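/- **Notation.** For $a\in\mathbb R$ let $L^2_a=\{f: e^{ax}f\in L^2(\mathbb R;\mathbb C)\}$ with $\|f\|_a=\|e^{ax}f\|_{L^2}$, and let $H^s_a$ be the space with norm $\|f\|_{H^s_a}=\|e^{ax}f\|_{H^s}=\big(\frac1{2\pi}\int_{\mathbb R}(1+k^2)^s|\hat f(k+ia)|^2\,dk\big)^{1/2}$, where $\hat f(k+ia)=\int e^{-ikx}e^{ax}f(x)\,dx$. A Fourier multiplier $m(D)$, $D=-i\partial$, acts in $L^2_a$ by multiplying $\hat f(k+ia)$ by $m(k+ia)$; in particular $\partial=iD$. Operators are taken on their natural domains, $[X,Y]=XY-YX$, and functions also denote the corresponding multiplication operators. **The solitary wave.** Let $0<\alpha\le\frac12$, $m\ge2$ an integer, $\mu\in(0,1)$. For $\varepsilon\in(0,1)$ put $\gamma=1-\varepsilon^2$, $a=\alpha\varepsilon$. Let $\omega:\mathbb R\to\mathbb R$ be an even solution of $$\omega=\Big(1-\gamma\frac{\tanh D}{D}\Big)^{-1}\left(\frac{\frac32\omega^2+\omega^3-\frac12\tau^2(1-2\gamma\bar\eta)}{(1+\omega)^2}\right),\qquad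 \bar\eta=\frac{\tanh D}{D}\,\omega,\quad \tau=i\tanh D\,\omega,$$ of the form $\omega(x)=\varepsilon^2\Omega(\varepsilon x)$ with $\|\Omega-\operatorname{sech}^2(\sqrt3\,\cdot/2)\|_{H^m_\alpha}<\varepsilon^{\mu}$ (the small solitary water wave with squared Froude number $1/\gamma$, described by its Riemann strain). Set $$u_1=\frac{\omega+\omega^2+\tau^2}{(1+\omega)^2+\tau^2},\quad \bar v=\frac{-\tau}{(1+\omega)^2+\tau^2},\quad v_1=\frac{(1-u_1)\,\bar v'}{\gamma(1+\omega)},$$ $$p=\frac{1-u_1}{1+\omega},\qquad q=\sqrt{\frac{1-v_1}{1+\omega}},\qquad \rho=\sqrt q .$$ **The operator.** Let $S=\sqrt{-\gamma D\tanh D}$ (symbol $\sqrt{-\gamma\xi\tanh\xi}$, principal root, $\xi=k+ia$), $R_1=q'pq^{-1}$, $R_2=p'+[p,S]S^{-1}\partial$, and $$\mathcal A=\begin{pmatrix}\mathcal A_{11}&J_{12}\\J_{21}&\mathcal A_{22}\end{pmatrix},\qquad \begin{aligned}\mathcal A_{11}&=\partial+S+\partial(p-1)+S(q-1)+J_{11},\\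 \mathcal A_{22}&=\sqrt p\,\partial\sqrt p-\sqrt q\,S\sqrt q+J_{22},\end{aligned}$$ $$\begin{pmatrix}J_{11}&J_{12}\\J_{21}&J_{22}\end{pmatrix}=-\frac12\begin{pmatrix}R_2+R_1+[S,q]&R_1-R_2-[S,q]\\R_1-R_2+[S,q]&R_1+[p,S]S^{-1}\partial+[[S,\rho],\rho]\end{pmatrix},$$ an unbounded operator in the Hilbert space $(L^2_a)^2$. **Statement.** Let $0<\alpha\le\frac12$ and $0<\nu<\hat\nu<1$ (and fix $m\ge2$, $\mu\in(0,1)$ as above). There are constants $\varepsilon_0>0$ and $K>0$ such that for every $0<\varepsilon<\varepsilon_0$ and every $\omega$ as above, with $a=\alpha\varepsilon$: the operator $\mathcal A$ has domain $(H^1_a)^2$, and every $\lambda\in\mathbb C$ with $$|\lambda|\ge\varepsilon^{\nu}\quad\text{and}\quad \operatorname{Re}\lambda\ge-\tfrac1{12}\,\alpha\,\varepsilon^{1+2\hat\nu}$$ belongs to the resolvent set of $\mathcal A$, with $\|(\lambda-\mathcal A)^{-1}\|_a\le K/\varepsilon^{1+2\hat\nu}$, where $\|\cdot\|_a$ is the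 operator norm on $(L^2_a)^2$. Here $K$ does not depend on $\varepsilon$, $\lambda$ or $\omega$. -/

import Mathlib

open MeasureTheory
open scoped ENNReal FourierTransform

noncomputable section

namespace SolitaryWave

/-! ### Unbounded operators -/

/-- Composition `B ∘ A` of unbounded operators, on its natural domain
`{x ∈ D(A) | A x ∈ D(B)}`. -/
def pcomp {E F G : Type*} [AddCommGroup E] [Module ℂ E] [AddCommGroup F] [Module ℂ F]
    [AddCommGroup G] [Module ℂ G] (B : F →ₗ.[ℂ] G) (A : E →ₗ.[ℂ] F) : E →ₗ.[ℂ] G where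
  domain := (B.domain.comap A.toFun).map A.domain.subtype
  toFun :=
    { toFun := fun x =>
        B ⟨A ⟨x.1, by obtain ⟨y, -, h⟩ := x.2; exact h ▸ y.2⟩, by
          obtain ⟨x, y, hy, rfl⟩ := x; exact hy⟩
      map_add' := fun x y => by
        rw [← LinearPMap.map_add]
        congr 1
        ext1
        exact A.toFun.map_add ⟨x.1, _⟩ ⟨y.1, _⟩
      map_smul' := fun c x => by
        rw [RingHom.id_apply, ← LinearPMap.map_smul]
        congr 1
        ext1
        exact A.toFun.map_smul c ⟨x.1, _⟩ }

infixr:80 " ⊚ " => pcomp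

/-- The commutator `[A, B] = A B - B A`, on its natural domain. -/
def comm {E : Type*} [AddCommGroup E] [Module ℂ E] (A B : E →ₗ.[ℂ] E) : E →ₗ.[ℂ] E :=
  A ⊚ B - B ⊚ A

/-- A bounded operator `R` is the resolvent `(lam - A)⁻¹`: it maps into the domain of `A` and is a
two-sided inverse of `lam - A`. -/
structure IsResolventAt {E : Type*} [NormedAddCommGroup E] [NormedSpace ℂ E]
    (A : E →ₗ.[ℂ] E) (lam : ℂ) (R : E →L[ℂ] E) : Prop where
  mem_domain : ∀ y, R y ∈ A.domain
  right_inv : ∀ y, lam • R y - A ⟨R y, mem_domain y⟩ = y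
  left_inv : ∀ x : A.domain, R (lam • (x : E) - A x) = x

/-- The operator matrix `(A₁₁, A₁₂; A₂₁, A₂₂)` acting in the Hilbert space `E × E`, on its natural
domain `(D(A₁₁) ∩ D(A₂₁)) × (D(A₁₂) ∩ D(A₂₂))`. -/
def blockOp {E : Type*} [NormedAddCommGroup E] [NormedSpace ℂ E]
    (A₁₁ A₁₂ A₂₁ A₂₂ : E →ₗ.[ℂ] E) : WithLp 2 (E × E) →ₗ.[ℂ] WithLp 2 (E × E) where
  domain := ((A₁₁.domain ⊓ A₂₁.domain).prod (A₁₂.domain ⊓ A₂₂.domain)).comap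
    (WithLp.linearEquiv 2 ℂ (E × E)).toLinearMap
  toFun :=
    { toFun := fun z => WithLp.toLp 2
        (A₁₁ ⟨z.1.fst, z.2.1.1⟩ + A₁₂ ⟨z.1.snd, z.2.2.1⟩,
         A₂₁ ⟨z.1.fst, z.2.1.2⟩ + A₂₂ ⟨z.1.snd, z.2.2.2⟩)
      map_add' := fun z w => by
        have h₁₁ := A₁₁.map_add ⟨z.1.fst, z.2.1.1⟩ ⟨w.1.fst, w.2.1.1⟩
        have h₁₂ := A₁₂.map_add ⟨z.1.snd, z.2.2.1⟩ ⟨w.1.snd, w.2.2.1⟩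
        have h₂₁ := A₂₁.map_add ⟨z.1.fst, z.2.1.2⟩ ⟨w.1.fst, w.2.1.2⟩
        have h₂₂ := A₂₂.map_add ⟨z.1.snd, z.2.2.2⟩ ⟨w.1.snd, w.2.2.2⟩
        rw [← WithLp.toLp_add]
        refine congrArg (WithLp.toLp 2) (Prod.ext ?_ ?_)
        · exact (congrArg₂ (· + ·) h₁₁ h₁₂).trans (add_add_add_comm _ _ _ _)
        · exact (congrArg₂ (· + ·) h₂₁ h₂₂).trans (add_add_add_comm _ _ _ _)
      map_smul' := fun c z => by
        have h₁₁ := A₁₁.map_smul c ⟨z.1.fst, z.2.1.1⟩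
        have h₁₂ := A₁₂.map_smul c ⟨z.1.snd, z.2.2.1⟩
        have h₂₁ := A₂₁.map_smul c ⟨z.1.fst, z.2.1.2⟩
        have h₂₂ := A₂₂.map_smul c ⟨z.1.snd, z.2.2.2⟩
        rw [RingHom.id_apply, ← WithLp.toLp_smul]
        refine congrArg (WithLp.toLp 2) (Prod.ext ?_ ?_)
        · exact (congrArg₂ (· + ·) h₁₁ h₁₂).trans (smul_add _ _ _).symm
        · exact (congrArg₂ (· + ·) h₂₁ h₂₂).trans (smul_add _ _ _).symm }

/-- Pointwise multiplication by `g` in `L²(μ)`, on its maximal domain. -/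
def mulOp (μ : Measure ℝ) (g : ℝ → ℂ) : Lp ℂ 2 μ →ₗ.[ℂ] Lp ℂ 2 μ where
  domain :=
    { carrier := {f | MemLp (fun x => g x * f x) 2 μ}
      add_mem' := fun {f₁ f₂} h₁ h₂ => (memLp_congr_ae (by
        filter_upwards [Lp.coeFn_add f₁ f₂] with x hx
        change g x * (f₁ + f₂ : Lp ℂ 2 μ) x = _
        rw [hx]; exact mul_add _ _ _)).2 (h₁.add h₂)
      zero_mem' := (memLp_congr_ae (by
        filter_upwards [Lp.coeFn_zero ℂ 2 μ] with x hx
        change g x * (0 : Lp ℂ 2 μ) x = 0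
        rw [hx]; exact mul_zero _)).2 (MemLp.zero (ε := ℂ))
      smul_mem' := fun c f h => (memLp_congr_ae (by
        filter_upwards [Lp.coeFn_smul c f] with x hx
        simp [hx, mul_left_comm])).2 (h.const_mul c) }
  toFun :=
    { toFun := fun f => MemLp.toLp (fun x => g x * f.1 x) f.2
      map_add' := fun f₁ f₂ => by
        rw [← MemLp.toLp_add]
        apply MemLp.toLp_congr
        filter_upwards [Lp.coeFn_add f₁.1 f₂.1] with x hx
        change g x * (f₁.1 + f₂.1 : Lp ℂ 2 μ) x = _
        rw [hx]; exact mul_add _ _ _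
      map_smul' := fun c f => by
        rw [RingHom.id_apply, ← MemLp.toLp_const_smul]
        apply MemLp.toLp_congr
        filter_upwards [Lp.coeFn_smul c f.1] with x hx
        simp [hx, mul_left_comm] }

/-! ### The weighted spaces `L²_a`, `H^s_a` and Fourier multipliers on them -/

/-- The measure `e^{2ax} dx` on `ℝ`. -/
def wMeasure (a : ℝ) : Measure ℝ :=
  volume.withDensity fun x => ENNReal.ofReal (Real.exp (a * x)) ^ (2 : ℝ)

/-- `L²_a = {f | e^{ax} f ∈ L²(ℝ)}` with norm `‖f‖_a = ‖e^{ax} f‖_{L²}`. -/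
abbrev L2w (a : ℝ) : Type := Lp ℂ 2 (wMeasure a)

theorem measurable_weight (a : ℝ) :
    Measurable fun x : ℝ => ENNReal.ofReal (Real.exp (a * x)) ^ (2 : ℝ) := by
  fun_prop

theorem wMeasure_ac (a : ℝ) : wMeasure a ≪ volume := withDensity_absolutelyContinuous _ _

theorem ac_wMeasure (a : ℝ) : volume ≪ wMeasure a :=
  withDensity_absolutelyContinuous' (measurable_weight a).aemeasurable
    (Filter.Eventually.of_forall fun x => by simp [Real.exp_pos])

theorem eLpNorm_weight (a : ℝ) (f : ℝ → ℂ) :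
    eLpNorm (fun x => (Real.exp (a * x) : ℂ) * f x) 2 volume = eLpNorm f 2 (wMeasure a) := by
  simp only [eLpNorm_eq_lintegral_rpow_enorm_toReal (p := 2) (by norm_num) (by norm_num),
    ENNReal.toReal_ofNat, wMeasure]
  rw [lintegral_withDensity_eq_lintegral_mul_non_measurable _ (measurable_weight a)
    (Filter.Eventually.of_forall fun x => by
      exact ENNReal.rpow_lt_top_of_nonneg (by norm_num) ENNReal.ofReal_ne_top)]
  congr 2
  ext x
  rw [enorm_mul, ENNReal.mul_rpow_of_nonneg _ _ (by norm_num)]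
  congr 2
  rw [← ofReal_norm, Complex.norm_real, Real.norm_of_nonneg (Real.exp_pos _).le]

theorem memLp_weight {a : ℝ} {f : ℝ → ℂ} (hf : MemLp f 2 (wMeasure a)) :
    MemLp (fun x => (Real.exp (a * x) : ℂ) * f x) 2 volume :=
  ⟨(by fun_prop : AEStronglyMeasurable (fun x : ℝ => (Real.exp (a * x) : ℂ)) volume).mul
    (hf.1.mono_ac (ac_wMeasure a)), (eLpNorm_weight a f).trans_lt hf.2⟩

theorem memLp_unweight (a : ℝ) {f : ℝ → ℂ} (hf : MemLp f 2 volume) :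
    MemLp (fun x => (Real.exp (-(a * x)) : ℂ) * f x) 2 (wMeasure a) := by
  refine ⟨((by fun_prop : AEStronglyMeasurable
    (fun x : ℝ => (Real.exp (-(a * x)) : ℂ)) volume).mul hf.1).mono_ac (wMeasure_ac a), ?_⟩
  rw [← eLpNorm_weight]
  convert hf.2 using 3 with x
  rw [← mul_assoc, ← Complex.ofReal_mul, ← Real.exp_add]
  simp

/-- The isometric isomorphism `f ↦ e^{ax} f` of `L²_a` onto `L²`. -/
def weight (a : ℝ) : L2w a ≃ₗᵢ[ℂ] Lp ℂ 2 (volume : Measure ℝ) where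
  toFun f := (memLp_weight (Lp.memLp f)).toLp
  invFun F := (memLp_unweight a (Lp.memLp F)).toLp
  map_add' f g := by
    rw [← MemLp.toLp_add]
    apply MemLp.toLp_congr
    filter_upwards [ac_wMeasure a (Lp.coeFn_add f g)] with x hx
    rw [hx]; exact mul_add _ _ _
  map_smul' c f := by
    rw [RingHom.id_apply, ← MemLp.toLp_const_smul]
    apply MemLp.toLp_congr
    filter_upwards [ac_wMeasure a (Lp.coeFn_smul c f)] with x hx
    simp [hx, mul_left_comm]
  left_inv f := by
    refine Lp.ext ?_
    filter_upwards [MemLp.coeFn_toLp (memLp_unweight a (Lp.memLp (memLp_weight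
      (Lp.memLp f)).toLp)), wMeasure_ac a (MemLp.coeFn_toLp (memLp_weight (Lp.memLp f)))]
      with x h₁ h₂
    rw [h₁, h₂, ← mul_assoc, ← Complex.ofReal_mul, ← Real.exp_add]
    simp
  right_inv F := by
    refine Lp.ext ?_
    filter_upwards [MemLp.coeFn_toLp (memLp_weight (Lp.memLp (memLp_unweight a
      (Lp.memLp F)).toLp)), ac_wMeasure a (MemLp.coeFn_toLp (memLp_unweight a (Lp.memLp F)))]
      with x h₁ h₂
    rw [h₁, h₂, ← mul_assoc, ← Complex.ofReal_mul, ← Real.exp_add]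
    simp
  norm_map' f := by
    change ‖(memLp_weight (Lp.memLp f)).toLp‖ = ‖f‖
    rw [Lp.norm_toLp, eLpNorm_weight, Lp.norm_def]

/-- The norm of `H^s_a`:
`‖f‖² = (1/2π) ∫ (1 + k²)^s |f̂(k + ia)|² dk`, where `f̂(· + ia)` is the Fourier transform of
`e^{ax} f`. Mathlib's frequency variable is `κ = k / 2π`. It is `∞` if `f ∉ H^s_a`. -/
def sobolevNorm (a s : ℝ) (f : L2w a) : ℝ≥0∞ :=
  eLpNorm (fun κ : ℝ => (((1 + (2 * Real.pi * κ) ^ 2) ^ (s / 2) : ℝ) : ℂ) *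
    (𝓕 (weight a f) : Lp ℂ 2 (volume : Measure ℝ)) κ) 2 volume

/-- The Fourier multiplier `m(D)` in `L²_a`, on its maximal domain: it is `e^{-ax} m(D + ia) e^{ax}`,
where `m(D + ia)` multiplies the Fourier transform at wavenumber `k = 2πκ` by `m(k + ia)`. -/
def fourierOp (a : ℝ) (m : ℂ → ℂ) : L2w a →ₗ.[ℂ] L2w a :=
  ((weight a).trans (Lp.fourierTransformₗᵢ ℝ ℂ)).symm.toLinearEquiv.toLinearMap.toPMap ⊤ ⊚
    mulOp volume (fun κ => m ((2 * Real.pi * κ : ℝ) + Complex.I * a)) ⊚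
    ((weight a).trans (Lp.fourierTransformₗᵢ ℝ ℂ)).toLinearEquiv.toLinearMap.toPMap ⊤

/-- Multiplication by a real function `g` in `L²_a`. -/
def mult (a : ℝ) (g : ℝ → ℝ) : L2w a →ₗ.[ℂ] L2w a := mulOp (wMeasure a) fun x => g x

/-- The Fourier multiplier `m(D)` acting on an integrable real function `f`, as a pointwise defined
function, for symbols with `m(-k) = conj (m k)` (so that the value before taking the real part is
already real). -/
def fourierFun (m : ℂ → ℂ) (f : ℝ → ℝ) (x : ℝ) : ℝ :=
  (𝓕⁻ (fun κ : ℝ => m ((2 * Real.pi * κ : ℝ) : ℂ) * 𝓕 (fun y : ℝ => (f y : ℂ)) κ) x).re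

/-! ### The solitary wave -/

/-- `γ = 1 - ε²`, the inverse square of the Froude number. -/
def gam (ε : ℝ) : ℝ := 1 - ε ^ 2

/-- The function `tanh ξ / ξ`, with its value `1` at `ξ = 0`. -/
def tanhc (ξ : ℂ) : ℂ := if ξ = 0 then 1 else Complex.tanh ξ / ξ

/-- The surface elevation in the flattened variable, `(tanh D / D) ω`. -/
def etaBar (ω : ℝ → ℝ) : ℝ → ℝ := fourierFun tanhc ω

/-- `(i tanh D) ω`. -/
def tau (ω : ℝ → ℝ) : ℝ → ℝ := fourierFun (fun k => Complex.I * Complex.tanh k) ω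

/-- The right-hand side nonlinearity of the solitary wave equation. -/
def nonlin (ε : ℝ) (ω : ℝ → ℝ) (x : ℝ) : ℝ :=
  (3 / 2 * ω x ^ 2 + ω x ^ 3 - 1 / 2 * tau ω x ^ 2 * (1 - 2 * gam ε * etaBar ω x)) /
    (1 + ω x) ^ 2

/-- `ω` is the Riemann strain of the small solitary wave with parameter `ε`: an even solution of
`ω = (1 - γ tanh D / D)⁻¹ N(ω)` of the form `ω(x) = ε² Ω(ε x)` with
`‖Ω - sech²(√3 · / 2)‖_{H^m_α} < ε^μ`. -/
structure IsSolitaryWave (α : ℝ) (m : ℕ) (μ ε : ℝ) (ω : ℝ → ℝ) : Prop where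
  even : ∀ x, ω (-x) = ω x
  near_sech : ∃ f : L2w α,
    (f =ᵐ[wMeasure α] fun x =>
      ((ω (x / ε) / ε ^ 2 - 1 / Real.cosh (√3 * x / 2) ^ 2 : ℝ) : ℂ)) ∧
    sobolevNorm α m f < ENNReal.ofReal (ε ^ μ)
  fixed_point : ∀ x, ω x = fourierFun (fun k => (1 - (gam ε : ℂ) * tanhc k)⁻¹) (nonlin ε ω) x

/-- Horizontal surface velocity in the flattened variable. -/
def u₁ (ω : ℝ → ℝ) (x : ℝ) : ℝ :=
  (ω x + ω x ^ 2 + tau ω x ^ 2) / ((1 + ω x) ^ 2 + tau ω x ^ 2)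

/-- Vertical surface velocity in the flattened variable. -/
def vBar (ω : ℝ → ℝ) (x : ℝ) : ℝ := -tau ω x / ((1 + ω x) ^ 2 + tau ω x ^ 2)

/-- The coefficient `v₁ = (1 - u₁) v̄' / (γ (1 + ω))`. -/
def v₁ (ε : ℝ) (ω : ℝ → ℝ) (x : ℝ) : ℝ :=
  (1 - u₁ ω x) * deriv (vBar ω) x / (gam ε * (1 + ω x))

/-- The coefficient `p = (1 - u₁) / (1 + ω)`. -/
def p (ω : ℝ → ℝ) (x : ℝ) : ℝ := (1 - u₁ ω x) / (1 + ω x)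

/-- The coefficient `q = √((1 - v₁) / (1 + ω))`. -/
def q (ε : ℝ) (ω : ℝ → ℝ) (x : ℝ) : ℝ := √((1 - v₁ ε ω x) / (1 + ω x))

/-- The coefficient `ρ = √q`. -/
def rho (ε : ℝ) (ω : ℝ → ℝ) (x : ℝ) : ℝ := √(q ε ω x)

/-! ### The linearized operator in `(L²_a)²` -/

/-- `∂ = iD`, with domain `H¹_a`. -/
def dOp (a : ℝ) : L2w a →ₗ.[ℂ] L2w a := fourierOp a fun ξ => Complex.I * ξ

/-- The symbol `√(-γ ξ tanh ξ)` (principal square root). -/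
def sSymbol (ε : ℝ) (ξ : ℂ) : ℂ := (-(gam ε : ℂ) * ξ * Complex.tanh ξ) ^ (1 / 2 : ℂ)

/-- `S = √(-γ D tanh D)`. -/
def sOp (a ε : ℝ) : L2w a →ₗ.[ℂ] L2w a := fourierOp a (sSymbol ε)

/-- `S⁻¹`. -/
def sInvOp (a ε : ℝ) : L2w a →ₗ.[ℂ] L2w a := fourierOp a fun ξ => (sSymbol ε ξ)⁻¹

/-- `[p, S] S⁻¹ ∂`. -/
def pCommOp (a ε : ℝ) (ω : ℝ → ℝ) : L2w a →ₗ.[ℂ] L2w a :=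
  comm (mult a (p ω)) (sOp a ε) ⊚ sInvOp a ε ⊚ dOp a

/-- `R₁ = q' p q⁻¹`. -/
def R₁ (a ε : ℝ) (ω : ℝ → ℝ) : L2w a →ₗ.[ℂ] L2w a :=
  mult a fun x => deriv (q ε ω) x * p ω x * (q ε ω x)⁻¹

/-- `R₂ = p' + [p, S] S⁻¹ ∂`. -/
def R₂ (a ε : ℝ) (ω : ℝ → ℝ) : L2w a →ₗ.[ℂ] L2w a :=
  mult a (deriv (p ω)) + pCommOp a ε ω

/-- `[S, q]`. -/
def qComm (a ε : ℝ) (ω : ℝ → ℝ) : L2w a →ₗ.[ℂ] L2w a :=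
  comm (sOp a ε) (mult a (q ε ω))

def J₁₁ (a ε : ℝ) (ω : ℝ → ℝ) : L2w a →ₗ.[ℂ] L2w a :=
  (-(1 / 2) : ℂ) • (R₂ a ε ω + R₁ a ε ω + qComm a ε ω)

def J₁₂ (a ε : ℝ) (ω : ℝ → ℝ) : L2w a →ₗ.[ℂ] L2w a :=
  (-(1 / 2) : ℂ) • (R₁ a ε ω - R₂ a ε ω - qComm a ε ω)

def J₂₁ (a ε : ℝ) (ω : ℝ → ℝ) : L2w a →ₗ.[ℂ] L2w a :=
  (-(1 / 2) : ℂ) • (R₁ a ε ω - R₂ a ε ω + qComm a ε ω)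

def J₂₂ (a ε : ℝ) (ω : ℝ → ℝ) : L2w a →ₗ.[ℂ] L2w a :=
  (-(1 / 2) : ℂ) • (R₁ a ε ω + pCommOp a ε ω +
    comm (comm (sOp a ε) (mult a (rho ε ω))) (mult a (rho ε ω)))

/-- `A₁₁ = (∂ + S) + (∂ u_p + S u_q) + J₁₁` with `u_p = p - 1`, `u_q = q - 1`. -/
def A₁₁ (a ε : ℝ) (ω : ℝ → ℝ) : L2w a →ₗ.[ℂ] L2w a :=
  (dOp a + sOp a ε) +
    (dOp a ⊚ mult a (fun x => p ω x - 1) + sOp a ε ⊚ mult a (fun x => q ε ω x - 1)) +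
    J₁₁ a ε ω

/-- `A₂₂ = √p ∂ √p - √q S √q + J₂₂`. -/
def A₂₂ (a ε : ℝ) (ω : ℝ → ℝ) : L2w a →ₗ.[ℂ] L2w a :=
  (mult a (fun x => √(p ω x)) ⊚ dOp a ⊚ mult a (fun x => √(p ω x)) -
    mult a (rho ε ω) ⊚ sOp a ε ⊚ mult a (rho ε ω)) + J₂₂ a ε ω

/-- The operator `𝒜 = (A₁₁, J₁₂; J₂₁, A₂₂)` in `(L²_a)²`. -/
def opA (a ε : ℝ) (ω : ℝ → ℝ) :
    WithLp 2 (L2w a × L2w a) →ₗ.[ℂ] WithLp 2 (L2w a × L2w a) :=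
  blockOp (A₁₁ a ε ω) (J₁₂ a ε ω) (J₂₁ a ε ω) (A₂₂ a ε ω)

end SolitaryWave

end

open MeasureTheory
open scoped ENNReal FourierTransform

noncomputable section

namespace SolitaryWave

/-! The mechanism is a spectral gap created by the exponential weight. On `L²_a` the operator `m(D)`
is multiplication by `m(k + ia)` on the Fourier side, so `∂` has real part exactly `-a`. The symbol
of `S` satisfies `0 < Re S ≤ a + a³` at every frequency, and `Re S ≤ a - aδ²/16` as soon as `|k| ≥
δ`, because `|S/ξ|` is controlled by the square root of `|tanh ξ / ξ|`, which falls off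
quadratically near `k = 0`. Hence `∂ - S` is dissipative at rate `a`, while `∂ + S` is dissipative
at a rate of order `aδ²`, but only on `|k| ≥ δ`. For `|k| < δ` the symbol of `∂ + S` is at most `3(δ
+ a)`, which is small compared with `|lam| ≥ θ = ε^ν` when `δ` is small compared with `θ`; there
`lam - ∂ - S` is invertible by size alone. Taking `δ = ε^ν'` with `ν < ν' < ν̂`, the gap `aδ²`
dominates both `ε^(1+2ν̂)` and `ε³`.

The variable coefficients are a perturbation. The functions `p - 1`, `q - 1`, `√p - 1`, `ρ - 1` are
`O(ε²)` and live on the scale `1/ε`, so every commutator with `∂` or `S` is `O(ε³)`, below the gap.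
Modulo such bounded errors the diagonal entries are `√p ∂ √p ± ρ S ρ`, whose real parts are those of
`∂` and `S` tested on `√p f` and `ρ f`; replacing these by `f` costs `O(aε²)`. The off-diagonal
entries are themselves `O(ε³)`. The term `[p, S] S⁻¹ ∂` is bounded because the Lipschitz constant of
`S` decays like `(1 + |k|)^(-1/2)` while `S⁻¹ ∂` grows at most like the inverse
(`norm_sSymbol_sub_mul_le`, `exists_FM_mulB`).

Smallness of the coefficients is measured in a Wiener algebra with weight `1 + |η|/ε`. The
hypothesis on `ω` controls only one end of the line, but evenness recovers the other
(`exists_wiener_of_isSolitaryWave`). Since `q` contains one derivative and `R₁` differentiates `q`,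
a second power of the weight is needed; it comes from the fixed point equation
(`exists_wiener_sq_of_fixed_point`).

Together these give the lower bound `apriori` for `lam - 𝒜` on the whole region. At `lam = 4` the
resolvent exists by perturbation of the constant coefficient operator, and it is continued along
segments inside the region, the lower bound controlling its norm at each step
(`exists_isResolventAt_of_region`). -/

/-! ### Weighted Wiener algebras -/

/-- A continuous, even, submultiplicative weight on `ℝ` that is at least `1`. -/
structure IsWeight (φ : ℝ → ℝ) : Prop where
  cont : Continuous φ
  one_le : ∀ x, 1 ≤ φ x
  mul_le : ∀ x y, φ (x + y) ≤ φ x * φ y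
  even : ∀ x, φ (-x) = φ x

theorem IsWeight.pos {φ : ℝ → ℝ} (h : IsWeight φ) (x : ℝ) : 0 < φ x :=
  zero_lt_one.trans_le (h.one_le x)

theorem IsWeight.mul {φ ψ : ℝ → ℝ} (h : IsWeight φ) (h' : IsWeight ψ) :
    IsWeight fun x => φ x * ψ x where
  cont := h.cont.mul h'.cont
  one_le x := one_le_mul_of_one_le_of_one_le (h.one_le x) (h'.one_le x)
  mul_le x y := by
    have := mul_le_mul (h.mul_le x y) (h'.mul_le x y) (h'.pos _).le
      (mul_pos (h.pos x) (h.pos y)).le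
    linarith
  even x := by rw [h.even, h'.even]

/-- The real function `g` is the inverse Fourier transform of `G`, with `φ G` integrable. -/
structure WienerRep (φ : ℝ → ℝ) (g : ℝ → ℝ) (G : ℝ → ℂ) : Prop where
  meas : AEStronglyMeasurable G volume
  weighted : Integrable fun η => φ η * ‖G η‖
  eq : ∀ x, (g x : ℂ) = 𝓕⁻ G x

/-- `g` belongs to the Wiener algebra with weight `φ`, with norm at most `N`. -/
def Wiener (φ : ℝ → ℝ) (g : ℝ → ℝ) (N : ℝ) : Prop :=
  ∃ G, WienerRep φ g G ∧ ∫ η, φ η * ‖G η‖ ≤ N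

theorem integrable_of_weighted {φ : ℝ → ℝ} (hφ : IsWeight φ) {G : ℝ → ℂ}
    (hm : AEStronglyMeasurable G volume) (h : Integrable fun η => φ η * ‖G η‖) : Integrable G :=
  h.mono' hm (Filter.Eventually.of_forall fun x =>
    le_mul_of_one_le_left (norm_nonneg _) (hφ.one_le x))

theorem WienerRep.integrable {φ : ℝ → ℝ} (hφ : IsWeight φ) {g : ℝ → ℝ} {G : ℝ → ℂ}
    (h : WienerRep φ g G) : Integrable G := integrable_of_weighted hφ h.meas h.weighted

theorem fourierInv_apply_eq (G : ℝ → ℂ) (x : ℝ) :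
    𝓕⁻ G x = ∫ η : ℝ, Complex.exp (2 * Real.pi * (η * x) * Complex.I) * G η := by
  rw [Real.fourierInv_eq']
  congr 1
  ext η
  simp [mul_comm]

theorem norm_exp_char (η x : ℝ) :
    ‖Complex.exp (2 * Real.pi * (η * x) * Complex.I)‖ = 1 := by
  rw [← Complex.norm_exp_ofReal_mul_I (2 * Real.pi * (η * x))]; push_cast; rfl

theorem integrable_exp_mul {G : ℝ → ℂ} (hG : Integrable G) (x : ℝ) :
    Integrable fun η : ℝ => Complex.exp (2 * Real.pi * (η * x) * Complex.I) * G η := by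
  refine hG.norm.mono' (by
    refine AEStronglyMeasurable.mul (Continuous.aestronglyMeasurable (by fun_prop)) hG.1) ?_
  exact Filter.Eventually.of_forall fun η => by rw [norm_mul, norm_exp_char, one_mul]

theorem norm_fourierInv_le (G : ℝ → ℂ) (x : ℝ) : ‖𝓕⁻ G x‖ ≤ ∫ η, ‖G η‖ := by
  rw [fourierInv_apply_eq]
  refine (norm_integral_le_integral_norm _).trans (le_of_eq ?_)
  simp only [norm_mul, norm_exp_char, one_mul]

theorem continuous_fourierInv {G : ℝ → ℂ} (hG : Integrable G) : Continuous (𝓕⁻ G) := by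
  have : (𝓕⁻ G) = fun x : ℝ => ∫ η : ℝ, Complex.exp (2 * Real.pi * (η * x) * Complex.I) * G η :=
    funext (fourierInv_apply_eq G)
  rw [this]
  refine continuous_of_dominated (bound := fun η => ‖G η‖)
    (fun x => (integrable_exp_mul hG x).1) (fun x => Filter.Eventually.of_forall fun η => by
      rw [norm_mul, norm_exp_char, one_mul]) hG.norm
    (Filter.Eventually.of_forall fun η => by fun_prop)

namespace Wiener

variable {φ : ℝ → ℝ} {f g : ℝ → ℝ} {M N : ℝ}

theorem nonneg (hφ : IsWeight φ) (h : Wiener φ g N) : 0 ≤ N := by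
  obtain ⟨G, -, hN⟩ := h
  exact (integral_nonneg fun η => mul_nonneg (hφ.pos η).le (norm_nonneg _)).trans hN

theorem mono (h : Wiener φ g M) (hMN : M ≤ N) : Wiener φ g N := by
  obtain ⟨G, hG, hN⟩ := h
  exact ⟨G, hG, hN.trans hMN⟩

theorem congr (h : Wiener φ g N) (hfg : ∀ x, f x = g x) : Wiener φ f N := by
  rwa [show f = g from funext hfg]

theorem continuous (hφ : IsWeight φ) (h : Wiener φ g N) : Continuous g := by
  obtain ⟨G, hG, -⟩ := h
  have : g = fun x => (𝓕⁻ G x).re := by ext x; rw [← hG.eq]; simp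
  rw [this]
  exact Complex.continuous_re.comp (continuous_fourierInv (hG.integrable hφ))

theorem abs_le (hφ : IsWeight φ) (h : Wiener φ g N) (x : ℝ) : |g x| ≤ N := by
  obtain ⟨G, hG, hN⟩ := h
  calc |g x| = ‖(g x : ℂ)‖ := by simp
    _ ≤ ∫ η, ‖G η‖ := by rw [hG.eq]; exact norm_fourierInv_le G x
    _ ≤ ∫ η, φ η * ‖G η‖ := integral_mono (hG.integrable hφ).norm hG.weighted fun η =>
        le_mul_of_one_le_left (norm_nonneg _) (hφ.one_le η)
    _ ≤ N := hN

theorem of_weight_le {ψ : ℝ → ℝ} (hψ : IsWeight ψ) (hle : ∀ x, ψ x ≤ φ x)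
    (h : Wiener φ g N) : Wiener ψ g N := by
  obtain ⟨G, hG, hN⟩ := h
  have hi : Integrable fun η => ψ η * ‖G η‖ :=
    hG.weighted.mono' (hψ.cont.aestronglyMeasurable.mul hG.meas.norm)
      (Filter.Eventually.of_forall fun η => by
        rw [Real.norm_of_nonneg (mul_nonneg (hψ.pos η).le (norm_nonneg _))]
        exact mul_le_mul_of_nonneg_right (hle η) (norm_nonneg _))
  exact ⟨G, ⟨hG.meas, hi, hG.eq⟩, (integral_mono hi hG.weighted fun η =>
    mul_le_mul_of_nonneg_right (hle η) (norm_nonneg _)).trans hN⟩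

/-- The real part of an inverse Fourier transform belongs to the Wiener algebra. -/
theorem of_re (hφ : IsWeight φ) {G : ℝ → ℂ} (hm : AEStronglyMeasurable G volume)
    (hw : Integrable fun η => φ η * ‖G η‖) :
    Wiener φ (fun x => (𝓕⁻ G x).re) (∫ η, φ η * ‖G η‖) := by
  have hG := integrable_of_weighted hφ hm hw
  have hneg : MeasurePreserving (fun x : ℝ => -x) volume volume :=
    Measure.measurePreserving_neg volume
  have hm' : AEStronglyMeasurable (fun η => (starRingEnd ℂ) (G (-η))) volume :=
    Complex.continuous_conj.comp_aestronglyMeasurable (hm.comp_measurePreserving hneg)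
  have hw' : Integrable fun η => φ η * ‖G (-η)‖ := by
    have := hw.comp_neg
    simpa only [hφ.even] using this
  have hle : ∀ η, φ η * ‖(G η + (starRingEnd ℂ) (G (-η))) / 2‖ ≤
      (φ η * ‖G η‖ + φ η * ‖G (-η)‖) / 2 := fun η => by
    have := norm_add_le (G η) ((starRingEnd ℂ) (G (-η)))
    rw [norm_div, Complex.norm_conj] at *
    have h2 : ‖(2 : ℂ)‖ = 2 := by simp
    rw [h2]
    have := mul_le_mul_of_nonneg_left this (hφ.pos η).le
    linarith
  have hi : Integrable fun η => φ η * ‖(G η + (starRingEnd ℂ) (G (-η))) / 2‖ := by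
    refine ((hw.add hw').div_const 2).mono' (hφ.cont.aestronglyMeasurable.mul
      ((hm.add hm').div₀ aestronglyMeasurable_const).norm) (Filter.Eventually.of_forall fun η => ?_)
    rw [Real.norm_of_nonneg (mul_nonneg (hφ.pos η).le (norm_nonneg _))]
    exact hle η
  -- Hermitian symmetrization on the Fourier side corresponds to taking the real part, and it does
  -- not increase the norm because `φ` is even.
  refine ⟨fun η => (G η + (starRingEnd ℂ) (G (-η))) / 2,
    ⟨(hm.add hm').div₀ aestronglyMeasurable_const, hi, fun x => ?_⟩, ?_⟩
  · rw [fourierInv_apply_eq, fourierInv_apply_eq, Complex.re_eq_add_conj, ← integral_conj,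
      ← integral_neg_eq_self fun η : ℝ => (starRingEnd ℂ)
        (Complex.exp (2 * Real.pi * (η * x) * Complex.I) * G η), ← integral_add
        (integrable_exp_mul hG x), ← integral_div]
    · congr 1
      ext η
      have : (starRingEnd ℂ) (Complex.exp (2 * Real.pi * (((-η : ℝ) : ℂ) * x) * Complex.I)) =
          Complex.exp (2 * Real.pi * (η * x) * Complex.I) := by
        rw [← Complex.exp_conj]; congr 1; simp [Complex.conj_ofNat]
      rw [map_mul, this]; ring
    · have := ((integrable_exp_mul hG x).comp_neg)
      exact (Complex.conjCLE.toContinuousLinearMap).integrable_comp this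
  · refine (integral_mono hi ((hw.add hw').div_const 2) hle).trans (le_of_eq ?_)
    simp only [Pi.add_apply]
    rw [integral_div, integral_add hw hw']
    have : ∫ η, φ η * ‖G (-η)‖ = ∫ η, φ η * ‖G η‖ := by
      rw [← integral_neg_eq_self fun η => φ η * ‖G η‖]
      simp only [hφ.even]
    rw [this]; ring

theorem add (hφ : IsWeight φ) (hf : Wiener φ f M) (hg : Wiener φ g N) :
    Wiener φ (fun x => f x + g x) (M + N) := by
  obtain ⟨F, hF, hM⟩ := hf
  obtain ⟨G, hG, hN⟩ := hg
  have hle : ∀ η, φ η * ‖F η + G η‖ ≤ φ η * ‖F η‖ + φ η * ‖G η‖ := fun η => by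
    rw [← mul_add]; exact mul_le_mul_of_nonneg_left (norm_add_le _ _) (hφ.pos η).le
  have hi : Integrable fun η => φ η * ‖F η + G η‖ := by
    refine (hF.weighted.add hG.weighted).mono' (hφ.cont.aestronglyMeasurable.mul
      (hF.meas.add hG.meas).norm) (Filter.Eventually.of_forall fun η => ?_)
    rw [Real.norm_of_nonneg (mul_nonneg (hφ.pos η).le (norm_nonneg _))]
    exact hle η
  refine ⟨fun η => F η + G η, ⟨hF.meas.add hG.meas, hi, fun x => ?_⟩, ?_⟩
  · rw [Complex.ofReal_add, hF.eq, hG.eq, fourierInv_apply_eq, fourierInv_apply_eq,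
      fourierInv_apply_eq, ← integral_add (integrable_exp_mul (hF.integrable hφ) x)
      (integrable_exp_mul (hG.integrable hφ) x)]
    simp only [mul_add]
  · refine (integral_mono hi (hF.weighted.add hG.weighted) hle).trans ?_
    simp only [Pi.add_apply]
    rw [integral_add hF.weighted hG.weighted]
    exact add_le_add hM hN

theorem const_mul (c : ℝ) (hf : Wiener φ f M) :
    Wiener φ (fun x => c * f x) (|c| * M) := by
  obtain ⟨F, hF, hM⟩ := hf
  have hrw : (fun η => φ η * ‖(c : ℂ) * F η‖) = fun η => |c| * (φ η * ‖F η‖) := by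
    ext η; rw [norm_mul]; simp only [Complex.norm_real, Real.norm_eq_abs]; ring
  refine ⟨fun η => c * F η, ⟨hF.meas.const_mul _, ?_, fun x => ?_⟩, ?_⟩
  · rw [hrw]; exact hF.weighted.const_mul _
  · rw [Complex.ofReal_mul, hF.eq, fourierInv_apply_eq, fourierInv_apply_eq,
      ← integral_const_mul]
    congr 1; ext η; ring
  · rw [hrw, integral_const_mul]; exact mul_le_mul_of_nonneg_left hM (abs_nonneg _)

theorem sub (hφ : IsWeight φ) (hf : Wiener φ f M) (hg : Wiener φ g N) :
    Wiener φ (fun x => f x - g x) (M + N) :=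
  ((hf.add hφ (hg.const_mul (-1))).congr fun x => by ring).mono (by simp)

/-- A product becomes a convolution of transforms, and `φ η ≤ φ t * φ (η - t)` distributes the
weight over the two factors. -/
theorem mul (hφ : IsWeight φ) (hf : Wiener φ f M) (hg : Wiener φ g N) :
    Wiener φ (fun x => f x * g x) (M * N) := by
  have hM0 := hf.nonneg hφ
  obtain ⟨F, hF, hM⟩ := hf
  obtain ⟨G, hG, hN⟩ := hg
  have hFi := hF.integrable hφ
  have hGi := hG.integrable hφ
  set H : ℝ → ℂ := convolution F G (ContinuousLinearMap.mul ℂ ℂ) volume with hH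
  have hHi : Integrable H := hFi.integrable_convolution _ hGi
  set B : ℝ → ℝ := convolution (fun η => φ η * ‖F η‖) (fun η => φ η * ‖G η‖)
    (ContinuousLinearMap.mul ℝ ℝ) volume with hB
  have hBi : Integrable B := hF.weighted.integrable_convolution _ hG.weighted
  have hle : ∀ᵐ η, φ η * ‖H η‖ ≤ B η := by
    filter_upwards [hF.weighted.ae_convolution_exists (ContinuousLinearMap.mul ℝ ℝ) hG.weighted]
      with η hη
    rw [hH, hB, convolution_def, convolution_def, ← Real.norm_of_nonneg (hφ.pos η).le,
      ← norm_smul, ← integral_smul]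
    refine norm_integral_le_of_norm_le hη.integrable (Filter.Eventually.of_forall fun t => ?_)
    simp only [ContinuousLinearMap.mul_apply']
    rw [norm_smul, norm_mul, Real.norm_of_nonneg (hφ.pos η).le]
    have h1 := hφ.mul_le t (η - t)
    rw [add_sub_cancel] at h1
    calc φ η * (‖F t‖ * ‖G (η - t)‖) ≤ φ t * φ (η - t) * (‖F t‖ * ‖G (η - t)‖) := by gcongr
      _ = _ := by ring
  have hi : Integrable fun η => φ η * ‖H η‖ := by
    refine hBi.mono' (hφ.cont.aestronglyMeasurable.mul hHi.1.norm) ?_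
    filter_upwards [hle] with η hη
    rwa [Real.norm_of_nonneg (mul_nonneg (hφ.pos η).le (norm_nonneg _))]
  refine ⟨H, ⟨hHi.1, hi, fun x => ?_⟩, ?_⟩
  · rw [Real.fourierInv_eq_fourier_neg, hH, Real.fourier_mul_convolution_eq hFi hGi,
      Complex.ofReal_mul, hF.eq, hG.eq, Real.fourierInv_eq_fourier_neg,
      Real.fourierInv_eq_fourier_neg]
  · refine (integral_mono_ae hi hBi hle).trans ?_
    rw [hB, integral_convolution _ hF.weighted hG.weighted]
    exact mul_le_mul hM hN (integral_nonneg fun η => mul_nonneg (hφ.pos η).le (norm_nonneg _)) hM0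

theorem pow_succ (hφ : IsWeight φ) (hf : Wiener φ f M) (n : ℕ) :
    Wiener φ (fun x => f x ^ (n + 1)) (M ^ (n + 1)) := by
  induction n with
  | zero => simpa using hf
  | succ n ih => simpa only [_root_.pow_succ] using ih.mul hφ hf

theorem sq (hφ : IsWeight φ) (hf : Wiener φ f M) :
    Wiener φ (fun x => f x ^ 2) (M ^ 2) := hf.pow_succ hφ 1

/-- Absolutely convergent series. -/
theorem hasSum (hφ : IsWeight φ) {u : ℕ → ℝ → ℝ} {B : ℕ → ℝ} (hu : ∀ n, Wiener φ (u n) (B n))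
    {S : ℝ} (hB : HasSum B S) (hg : ∀ x, HasSum (fun n => u n x) (g x)) : Wiener φ g S := by
  choose G hG hN using hu
  have hGi : ∀ n, Integrable (G n) := fun n => (hG n).integrable hφ
  have hB0 : ∀ n, 0 ≤ B n := fun n =>
    (integral_nonneg fun η => mul_nonneg (hφ.pos η).le (norm_nonneg _)).trans (hN n)
  have hsum : Summable fun n => ∫ η, φ η * ‖G n η‖ :=
    Summable.of_nonneg_of_le (fun n => integral_nonneg fun η =>
      mul_nonneg (hφ.pos η).le (norm_nonneg _)) hN hB.summable
  have hmeas : AEStronglyMeasurable (fun η => ∑' n, G n η) volume :=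
    (AEMeasurable.tsum fun n => (hG n).meas.aemeasurable).aestronglyMeasurable
  have hlint : ∫⁻ η, ‖φ η * ‖∑' n, G n η‖‖ₑ ≤ ENNReal.ofReal S := by
    calc ∫⁻ η, ‖φ η * ‖∑' n, G n η‖‖ₑ ≤ ∫⁻ η, ∑' n, ‖φ η * ‖G n η‖‖ₑ := by
          refine lintegral_mono fun η => ?_
          simp only [enorm_mul, ENNReal.tsum_mul_left, enorm_norm]
          gcongr
          exact enorm_tsum_le_tsum_enorm
      _ = ∑' n, ∫⁻ η, ‖φ η * ‖G n η‖‖ₑ :=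
          lintegral_tsum fun n => ((hG n).weighted.1.enorm)
      _ ≤ ∑' n, ENNReal.ofReal (B n) := by
          refine ENNReal.tsum_le_tsum fun n => ?_
          rw [← ofReal_integral_norm_eq_lintegral_enorm (hG n).weighted]
          refine ENNReal.ofReal_le_ofReal (le_trans (le_of_eq ?_) (hN n))
          congr 1; ext η
          exact Real.norm_of_nonneg (mul_nonneg (hφ.pos η).le (norm_nonneg _))
      _ = ENNReal.ofReal S := by
          rw [← ENNReal.ofReal_tsum_of_nonneg hB0 hB.summable, hB.tsum_eq]
  have hint : Integrable fun η => φ η * ‖∑' n, G n η‖ :=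
    ⟨hφ.cont.aestronglyMeasurable.mul hmeas.norm, hlint.trans_lt ENNReal.ofReal_lt_top⟩
  refine ⟨fun η => ∑' n, G n η, ⟨hmeas, hint, fun x => ?_⟩, ?_⟩
  · have h1 : HasSum (fun n => ((u n x : ℝ) : ℂ)) (g x : ℂ) := Complex.hasSum_ofReal.2 (hg x)
    have h2 := hasSum_integral_of_summable_integral_norm
      (F := fun n (η : ℝ) => Complex.exp (2 * Real.pi * (η * x) * Complex.I) * G n η)
      (fun n => integrable_exp_mul (hGi n) x) (by
        refine Summable.of_nonneg_of_le (fun n => integral_nonneg fun η => norm_nonneg _)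
          (fun n => ?_) hsum
        refine integral_mono (integrable_exp_mul (hGi n) x).norm (hG n).weighted fun η => ?_
        simp only [norm_mul, norm_exp_char, one_mul]
        exact le_mul_of_one_le_left (norm_nonneg _) (hφ.one_le η))
    have h3 : (fun n => ((u n x : ℝ) : ℂ)) = fun n => ∫ η : ℝ,
        Complex.exp (2 * Real.pi * (η * x) * Complex.I) * G n η := by
      ext n; rw [(hG n).eq, fourierInv_apply_eq]
    rw [h3] at h1
    rw [h1.unique h2, fourierInv_apply_eq]
    simp only [tsum_mul_left]
  · have h0 : ∀ η, 0 ≤ φ η * ‖∑' n, G n η‖ := fun η => mul_nonneg (hφ.pos η).le (norm_nonneg _)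
    have hS : 0 ≤ S := hB.nonneg hB0
    rw [integral_eq_lintegral_of_nonneg_ae (Filter.Eventually.of_forall h0) hint.1]
    refine ENNReal.toReal_le_of_le_ofReal hS (le_trans (le_of_eq ?_) hlint)
    refine lintegral_congr fun η => ?_
    rw [Real.enorm_of_nonneg (h0 η)]

/-- Powers of functions close to `1` belong to the Wiener algebra, up to the constant `1`. -/
theorem exists_one_add_rpow (r : ℝ) : ∃ C, 1 ≤ C ∧ ∀ (φ : ℝ → ℝ), IsWeight φ → ∀ (w : ℝ → ℝ)
    (N : ℝ), Wiener φ w N → N ≤ 1 / 4 → Wiener φ (fun x => (1 + w x) ^ r - 1) (C * N) := by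
  have hp := Real.one_add_rpow_hasFPowerSeriesOnBall_zero (a := r)
  set c : ℕ → ℝ := fun n => Ring.choose r n with hc
  -- The binomial series has radius of convergence at least 1; evaluating at radius `1/2` gives `|c
  -- n| ≤ C * 2 ^ n`. With `N ≤ 1/4` the series is then dominated by a geometric one of ratio `2N ≤
  -- 1/2`, whose sum is at most `4CN`. The constant depends on `r` only, not on the weight.
  obtain ⟨C, hC0, hC⟩ := (binomialSeries ℝ r).norm_mul_pow_le_of_lt_radius (r := 1 / 2)
    (lt_of_lt_of_le (by norm_num) hp.r_le)
  have hcn : ∀ n, |c n| ≤ C * 2 ^ n := fun n => by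
    have h1 := hC n
    have h2 : ‖binomialSeries ℝ r n‖ = |c n| := by
      rw [binomialSeries, FormalMultilinearSeries.ofScalars_norm, Real.norm_eq_abs]
    rw [h2] at h1
    have h3 : (0 : ℝ) < 2 ^ n := by positivity
    have h4 : ((1 / 2 : NNReal) : ℝ) ^ n = (2 ^ n)⁻¹ := by
      push_cast; rw [one_div, inv_pow]
    rw [h4] at h1
    rwa [← div_eq_mul_inv, div_le_iff₀ h3] at h1
  refine ⟨4 * C + 1, by linarith, fun φ hφ w N hw hN => ?_⟩
  have hN0 := hw.nonneg hφ
  have hgeo : HasSum (fun n : ℕ => C * 2 * N * (2 * N) ^ n) (C * 2 * N * (1 - 2 * N)⁻¹) :=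
    (hasSum_geometric_of_lt_one (by linarith) (by linarith)).mul_left _
  have hsum := hasSum hφ (u := fun n x => c (n + 1) * w x ^ (n + 1))
    (g := fun x => (1 + w x) ^ r - 1) (fun n => ((hw.pow_succ hφ n).const_mul (c (n + 1))).mono
      (N := C * 2 * N * (2 * N) ^ n) ?_) hgeo ?_
  · refine hsum.mono ?_
    have : (1 - 2 * N)⁻¹ ≤ 2 := by
      rw [inv_le_comm₀ (by linarith) (by norm_num)]; linarith
    have : C * 2 * N * (1 - 2 * N)⁻¹ ≤ C * 2 * N * 2 := by gcongr
    nlinarith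
  · calc |c (n + 1)| * N ^ (n + 1) ≤ C * 2 ^ (n + 1) * N ^ (n + 1) := by
          gcongr; exact hcn _
      _ = C * 2 * N * (2 * N) ^ n := by ring
  · intro x
    have hx := hw.abs_le hφ x
    have h1 := hp.hasSum (y := w x) (by
      simp only [Metric.mem_eball, edist_zero_right]
      rw [Real.enorm_eq_ofReal_abs]
      exact_mod_cast ENNReal.ofReal_lt_one.2 (by linarith))
    simp only [zero_add, binomialSeries_apply] at h1
    have h2 : HasSum (fun n => c n * w x ^ n) ((1 + w x) ^ r) := by
      have h4 : (fun n => c n * w x ^ n) =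
          fun n => Ring.choose r n • (List.ofFn fun _ : Fin n => w x).prod := by
        ext n; simp [hc]
      rw [h4]; exact h1
    have h3 := (hasSum_nat_add_iff' (f := fun n => c n * w x ^ n) 1).2 h2
    simpa [hc] using h3

end Wiener

/-! ### Fourier transforms of integrable and of square integrable functions -/

theorem integral_fourier_mul_flip {f g : ℝ → ℂ} (hf : Integrable f) (hg : Integrable g) :
    ∫ x, 𝓕 f x * g x = ∫ x, f x * 𝓕 g x := by
  have := VectorFourier.integral_fourierIntegral_smul_eq_flip (L := innerₗ ℝ)
    (μ := (volume : Measure ℝ)) (ν := (volume : Measure ℝ)) Real.continuous_fourierChar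
    continuous_inner hf hg
  rw [flip_innerₗ] at this
  exact this

theorem integral_fourierInv_mul_flip {f g : ℝ → ℂ} (hf : Integrable f) (hg : Integrable g) :
    ∫ x, 𝓕⁻ f x * g x = ∫ x, f x * 𝓕⁻ g x := by
  have h1 : ∫ x, 𝓕⁻ f x * g x = ∫ x, 𝓕 f x * g (-x) := by
    rw [← integral_neg_eq_self fun x => 𝓕 f x * g (-x)]
    simp only [neg_neg, Real.fourierInv_eq_fourier_neg]
  rw [h1, integral_fourier_mul_flip hf hg.comp_neg, Real.fourierInv_eq_fourier_comp_neg]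

theorem ae_eq_of_integral_schwartz {f g : ℝ → ℂ} (hf : LocallyIntegrable f)
    (hg : LocallyIntegrable g)
    (h : ∀ u : SchwartzMap ℝ ℂ, ∫ x, u x * f x = ∫ x, u x * g x) : f =ᵐ[volume] g := by
  refine ae_eq_of_integral_contDiff_smul_eq hf hg fun u hu hc => ?_
  have h2 : HasCompactSupport fun x => (u x : ℂ) :=
    hc.comp_left (g := fun y : ℝ => (y : ℂ)) Complex.ofReal_zero
  have := h (h2.toSchwartzMap (Complex.ofRealCLM.contDiff.comp hu))
  simp only [Complex.real_smul]
  exact this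

/-- A Fourier transform is determined by its inverse transform. -/
theorem fourier_ae_eq_of_eq_fourierInv {g G : ℝ → ℂ} (hg : Integrable g) (hG : Integrable G)
    (h : ∀ x, g x = 𝓕⁻ G x) : 𝓕 g =ᵐ[volume] G := by
  have hcont : Continuous (𝓕 g) := by
    have := (continuous_fourierInv hg).comp continuous_neg
    convert this using 1
    ext x
    simp [Real.fourierInv_eq_fourier_neg]
  refine ae_eq_of_integral_schwartz hcont.locallyIntegrable hG.locallyIntegrable fun u => ?_
  have hu := u.integrable (μ := volume)
  have hu' := (𝓕 u).integrable (μ := volume)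
  calc ∫ x, u x * 𝓕 g x = ∫ x, 𝓕 (u : ℝ → ℂ) x * g x := (integral_fourier_mul_flip hu hg).symm
    _ = ∫ x, (𝓕 u) x * 𝓕⁻ G x := by simp only [h, SchwartzMap.fourier_coe]
    _ = ∫ x, 𝓕⁻ ((𝓕 u : SchwartzMap ℝ ℂ) : ℝ → ℂ) x * G x :=
        (integral_fourierInv_mul_flip hu' hG).symm
    _ = ∫ x, u x * G x := by
        rw [← SchwartzMap.fourierInv_coe, FourierTransform.fourierInv_fourier_eq]

/-- The Plancherel transform is defined by extension, the other one by an integral. Tested against a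
Schwartz function `u`, both give the pairing of `G` with `𝓕⁻ u`. -/
theorem fourierInv_toLp_ae {G : ℝ → ℂ} (hG : Integrable G) (hG2 : MemLp G 2 volume) :
    ((𝓕⁻ (hG2.toLp : Lp ℂ 2 (volume : Measure ℝ)) : Lp ℂ 2 (volume : Measure ℝ)) : ℝ → ℂ)
      =ᵐ[volume] 𝓕⁻ G := by
  refine ae_eq_of_integral_schwartz ((Lp.memLp _).locallyIntegrable (by norm_num))
    (continuous_fourierInv hG).locallyIntegrable fun u => ?_
  have h1 := congrArg (fun T : TemperedDistribution ℝ ℂ => T u)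
    (Lp.fourierInv_toTemperedDistribution_eq (hG2.toLp : Lp ℂ 2 (volume : Measure ℝ)))
  simp only [TemperedDistribution.fourierInv_apply, Lp.toTemperedDistribution_apply,
    smul_eq_mul] at h1
  rw [← h1]
  have hu := u.integrable (μ := volume)
  calc _ = ∫ x, 𝓕⁻ (u : ℝ → ℂ) x * G x := by
        refine integral_congr_ae ?_
        filter_upwards [hG2.coeFn_toLp] with x hx
        rw [hx, SchwartzMap.fourierInv_coe]
    _ = _ := integral_fourierInv_mul_flip hu hG

/-! ### Convolution of an integrable with a square integrable function -/

/-- Young's inequality for `L¹ * L²`: split `K = K^(1/2) * K^(1/2)`, apply Cauchy–Schwarz in `η`,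
then Tonelli. Working in `ℝ≥0∞` avoids any prior integrability. -/
theorem lintegral_conv_sq_le {K v : ℝ → ℝ≥0∞} (hK : AEMeasurable K volume)
    (hv : AEMeasurable v volume) :
    ∫⁻ κ, (∫⁻ η, K η * v (κ - η)) ^ (2 : ℝ) ≤ (∫⁻ η, K η) ^ (2 : ℝ) * ∫⁻ κ, v κ ^ (2 : ℝ) := by
  have hsub : ∀ κ : ℝ, AEMeasurable (fun η => v (κ - η)) volume := fun κ =>
    hv.comp_quasiMeasurePreserving (quasiMeasurePreserving_sub_left volume κ)
  have hpt : ∀ κ, (∫⁻ η, K η * v (κ - η)) ^ (2 : ℝ) ≤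
      (∫⁻ η, K η) * ∫⁻ η, K η * v (κ - η) ^ (2 : ℝ) := fun κ => by
    have h := ENNReal.lintegral_mul_le_Lp_mul_Lq volume (Real.HolderConjugate.two_two)
      (f := fun η => K η ^ (1 / 2 : ℝ)) (g := fun η => K η ^ (1 / 2 : ℝ) * v (κ - η))
      (hK.pow_const _) ((hK.pow_const _).mul (hsub κ))
    have e1 : ∀ η, (K η ^ (1 / 2 : ℝ)) ^ (2 : ℝ) = K η := fun η => by
      rw [← ENNReal.rpow_mul]; norm_num
    have e2 : ∀ η, (K η ^ (1 / 2 : ℝ) * v (κ - η)) ^ (2 : ℝ) = K η * v (κ - η) ^ (2 : ℝ) :=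
      fun η => by rw [ENNReal.mul_rpow_of_nonneg _ _ (by norm_num), e1]
    have e3 : ∀ η, K η ^ (1 / 2 : ℝ) * (K η ^ (1 / 2 : ℝ) * v (κ - η)) = K η * v (κ - η) :=
      fun η => by
        rw [← mul_assoc, ← ENNReal.rpow_add_of_nonneg _ _ (by norm_num) (by norm_num)]
        norm_num
    simp only [Pi.mul_apply, e1, e2, e3] at h
    calc _ ≤ ((∫⁻ η, K η) ^ (1 / 2 : ℝ) * (∫⁻ η, K η * v (κ - η) ^ (2 : ℝ)) ^ (1 / 2 : ℝ)) ^
          (2 : ℝ) := ENNReal.rpow_le_rpow h (by norm_num)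
      _ = _ := by
        rw [ENNReal.mul_rpow_of_nonneg _ _ (by norm_num), ← ENNReal.rpow_mul,
          ← ENNReal.rpow_mul]
        norm_num
  have hmeas : AEMeasurable (Function.uncurry fun (κ η : ℝ) => K η * v (κ - η) ^ (2 : ℝ))
      (volume.prod volume) := by
    refine (hK.comp_quasiMeasurePreserving Measure.quasiMeasurePreserving_snd).mul
      (AEMeasurable.pow_const ?_ _)
    exact hv.comp_quasiMeasurePreserving
      (quasiMeasurePreserving_sub_of_right_invariant volume volume)
  calc ∫⁻ κ, (∫⁻ η, K η * v (κ - η)) ^ (2 : ℝ)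
      ≤ ∫⁻ κ, (∫⁻ η, K η) * ∫⁻ η, K η * v (κ - η) ^ (2 : ℝ) := lintegral_mono hpt
    _ = (∫⁻ η, K η) * ∫⁻ κ, ∫⁻ η, K η * v (κ - η) ^ (2 : ℝ) :=
        lintegral_const_mul'' _ hmeas.lintegral_prod_right'
    _ = (∫⁻ η, K η) * ∫⁻ η, ∫⁻ κ, K η * v (κ - η) ^ (2 : ℝ) := by
        rw [lintegral_lintegral_swap hmeas]
    _ = (∫⁻ η, K η) * ∫⁻ η, K η * ∫⁻ κ, v κ ^ (2 : ℝ) := by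
        congr 1
        refine lintegral_congr fun η => ?_
        have hv' : AEMeasurable (fun κ => v (κ - η) ^ (2 : ℝ)) volume :=
          (hv.comp_quasiMeasurePreserving
            (measurePreserving_sub_right volume η).quasiMeasurePreserving).pow_const _
        rw [lintegral_const_mul'' _ hv', lintegral_sub_right_eq_self (fun κ => v κ ^ (2 : ℝ)) η]
    _ = _ := by
        rw [lintegral_mul_const'' _ hK, ← mul_assoc]
        congr 1
        rw [show (2 : ℝ) = ((2 : ℕ) : ℝ) by norm_num, ENNReal.rpow_natCast, sq]

theorem lintegral_enorm_sq_eq (v : ℝ → ℂ) :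
    ∫⁻ κ, ‖v κ‖ₑ ^ (2 : ℝ) = eLpNorm v 2 volume ^ (2 : ℝ) := by
  rw [eLpNorm_eq_lintegral_rpow_enorm_toReal (by norm_num) (by norm_num), ← ENNReal.rpow_mul]
  simp

/-- Young's inequality for a function dominated by a convolution. -/
theorem eLpNorm_le_of_le_conv {K v w : ℝ → ℂ} (hK : Integrable K) (hv : MemLp v 2 volume)
    (h : ∀ᵐ κ, ‖w κ‖ₑ ≤ ∫⁻ η, ‖K η‖ₑ * ‖v (κ - η)‖ₑ) :
    eLpNorm w 2 volume ≤ ENNReal.ofReal (∫ η, ‖K η‖) * eLpNorm v 2 volume := by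
  rw [← ENNReal.rpow_le_rpow_iff (z := 2) (by norm_num), ← lintegral_enorm_sq_eq,
    ENNReal.mul_rpow_of_nonneg _ _ (by norm_num), ← lintegral_enorm_sq_eq]
  refine le_trans (lintegral_mono_ae ?_) ((lintegral_conv_sq_le hK.1.enorm hv.1.enorm).trans
    (le_of_eq ?_))
  · filter_upwards [h] with κ hκ using ENNReal.rpow_le_rpow hκ (by norm_num)
  · rw [ofReal_integral_norm_eq_lintegral_enorm hK]

theorem ae_integrable_conv {K v : ℝ → ℂ} (hK : Integrable K) (hv : MemLp v 2 volume) :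
    ∀ᵐ κ, Integrable fun η => K η * v (κ - η) := by
  have hfin : ∫⁻ κ, (∫⁻ η, ‖K η‖ₑ * ‖v (κ - η)‖ₑ) ^ (2 : ℝ) < ⊤ := by
    refine (lintegral_conv_sq_le hK.1.enorm hv.1.enorm).trans_lt (ENNReal.mul_lt_top ?_ ?_)
    · exact ENNReal.rpow_lt_top_of_nonneg (by norm_num) hK.2.ne
    · rw [lintegral_enorm_sq_eq]
      exact ENNReal.rpow_lt_top_of_nonneg (by norm_num) hv.2.ne
  have hmeas : AEMeasurable (fun κ : ℝ => (∫⁻ η, ‖K η‖ₑ * ‖v (κ - η)‖ₑ) ^ (2 : ℝ)) volume := by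
    refine AEMeasurable.pow_const ?_ _
    refine AEMeasurable.lintegral_prod_right'
      (f := fun z : ℝ × ℝ => ‖K z.2‖ₑ * ‖v (z.1 - z.2)‖ₑ) ?_
    exact (hK.1.enorm.comp_quasiMeasurePreserving Measure.quasiMeasurePreserving_snd).mul
      (hv.1.enorm.comp_quasiMeasurePreserving
      (quasiMeasurePreserving_sub_of_right_invariant volume volume))
  filter_upwards [ae_lt_top' hmeas hfin.ne] with κ hκ
  refine ⟨hK.1.mul (hv.1.comp_quasiMeasurePreserving (quasiMeasurePreserving_sub_left volume κ)),
    ?_⟩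
  have : (∫⁻ η, ‖K η‖ₑ * ‖v (κ - η)‖ₑ) < ⊤ := by
    by_contra hcon
    rw [not_lt, top_le_iff] at hcon
    rw [hcon] at hκ
    simp at hκ
  simpa only [HasFiniteIntegral, enorm_mul] using this

theorem aestronglyMeasurable_conv {K v : ℝ → ℂ} (hK : Integrable K) (hv : MemLp v 2 volume) :
    AEStronglyMeasurable (fun κ => ∫ η, K η * v (κ - η)) volume := by
  refine AEStronglyMeasurable.integral_prod_right' (f := fun z : ℝ × ℝ => K z.2 * v (z.1 - z.2)) ?_
  exact (hK.1.comp_quasiMeasurePreserving Measure.quasiMeasurePreserving_snd).mul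
      (hv.1.comp_quasiMeasurePreserving
      (quasiMeasurePreserving_sub_of_right_invariant volume volume))

theorem eLpNorm_conv_le {K v : ℝ → ℂ} (hK : Integrable K) (hv : MemLp v 2 volume) :
    eLpNorm (fun κ => ∫ η, K η * v (κ - η)) 2 volume ≤
      ENNReal.ofReal (∫ η, ‖K η‖) * eLpNorm v 2 volume := by
  refine eLpNorm_le_of_le_conv hK hv (Filter.Eventually.of_forall fun κ => ?_)
  simp only [← enorm_mul]
  exact enorm_integral_le_lintegral_enorm _

theorem memLp_conv {K v : ℝ → ℂ} (hK : Integrable K) (hv : MemLp v 2 volume) :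
    MemLp (fun κ => ∫ η, K η * v (κ - η)) 2 volume :=
  ⟨aestronglyMeasurable_conv hK hv, (eLpNorm_conv_le hK hv).trans_lt
    (ENNReal.mul_lt_top ENNReal.ofReal_lt_top hv.2)⟩

theorem conv_congr_ae {K v w : ℝ → ℂ} (h : v =ᵐ[volume] w) (κ : ℝ) :
    ∫ η, K η * v (κ - η) = ∫ η, K η * w (κ - η) := by
  refine integral_congr_ae ?_
  filter_upwards [(quasiMeasurePreserving_sub_left volume κ).ae_eq_comp h] with η hη
  simp only [Function.comp_apply] at hη
  rw [hη]

/-- Convolution with an integrable function, as a bounded operator in `L²`. -/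
def convCLM (K : ℝ → ℂ) (hK : Integrable K) :
    Lp ℂ 2 (volume : Measure ℝ) →L[ℂ] Lp ℂ 2 (volume : Measure ℝ) :=
  LinearMap.mkContinuous
    { toFun := fun u => (memLp_conv hK (Lp.memLp u)).toLp
      map_add' := fun u v => by
        rw [← MemLp.toLp_add]
        apply MemLp.toLp_congr
        filter_upwards [ae_integrable_conv hK (Lp.memLp u), ae_integrable_conv hK (Lp.memLp v)]
          with κ hu hv
        rw [conv_congr_ae (Lp.coeFn_add u v)]
        simp only [Pi.add_apply, mul_add]
        exact integral_add hu hv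
      map_smul' := fun c u => by
        rw [RingHom.id_apply, ← MemLp.toLp_const_smul]
        apply MemLp.toLp_congr
        filter_upwards with κ
        rw [conv_congr_ae (Lp.coeFn_smul c u)]
        simp only [Pi.smul_apply, smul_eq_mul, mul_left_comm _ c]
        exact integral_const_mul _ _ }
    (∫ η, ‖K η‖) fun u => by
      change ‖(memLp_conv hK (Lp.memLp u)).toLp‖ ≤ _
      rw [Lp.norm_toLp, Lp.norm_def, ← ENNReal.toReal_ofReal (integral_nonneg fun η =>
        norm_nonneg (K η)), ← ENNReal.toReal_mul]
      exact ENNReal.toReal_mono (ENNReal.mul_lt_top ENNReal.ofReal_lt_top (Lp.memLp u).2).ne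
        (eLpNorm_conv_le hK (Lp.memLp u))

theorem convCLM_ae (K : ℝ → ℂ) (hK : Integrable K) (u : Lp ℂ 2 (volume : Measure ℝ)) :
    convCLM K hK u =ᵐ[volume] fun κ => ∫ η, K η * u (κ - η) :=
  (memLp_conv hK (Lp.memLp u)).coeFn_toLp

theorem memLp_bdd_mul {μ : Measure ℝ} {g f : ℝ → ℂ} {C : ℝ} (hg : AEStronglyMeasurable g μ)
    (hC : ∀ x, ‖g x‖ ≤ C) (hf : MemLp f 2 μ) : MemLp (fun x => g x * f x) 2 μ :=
  hf.of_le_mul (hg.mul hf.1) (Filter.Eventually.of_forall fun x => by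
    rw [norm_mul]; exact mul_le_mul_of_nonneg_right (hC x) (norm_nonneg _))

/-- Multiplication by a bounded function, as a bounded operator in `L²(μ)`. -/
def mulCLM (μ : Measure ℝ) (g : ℝ → ℂ) (C : ℝ) (hg : AEStronglyMeasurable g μ)
    (hC : ∀ x, ‖g x‖ ≤ C) : Lp ℂ 2 μ →L[ℂ] Lp ℂ 2 μ :=
  LinearMap.mkContinuous
    { toFun := fun u => (memLp_bdd_mul hg hC (Lp.memLp u)).toLp
      map_add' := fun u v => by
        rw [← MemLp.toLp_add]
        apply MemLp.toLp_congr
        filter_upwards [Lp.coeFn_add u v] with x hx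
        rw [hx]; exact mul_add _ _ _
      map_smul' := fun c u => by
        rw [RingHom.id_apply, ← MemLp.toLp_const_smul]
        apply MemLp.toLp_congr
        filter_upwards [Lp.coeFn_smul c u] with x hx
        simp [hx, mul_left_comm] }
    C fun u => by
      refine Lp.norm_le_mul_norm_of_ae_le_mul ?_
      filter_upwards [(memLp_bdd_mul hg hC (Lp.memLp u)).coeFn_toLp] with x hx
      change ‖((memLp_bdd_mul hg hC (Lp.memLp u)).toLp : ℝ → ℂ) x‖ ≤ _
      rw [hx, norm_mul]; exact mul_le_mul_of_nonneg_right (hC x) (norm_nonneg _)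

theorem mulCLM_ae {μ : Measure ℝ} {g : ℝ → ℂ} {C : ℝ} (hg : AEStronglyMeasurable g μ)
    (hC : ∀ x, ‖g x‖ ≤ C) (u : Lp ℂ 2 μ) : mulCLM μ g C hg hC u =ᵐ[μ] fun x => g x * u x :=
  (memLp_bdd_mul hg hC (Lp.memLp u)).coeFn_toLp

/-- The convolution theorem: if `h = (𝓕⁻ G) f` with `G` integrable and `f` square integrable, then
the Fourier transform of `h` is the convolution of `G` and the Fourier transform of `f`. -/
theorem fourier_mul_ae {G : ℝ → ℂ} (hG : Integrable G) {f h : Lp ℂ 2 (volume : Measure ℝ)}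
    (hh : h =ᵐ[volume] fun x => 𝓕⁻ G x * f x) :
    (𝓕 h : Lp ℂ 2 (volume : Measure ℝ)) =ᵐ[volume]
      fun κ => ∫ η, G η * (𝓕 f : Lp ℂ 2 (volume : Measure ℝ)) (κ - η) := by
  have hgm : AEStronglyMeasurable (𝓕⁻ G) volume := (continuous_fourierInv hG).aestronglyMeasurable
  -- Written with inverse transforms, both sides are continuous in `u`, so it suffices to treat
  -- Schwartz functions. There everything is integrable and the classical convolution theorem
  -- applies.
  have key : ∀ u : Lp ℂ 2 (volume : Measure ℝ),
      (𝓕⁻ (convCLM G hG u) : Lp ℂ 2 (volume : Measure ℝ)) =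
        mulCLM volume (𝓕⁻ G) (∫ η, ‖G η‖) hgm (norm_fourierInv_le G) (𝓕⁻ u) := by
    intro u
    refine DenseRange.induction_on (p := fun u : Lp ℂ 2 (volume : Measure ℝ) =>
      (𝓕⁻ (convCLM G hG u) : Lp ℂ 2 (volume : Measure ℝ)) =
        mulCLM volume (𝓕⁻ G) (∫ η, ‖G η‖) hgm (norm_fourierInv_le G) (𝓕⁻ u))
      (SchwartzMap.denseRange_toLpCLM (p := 2) (F := ℂ) (E := ℝ) (μ := volume)
        ENNReal.ofNat_ne_top) u ?_ ?_
    · refine isClosed_eq ?_ ?_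
      · exact (Lp.fourierTransformₗᵢ ℝ ℂ).symm.continuous.comp (convCLM G hG).continuous
      · exact (mulCLM volume (𝓕⁻ G) _ hgm (norm_fourierInv_le G)).continuous.comp
          (Lp.fourierTransformₗᵢ ℝ ℂ).symm.continuous
    · intro s
      simp only [SchwartzMap.toLpCLM_apply]
      have hs := s.integrable (μ := volume)
      have hs2 := s.memLp 2 (μ := volume)
      have hci : Integrable fun κ => ∫ η, G η * s (κ - η) :=
        hG.integrable_convolution (ContinuousLinearMap.mul ℂ ℂ) hs
      have hc2 := memLp_conv hG hs2
      have h1 : convCLM G hG (s.toLp 2 volume) = hc2.toLp := by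
        refine Lp.ext ((convCLM_ae G hG _).trans ?_)
        refine Filter.EventuallyEq.trans ?_ hc2.coeFn_toLp.symm
        filter_upwards with κ
        exact conv_congr_ae (s.coeFn_toLp 2 volume) κ
      rw [h1, SchwartzMap.toLp_fourierInv_eq]
      refine Lp.ext ((fourierInv_toLp_ae hci hc2).trans ?_)
      refine Filter.EventuallyEq.trans ?_ (mulCLM_ae hgm (norm_fourierInv_le G) _).symm
      filter_upwards [(𝓕⁻ s).coeFn_toLp 2 volume] with x hx
      rw [hx, Real.fourierInv_eq_fourier_neg, SchwartzMap.fourierInv_coe,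
        Real.fourierInv_eq_fourier_neg, Real.fourierInv_eq_fourier_neg]
      exact Real.fourier_mul_convolution_eq hG hs (-x)
  have h2 := key (𝓕 f)
  rw [FourierTransform.fourierInv_fourier_eq] at h2
  have h3 : h = mulCLM volume (𝓕⁻ G) (∫ η, ‖G η‖) hgm (norm_fourierInv_le G) f :=
    Lp.ext (hh.trans (mulCLM_ae hgm (norm_fourierInv_le G) f).symm)
  rw [h3, ← h2, FourierTransform.fourier_fourierInv_eq]
  exact convCLM_ae G hG _

/-! ### Hyperbolic functions -/

theorem abs_le_abs_sinh (x : ℝ) : |x| ≤ |Real.sinh x| := by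
  rcases le_total 0 x with h | h
  · rw [abs_of_nonneg h, abs_of_nonneg (Real.sinh_nonneg_iff.2 h)]
    exact Real.self_le_sinh_iff.2 h
  · rw [abs_of_nonpos h, abs_of_nonpos (Real.sinh_nonpos_iff.2 h)]
    have := Real.self_le_sinh_iff.2 (neg_nonneg.2 h)
    rwa [Real.sinh_neg] at this

theorem sq_le_sinh_sq (x : ℝ) : x ^ 2 ≤ Real.sinh x ^ 2 := sq_le_sq.2 (abs_le_abs_sinh x)

theorem one_add_half_sq_le_cosh (x : ℝ) : 1 + x ^ 2 / 2 ≤ Real.cosh x := by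
  have h1 := Real.cosh_two_mul (x / 2)
  rw [mul_div_cancel₀ _ (two_ne_zero' ℝ), Real.cosh_sq'] at h1
  have := sq_le_sinh_sq (x / 2)
  nlinarith

theorem sinh_le_mul_cosh {x : ℝ} (hx : 0 ≤ x) : Real.sinh x ≤ x * Real.cosh x := by
  have hd : ∀ y, HasDerivAt (fun y => y * Real.cosh y - Real.sinh y) (y * Real.sinh y) y := by
    intro y
    have := ((hasDerivAt_id y).mul (Real.hasDerivAt_cosh y)).sub (Real.hasDerivAt_sinh y)
    exact this.congr_deriv (by simp)
  have hmono : MonotoneOn (fun y => y * Real.cosh y - Real.sinh y) (Set.Ici 0) := by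
    refine monotoneOn_of_deriv_nonneg (convex_Ici 0)
      (fun y _ => (hd y).continuousAt.continuousWithinAt)
      (fun y _ => (hd y).differentiableAt.differentiableWithinAt) fun y hy => ?_
    rw [(hd y).deriv]
    rw [interior_Ici] at hy
    exact mul_nonneg hy.le (Real.sinh_nonneg_iff.2 hy.le)
  have := hmono (Set.mem_Ici.2 le_rfl) (Set.mem_Ici.2 hx) hx
  simp at this
  exact this

theorem abs_sinh_le_mul_cosh (x : ℝ) : |Real.sinh x| ≤ |x| * Real.cosh x := by
  have := sinh_le_mul_cosh (abs_nonneg x)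
  rwa [Real.cosh_abs, ← Real.abs_sinh] at this

theorem sinh_sq_le_mul_cosh_sq (x : ℝ) : Real.sinh x ^ 2 ≤ x ^ 2 * Real.cosh x ^ 2 := by
  rw [← mul_pow]
  refine sq_le_sq.2 ?_
  rw [abs_mul, abs_of_pos (Real.cosh_pos x)]
  exact abs_sinh_le_mul_cosh x

/-- This makes `tanh k / k` drop below 1 quadratically, the source of the spectral gap. By `cosh² =
1 + sinh²` it reduces to `sinh² k * (1 - k²/2) ≤ k²`; the duplication formula gives `sinh² k ≤ k²
cosh⁴(k/2) ≤ k² exp(k²/2)`, and `1 - k²/2 ≤ exp(-k²/2)` finishes. -/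
theorem sinh_sq_mul_le (k : ℝ) :
    Real.sinh k ^ 2 * (1 + k ^ 2 / 2) ≤ k ^ 2 * Real.cosh k ^ 2 := by
  rw [Real.cosh_sq']
  suffices h : Real.sinh k ^ 2 * (1 - k ^ 2 / 2) ≤ k ^ 2 by nlinarith
  rcases le_or_gt (1 - k ^ 2 / 2) 0 with h0 | h0
  · exact (mul_nonpos_of_nonneg_of_nonpos (sq_nonneg _) h0).trans (sq_nonneg k)
  have h1 : Real.sinh k ^ 2 ≤ k ^ 2 * Real.exp (k ^ 2 / 2) := by
    have e1 : Real.sinh k = 2 * Real.sinh (k / 2) * Real.cosh (k / 2) := by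
      rw [← Real.sinh_two_mul]; congr 1; ring
    have e2 := Real.cosh_le_exp_half_sq (k / 2)
    have e3 : Real.cosh (k / 2) ^ 4 ≤ Real.exp ((k / 2) ^ 2 / 2) ^ 4 :=
      pow_le_pow_left₀ (Real.cosh_pos _).le e2 4
    rw [← Real.exp_nat_mul] at e3
    have e4 : ((4 : ℕ) : ℝ) * ((k / 2) ^ 2 / 2) = k ^ 2 / 2 := by push_cast; ring
    rw [e4] at e3
    have e5 := sinh_sq_le_mul_cosh_sq (k / 2)
    calc Real.sinh k ^ 2 = 4 * Real.sinh (k / 2) ^ 2 * Real.cosh (k / 2) ^ 2 := by rw [e1]; ring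
      _ ≤ 4 * ((k / 2) ^ 2 * Real.cosh (k / 2) ^ 2) * Real.cosh (k / 2) ^ 2 := by gcongr
      _ = k ^ 2 * Real.cosh (k / 2) ^ 4 := by ring
      _ ≤ _ := by gcongr
  have h2 : 1 - k ^ 2 / 2 ≤ Real.exp (-(k ^ 2 / 2)) := by
    have := Real.add_one_le_exp (-(k ^ 2 / 2)); linarith
  calc Real.sinh k ^ 2 * (1 - k ^ 2 / 2)
      ≤ k ^ 2 * Real.exp (k ^ 2 / 2) * Real.exp (-(k ^ 2 / 2)) := by gcongr
    _ = k ^ 2 := by rw [mul_assoc, ← Real.exp_add]; simp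

/-! ### More on Wiener algebras -/

theorem isWeight_one_add_abs {s : ℝ} (hs : 0 < s) : IsWeight fun η => 1 + |η| / s where
  cont := by fun_prop
  one_le x := by have : 0 ≤ |x| / s := by positivity
                 linarith
  mul_le x y := by
    have h1 : |x + y| / s ≤ |x| / s + |y| / s := by
      rw [← add_div]; exact div_le_div_of_nonneg_right (abs_add_le x y) hs.le
    have h2 : 0 ≤ |x| / s * (|y| / s) := by positivity
    nlinarith
  even x := by rw [abs_neg]

theorem isWeight_one : IsWeight fun _ => 1 where
  cont := by fun_prop
  one_le _ := le_rfl
  mul_le _ _ := by norm_num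
  even _ := rfl

namespace Wiener

variable {φ : ℝ → ℝ} {f g : ℝ → ℝ} {M N : ℝ}

theorem of_weight_le_mul {ψ : ℝ → ℝ} (hψ : IsWeight ψ) {c : ℝ} (hle : ∀ x, ψ x ≤ c * φ x)
    (hc : 0 ≤ c) (h : Wiener φ g N) : Wiener ψ g (c * N) := by
  obtain ⟨G, hG, hN⟩ := h
  have hle' : ∀ η, ψ η * ‖G η‖ ≤ c * (φ η * ‖G η‖) := fun η => by
    rw [← mul_assoc]; exact mul_le_mul_of_nonneg_right (hle η) (norm_nonneg _)
  have hi : Integrable fun η => ψ η * ‖G η‖ :=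
    (hG.weighted.const_mul c).mono' (hψ.cont.aestronglyMeasurable.mul hG.meas.norm)
      (Filter.Eventually.of_forall fun η => by
        rw [Real.norm_of_nonneg (mul_nonneg (hψ.pos η).le (norm_nonneg _))]
        exact hle' η)
  refine ⟨G, ⟨hG.meas, hi, hG.eq⟩, (integral_mono hi (hG.weighted.const_mul c) hle').trans ?_⟩
  rw [integral_const_mul]
  exact mul_le_mul_of_nonneg_left hN hc

theorem comp_neg (hφ : IsWeight φ) (h : Wiener φ g N) : Wiener φ (fun x => g (-x)) N := by
  obtain ⟨G, hG, hN⟩ := h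
  refine ⟨fun η => G (-η), ⟨hG.meas.comp_measurePreserving
    (Measure.measurePreserving_neg volume), ?_, fun x => ?_⟩, ?_⟩
  · simpa only [hφ.even] using hG.weighted.comp_neg
  · rw [hG.eq, fourierInv_apply_eq, fourierInv_apply_eq, ← integral_neg_eq_self]
    congr 1; ext η; push_cast; congr 2; ring
  · rw [← integral_neg_eq_self]; simpa only [hφ.even, neg_neg] using hN

theorem comp_mul {s : ℝ} (hs : 0 < s) (h : Wiener (fun η => 1 + |η|) g N) :
    Wiener (fun η => 1 + |η| / s) (fun x => g (s * x)) N := by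
  obtain ⟨G, hG, hN⟩ := h
  have hs' : s⁻¹ ≠ 0 := inv_ne_zero hs.ne'
  have hrw : (fun η => (1 + |η| / s) * ‖(s⁻¹ : ℂ) * G (s⁻¹ * η)‖) =
      fun η => s⁻¹ * ((1 + |s⁻¹ * η|) * ‖G (s⁻¹ * η)‖) := by
    ext η
    rw [norm_mul, norm_inv, Complex.norm_real, Real.norm_of_nonneg hs.le, abs_mul,
      abs_of_pos (inv_pos.2 hs)]
    ring
  have hint := (integrable_comp_mul_left_iff (fun η => (1 + |η|) * ‖G η‖) hs').2 hG.weighted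
  refine ⟨fun η => (s⁻¹ : ℂ) * G (s⁻¹ * η), ⟨?_, ?_, fun x => ?_⟩, ?_⟩
  · refine AEStronglyMeasurable.const_mul ?_ _
    exact hG.meas.comp_quasiMeasurePreserving (Measure.quasiMeasurePreserving_smul volume hs')
  · rw [hrw]; exact hint.const_mul _
  · rw [hG.eq, fourierInv_apply_eq, fourierInv_apply_eq]
    have := Measure.integral_comp_mul_left (fun η : ℝ =>
      Complex.exp (2 * Real.pi * (η * ((s * x : ℝ) : ℂ)) * Complex.I) * G η) s⁻¹
    rw [inv_inv, abs_of_pos hs] at this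
    have hs2 : (s : ℂ) ≠ 0 := by exact_mod_cast hs.ne'
    have e : (∫ η : ℝ, Complex.exp (2 * Real.pi * (η * x) * Complex.I) *
        ((s⁻¹ : ℂ) * G (s⁻¹ * η))) = (s⁻¹ : ℂ) * ∫ η : ℝ, Complex.exp
        (2 * Real.pi * (((s⁻¹ * η : ℝ) : ℂ) * ((s * x : ℝ) : ℂ)) * Complex.I) * G (s⁻¹ * η) := by
      rw [← integral_const_mul]
      congr 1; ext η
      have : ((s⁻¹ * η : ℝ) : ℂ) * ((s * x : ℝ) : ℂ) = η * x := by
        push_cast; field_simp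
      rw [this]; ring
    rw [e, this, Complex.real_smul, ← mul_assoc, inv_mul_cancel₀ hs2, one_mul]
  · rw [hrw, integral_const_mul]
    have := Measure.integral_comp_mul_left (fun η => (1 + |η|) * ‖G η‖) s⁻¹
    rw [this, inv_inv, abs_of_pos hs, smul_eq_mul, ← mul_assoc, inv_mul_cancel₀ hs.ne', one_mul]
    exact hN

/-- One power of the weight controls one derivative. -/
theorem hasDerivAt {s : ℝ} (hs : 0 < s) (hφ : IsWeight φ)
    (h : Wiener (fun η => φ η * (1 + |η| / s)) g N) :
    Differentiable ℝ g ∧ Wiener φ (deriv g) (2 * Real.pi * s * N) := by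
  have hφ2 := hφ.mul (isWeight_one_add_abs hs)
  obtain ⟨G, hG, hN⟩ := h
  have hGi : Integrable G := hG.integrable hφ2
  have hle : ∀ η, φ η * ‖(2 * Real.pi * Complex.I * η) * G η‖ ≤
      2 * Real.pi * s * (φ η * (1 + |η| / s) * ‖G η‖) := fun η => by
    have e : ‖(2 * Real.pi * Complex.I * η) * G η‖ = 2 * Real.pi * |η| * ‖G η‖ := by
      simp [abs_of_pos Real.pi_pos]
    rw [e]
    have h1 : |η| ≤ s * (1 + |η| / s) := by
      rw [mul_add, mul_div_cancel₀ _ hs.ne']; linarith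
    have h2 : 0 ≤ 2 * Real.pi * (φ η * ‖G η‖) :=
      mul_nonneg (by positivity) (mul_nonneg (hφ.pos η).le (norm_nonneg _))
    calc _ = 2 * Real.pi * (φ η * ‖G η‖) * |η| := by ring
      _ ≤ 2 * Real.pi * (φ η * ‖G η‖) * (s * (1 + |η| / s)) := by gcongr
      _ = _ := by ring
  have hm : AEStronglyMeasurable (fun η : ℝ => (2 * Real.pi * Complex.I * η) * G η) volume :=
    (Continuous.aestronglyMeasurable (by fun_prop)).mul hG.meas
  have hi : Integrable fun η : ℝ => φ η * ‖(2 * Real.pi * Complex.I * η) * G η‖ :=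
    (hG.weighted.const_mul (2 * Real.pi * s)).mono' (hφ.cont.aestronglyMeasurable.mul hm.norm)
      (Filter.Eventually.of_forall fun η => by
        rw [Real.norm_of_nonneg (mul_nonneg (hφ.pos η).le (norm_nonneg _))]
        exact hle η)
  have hi' : Integrable fun η : ℝ => (2 * Real.pi * Complex.I * η) * G η :=
    integrable_of_weighted hφ hm hi
  have hi'' : Integrable fun η : ℝ => η • G η := by
    have := hi'.const_mul (2 * Real.pi * Complex.I)⁻¹
    convert this using 1
    ext η
    have : (2 * Real.pi * Complex.I : ℂ) ≠ 0 := by simp [Real.pi_ne_zero]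
    rw [Complex.real_smul]; field_simp
  have hderiv : ∀ x, HasDerivAt (fun x : ℝ => 𝓕⁻ G x)
      (𝓕⁻ (fun η : ℝ => (2 * Real.pi * Complex.I * η) * G η) x) x := fun x => by
    have h1 := (Real.hasDerivAt_fourier hGi hi'' (-x)).scomp x (hasDerivAt_neg x)
    have h2 : (fun x : ℝ => 𝓕⁻ G x) = 𝓕 G ∘ Neg.neg := by
      ext y; rw [Real.fourierInv_eq_fourier_neg]; rfl
    rw [h2]
    refine h1.congr_deriv ?_
    rw [Real.fourierInv_eq_fourier_neg, Real.fourier_real_eq, Real.fourier_real_eq,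
      ← integral_smul]
    congr 1; ext η
    simp only [smul_eq_mul, Circle.smul_def, Complex.real_smul]
    push_cast; ring
  have hre : ∀ x, HasDerivAt g (𝓕⁻ (fun η : ℝ => (2 * Real.pi * Complex.I * η) * G η) x).re x :=
    fun x => by
      have h1 := (Complex.reCLM.hasFDerivAt (x := 𝓕⁻ G x)).comp_hasDerivAt x (hderiv x)
      have h2 : (Complex.reCLM ∘ fun x : ℝ => 𝓕⁻ G x) = g := by
        ext y; simp [← hG.eq]
      rw [h2] at h1
      exact h1
  refine ⟨fun x => (hre x).differentiableAt, ?_⟩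
  refine ((of_re hφ hm hi).congr fun x => (hre x).deriv).mono ?_
  refine (integral_mono hi (hG.weighted.const_mul _) hle).trans ?_
  rw [integral_const_mul]
  exact mul_le_mul_of_nonneg_left hN (by positivity)

/-- Bounded Fourier multipliers act in the Wiener algebra. -/
theorem fourierFun (hφ : IsWeight φ) (hg : Integrable g) (h : Wiener φ g N) {m : ℂ → ℂ}
    (hm : Measurable fun κ : ℝ => m ((2 * Real.pi * κ : ℝ) : ℂ))
    (hb : ∀ k : ℝ, ‖m k‖ ≤ 1) : Wiener φ (fourierFun m g) N := by
  obtain ⟨G, hG, hN⟩ := h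
  -- The multiplier is defined through the Fourier integral of `g`, so the representing `G` must
  -- first be identified with it.
  have hae : 𝓕 (fun y : ℝ => (g y : ℂ)) =ᵐ[volume] G :=
    fourier_ae_eq_of_eq_fourierInv hg.ofReal (hG.integrable hφ) hG.eq
  have hm' : AEStronglyMeasurable (fun κ : ℝ => m ((2 * Real.pi * κ : ℝ) : ℂ) *
      𝓕 (fun y : ℝ => (g y : ℂ)) κ) volume :=
    hm.aestronglyMeasurable.mul (hG.meas.congr hae.symm)
  have hle : ∀ᵐ κ : ℝ, φ κ * ‖m ((2 * Real.pi * κ : ℝ) : ℂ) * 𝓕 (fun y : ℝ => (g y : ℂ)) κ‖ ≤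
      φ κ * ‖G κ‖ := by
    filter_upwards [hae] with κ hκ
    rw [hκ, norm_mul]
    exact mul_le_mul_of_nonneg_left (mul_le_of_le_one_left (norm_nonneg _) (hb _)) (hφ.pos κ).le
  have hi : Integrable fun κ : ℝ => φ κ * ‖m ((2 * Real.pi * κ : ℝ) : ℂ) *
      𝓕 (fun y : ℝ => (g y : ℂ)) κ‖ := by
    refine hG.weighted.mono' (hφ.cont.aestronglyMeasurable.mul hm'.norm) ?_
    filter_upwards [hle] with κ hκ
    rwa [Real.norm_of_nonneg (mul_nonneg (hφ.pos κ).le (norm_nonneg _))]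
  exact (of_re hφ hm' hi).mono ((integral_mono_ae hi hG.weighted hle).trans hN)

end Wiener

/-! ### The hyperbolic secant -/

theorem inv_cosh_le (x : ℝ) : (Real.cosh x)⁻¹ ≤ 2 * (1 + x ^ 2)⁻¹ := by
  have h := one_add_half_sq_le_cosh x
  rw [← div_eq_mul_inv, inv_le_comm₀ (Real.cosh_pos x) (by positivity), inv_div]
  nlinarith [sq_nonneg x]

theorem integrable_inv_cosh : Integrable fun x => (Real.cosh x)⁻¹ :=
  (integrable_inv_one_add_sq.const_mul 2).mono'
    (Real.continuous_cosh.inv₀ fun x => (Real.cosh_pos x).ne').aestronglyMeasurable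
    (Filter.Eventually.of_forall fun x => by
      rw [Real.norm_of_nonneg (inv_nonneg.2 (Real.cosh_pos x).le)]; exact inv_cosh_le x)

theorem hasDerivAt_inv_cosh (x : ℝ) :
    HasDerivAt (fun x => (Real.cosh x)⁻¹) (-(Real.sinh x / Real.cosh x ^ 2)) x := by
  have := (Real.hasDerivAt_cosh x).inv (Real.cosh_pos x).ne'
  rwa [neg_div] at this

theorem abs_sinh_le_cosh (x : ℝ) : |Real.sinh x| ≤ Real.cosh x := by
  refine abs_le_of_sq_le_sq ?_ (Real.cosh_pos x).le
  rw [Real.cosh_sq']; linarith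

/-- Three integrable derivatives make the Fourier transform `O((1 + |η|³)⁻¹)`, so that it remains
integrable after multiplication by `1 + |η|`. -/
theorem exists_wiener_inv_cosh :
    ∃ N, Wiener (fun η => 1 + |η|) (fun x => (Real.cosh x)⁻¹) N := by
  have hc0 : ∀ x, Real.cosh x ≠ 0 := fun x => (Real.cosh_pos x).ne'
  have hnorm : ∀ x, ‖(Real.cosh x)⁻¹‖ = (Real.cosh x)⁻¹ := fun x =>
    Real.norm_of_nonneg (inv_nonneg.2 (Real.cosh_pos x).le)
  set f₀ : ℝ → ℂ := fun x => (((Real.cosh x)⁻¹ : ℝ) : ℂ) with hf₀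
  set f₁ : ℝ → ℂ := fun x => ((-(Real.sinh x / Real.cosh x ^ 2) : ℝ) : ℂ) with hf₁
  set f₂ : ℝ → ℂ := fun x => (((Real.cosh x)⁻¹ - 2 * (Real.cosh x)⁻¹ ^ 3 : ℝ) : ℂ) with hf₂
  set f₃ : ℝ → ℂ := fun x => ((-(Real.sinh x / Real.cosh x ^ 2) -
    2 * (3 * (Real.cosh x)⁻¹ ^ 2 * (-(Real.sinh x / Real.cosh x ^ 2))) : ℝ) : ℂ) with hf₃
  have d₀ : ∀ x, HasDerivAt f₀ (f₁ x) x := fun x => (hasDerivAt_inv_cosh x).ofReal_comp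
  have d₁ : ∀ x, HasDerivAt f₁ (f₂ x) x := fun x => by
    have h := (((Real.hasDerivAt_sinh x).div ((Real.hasDerivAt_cosh x).pow 2)
      (pow_ne_zero 2 (hc0 x)))).neg
    refine HasDerivAt.ofReal_comp (h.congr_deriv ?_)
    have := Real.cosh_sq' x
    have h0 := hc0 x
    simp only [Pi.pow_apply]
    field_simp
    have h2 : Real.sinh x ^ 2 = Real.cosh x ^ 2 - 1 := by linarith
    push_cast
    norm_num
    ring_nf
    rw [h2]; ring
  have d₂ : ∀ x, HasDerivAt f₂ (f₃ x) x := fun x => by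
    have h := (hasDerivAt_inv_cosh x).sub (((hasDerivAt_inv_cosh x).pow 3).const_mul 2)
    exact HasDerivAt.ofReal_comp (h.congr_deriv (by norm_num))
  have hsech_le : ∀ x, (Real.cosh x)⁻¹ ≤ 1 := fun x => inv_le_one_of_one_le₀ (Real.one_le_cosh x)
  have hsech_pos : ∀ x, 0 < (Real.cosh x)⁻¹ := fun x => inv_pos.2 (Real.cosh_pos x)
  have hsx : ∀ x, |(-(Real.sinh x / Real.cosh x ^ 2))| ≤ (Real.cosh x)⁻¹ := fun x => by
    rw [abs_neg, abs_div, abs_of_pos (pow_pos (Real.cosh_pos x) 2), div_le_iff₀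
      (pow_pos (Real.cosh_pos x) 2), sq, ← mul_assoc, inv_mul_cancel₀ (hc0 x), one_mul]
    exact abs_sinh_le_cosh x
  have c₀ : Continuous f₀ := continuous_iff_continuousAt.2 fun x => (d₀ x).continuousAt
  have c₁ : Continuous f₁ := continuous_iff_continuousAt.2 fun x => (d₁ x).continuousAt
  have c₂ : Continuous f₂ := continuous_iff_continuousAt.2 fun x => (d₂ x).continuousAt
  have hcosh := Real.continuous_cosh
  have hsinh := Real.continuous_sinh
  have c₃ : Continuous f₃ := by
    refine Complex.continuous_ofReal.comp ?_
    have h1 : Continuous fun x => Real.sinh x / Real.cosh x ^ 2 :=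
      hsinh.div (hcosh.pow 2) fun x => pow_ne_zero 2 (hc0 x)
    have h2 : Continuous fun x => (Real.cosh x)⁻¹ := hcosh.inv₀ hc0
    fun_prop
  have i₀ : Integrable f₀ := integrable_inv_cosh.ofReal
  have i₁ : Integrable f₁ := integrable_inv_cosh.mono' c₁.aestronglyMeasurable
    (Filter.Eventually.of_forall fun x => by
      simp only [hf₁, Complex.norm_real, Real.norm_eq_abs]; exact hsx x)
  have i₂ : Integrable f₂ := (integrable_inv_cosh.const_mul 3).mono' c₂.aestronglyMeasurable
    (Filter.Eventually.of_forall fun x => by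
      simp only [hf₂, Complex.norm_real, Real.norm_eq_abs]
      have h1 := hsech_le x
      have h2 := hsech_pos x
      have h3 : (Real.cosh x)⁻¹ ^ 3 ≤ (Real.cosh x)⁻¹ := pow_le_of_le_one h2.le h1 (by norm_num)
      have h4 : 0 < (Real.cosh x)⁻¹ ^ 3 := by positivity
      rw [abs_le]; constructor <;> linarith)
  have i₃ : Integrable f₃ := (integrable_inv_cosh.const_mul 7).mono' c₃.aestronglyMeasurable
    (Filter.Eventually.of_forall fun x => by
      simp only [hf₃, Complex.norm_real, Real.norm_eq_abs]
      have h1 := hsech_le x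
      have h2 := hsech_pos x
      have h3 : (Real.cosh x)⁻¹ ^ 2 ≤ 1 := pow_le_one₀ h2.le h1
      set y := -(Real.sinh x / Real.cosh x ^ 2)
      have h5 : y - 2 * (3 * (Real.cosh x)⁻¹ ^ 2 * y) = (1 - 6 * (Real.cosh x)⁻¹ ^ 2) * y := by
        ring
      rw [h5, abs_mul]
      have h6 : |1 - 6 * (Real.cosh x)⁻¹ ^ 2| ≤ 7 := by
        have := sq_nonneg (Real.cosh x)⁻¹
        rw [abs_le]; constructor <;> linarith
      exact mul_le_mul h6 (hsx x) (abs_nonneg _) (by norm_num))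
  have e₀ : deriv f₀ = f₁ := funext fun x => (d₀ x).deriv
  have e₁ : deriv f₁ = f₂ := funext fun x => (d₁ x).deriv
  have e₂ : deriv f₂ = f₃ := funext fun x => (d₂ x).deriv
  have g₁ := Real.fourier_deriv i₀ (fun x => (d₀ x).differentiableAt) (e₀ ▸ i₁)
  have g₂ := Real.fourier_deriv i₁ (fun x => (d₁ x).differentiableAt) (e₁ ▸ i₂)
  have g₃ := Real.fourier_deriv i₂ (fun x => (d₂ x).differentiableAt) (e₂ ▸ i₃)
  rw [e₀] at g₁
  rw [e₁, g₁] at g₂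
  rw [e₂, g₂] at g₃
  have hFc : Continuous (𝓕 f₀) := by
    have := (continuous_fourierInv i₀).comp continuous_neg
    convert this using 1
    ext x
    simp [Real.fourierInv_eq_fourier_neg]
  have hbd : ∀ (u : ℝ → ℂ) (η : ℝ), ‖𝓕 u η‖ ≤ ∫ x, ‖u x‖ := fun u η => by
    have := norm_fourierInv_le u (-η)
    rwa [Real.fourierInv_eq_fourier_neg, neg_neg] at this
  set C := (∫ x, ‖f₀ x‖) + ∫ x, ‖f₃ x‖ with hC
  have hC0 : 0 ≤ C := add_nonneg (integral_nonneg fun x => norm_nonneg _)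
    (integral_nonneg fun x => norm_nonneg _)
  have hdecay : ∀ η, (1 + |η| ^ 3) * ‖𝓕 f₀ η‖ ≤ C := fun η => by
    have h3 := hbd f₃ η
    rw [g₃] at h3
    simp only [smul_eq_mul, norm_mul, Complex.norm_ofNat, Complex.norm_real, Complex.norm_I,
      Real.norm_eq_abs, mul_one, abs_of_pos Real.pi_pos] at h3
    have hpi := Real.pi_gt_three
    have h5 : |η| ≤ 2 * Real.pi * |η| := by
      nlinarith [abs_nonneg η]
    have h6 : |η| ^ 3 ≤ (2 * Real.pi * |η|) ^ 3 := pow_le_pow_left₀ (abs_nonneg η) h5 3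
    have h7 := mul_le_mul_of_nonneg_right h6 (norm_nonneg (𝓕 f₀ η))
    have h8 := hbd f₀ η
    rw [hC]
    nlinarith
  have hle : ∀ η, (1 + |η|) * ‖𝓕 f₀ η‖ ≤ 3 * C * (1 + η ^ 2)⁻¹ := fun η => by
    rw [← div_eq_mul_inv, le_div_iff₀ (by positivity)]
    have h1 := hdecay η
    have h2 : (1 + |η|) * (1 + η ^ 2) ≤ 3 * (1 + |η| ^ 3) := by
      rw [← sq_abs]
      nlinarith [abs_nonneg η, mul_nonneg (abs_nonneg η) (sq_nonneg (|η| - 1)), sq_nonneg (|η| - 1)]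
    have h3 := mul_le_mul_of_nonneg_right h2 (norm_nonneg (𝓕 f₀ η))
    nlinarith
  have hw : Integrable fun η => (1 + |η|) * ‖𝓕 f₀ η‖ :=
    (integrable_inv_one_add_sq.const_mul (3 * C)).mono'
      (by fun_prop : Continuous fun η => (1 + |η|) * ‖𝓕 f₀ η‖).aestronglyMeasurable
      (Filter.Eventually.of_forall fun η => by
        rw [Real.norm_of_nonneg (by positivity)]; exact hle η)
  have hFi : Integrable (𝓕 f₀) := hw.mono' hFc.aestronglyMeasurable
    (Filter.Eventually.of_forall fun η => le_mul_of_one_le_left (norm_nonneg _)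
      (by have := abs_nonneg η; linarith))
  exact ⟨_, 𝓕 f₀, ⟨hFc.aestronglyMeasurable, hw, fun x => by
    rw [c₀.fourierInv_fourier_eq i₀ hFi]⟩, le_rfl⟩

theorem exists_wiener_inv_cosh_mul {b : ℝ} (hb : 0 < b) :
    ∃ N, Wiener (fun η => 1 + |η|) (fun x => (Real.cosh (b * x))⁻¹) N := by
  obtain ⟨N, hN⟩ := exists_wiener_inv_cosh
  have hw : IsWeight fun η => 1 + |η| := by simpa using isWeight_one_add_abs one_pos
  refine ⟨_, (hN.comp_mul hb).of_weight_le_mul hw (c := 1 + b) (fun x => ?_) (by positivity)⟩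
  have : (1 + b) * (1 + |x| / b) = 1 + |x| + b + |x| / b := by field_simp; ring
  rw [this]
  have : 0 ≤ |x| / b := by positivity
  linarith

/-! ### The symbols on the real line -/

/-- The real function `tanh k / k`. -/
def rtanhc (k : ℝ) : ℝ := if k = 0 then 1 else Real.tanh k / k

theorem tanhc_ofReal (k : ℝ) : tanhc k = (rtanhc k : ℂ) := by
  unfold tanhc rtanhc
  by_cases h : k = 0
  · simp [h]
  · simp [h]

theorem rtanhc_nonneg (k : ℝ) : 0 ≤ rtanhc k := by
  unfold rtanhc
  split_ifs with h
  · norm_num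
  · rw [Real.tanh_eq_sinh_div_cosh]
    rcases le_total 0 k with hk | hk
    · exact div_nonneg (div_nonneg (Real.sinh_nonneg_iff.2 hk) (Real.cosh_pos k).le) hk
    · exact div_nonneg_of_nonpos (div_nonpos_of_nonpos_of_nonneg (Real.sinh_nonpos_iff.2 hk)
        (Real.cosh_pos k).le) hk

theorem rtanhc_sq_mul_le (k : ℝ) : rtanhc k ^ 2 * (1 + k ^ 2 / 2) ≤ 1 := by
  unfold rtanhc
  split_ifs with h
  · simp [h]
  · rw [Real.tanh_eq_sinh_div_cosh, div_pow, div_pow, div_div, div_mul_eq_mul_div,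
      div_le_one (by have := Real.cosh_pos k; positivity), mul_comm (Real.cosh k ^ 2)]
    exact sinh_sq_mul_le k

theorem rtanhc_le_one (k : ℝ) : rtanhc k ≤ 1 := by
  have h1 := rtanhc_sq_mul_le k
  have h2 : rtanhc k ^ 2 ≤ 1 := by
    nlinarith [mul_nonneg (sq_nonneg (rtanhc k)) (sq_nonneg k)]
  exact (sq_le_one_iff₀ (rtanhc_nonneg k)).1 h2

theorem measurable_complex_tanh : Measurable Complex.tanh :=
  Complex.measurable_sinh.div Complex.measurable_cosh

theorem measurable_tanhc : Measurable tanhc :=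
  Measurable.ite (measurableSet_singleton 0) measurable_const
    (measurable_complex_tanh.div measurable_id)

theorem measurable_real_freq : Measurable fun κ : ℝ => ((2 * Real.pi * κ : ℝ) : ℂ) := by
  fun_prop

theorem norm_tanhc_ofReal_le (k : ℝ) : ‖tanhc k‖ ≤ 1 := by
  rw [tanhc_ofReal, Complex.norm_real, Real.norm_of_nonneg (rtanhc_nonneg k)]
  exact rtanhc_le_one k

theorem norm_tanh_ofReal_le (k : ℝ) : ‖Complex.I * Complex.tanh k‖ ≤ 1 := by
  rw [norm_mul, Complex.norm_I, one_mul, ← Complex.ofReal_tanh, Complex.norm_real]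
  exact (Real.abs_tanh_lt_one k).le

/-- The symbol of `(1 - γ tanh D / D)⁻¹`. -/
def resSymbol (ε : ℝ) (k : ℂ) : ℂ := (1 - (gam ε : ℂ) * tanhc k)⁻¹

theorem measurable_resSymbol (ε : ℝ) : Measurable (resSymbol ε) := by
  unfold resSymbol
  exact (measurable_const.sub (measurable_const.mul measurable_tanhc)).inv

theorem norm_resSymbol (ε k : ℝ) : ‖resSymbol ε k‖ = |1 - gam ε * rtanhc k|⁻¹ := by
  unfold resSymbol
  rw [tanhc_ofReal, ← Complex.ofReal_mul, ← Complex.ofReal_one, ← Complex.ofReal_sub, norm_inv,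
    Complex.norm_real, Real.norm_eq_abs]

/-- At low frequency `1 - γ tanh k / k` is bounded below by a multiple of `ε² + η²`, where `ε²`
comes from `γ = 1 - ε²`. Its inverse therefore absorbs two powers of the weight `1 + |η|/ε` at the
price of `ε⁻²`. -/
theorem resSymbol_bound_low {ε : ℝ} (hε : 0 < ε) (hε1 : ε ^ 2 ≤ 1 / 2) {η : ℝ} (hη : |η| ≤ 1) :
    (1 + |η| / ε) ^ 2 * ‖resSymbol ε ((2 * Real.pi * η : ℝ) : ℂ)‖ ≤ 12 / ε ^ 2 := by
  rw [norm_resSymbol]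
  set k := 2 * Real.pi * η with hk
  set T := rtanhc k with hT
  have hη2 : η ^ 2 ≤ 1 := by rw [← sq_abs]; exact pow_le_one₀ (abs_nonneg _) hη
  have hpi1 := Real.pi_gt_three
  have hpi2 := Real.pi_lt_d2
  have hpi3 : Real.pi ^ 2 ≤ 10 := by nlinarith
  have hpi4 : 9 ≤ Real.pi ^ 2 := by nlinarith
  have hk2 : k ^ 2 = 4 * Real.pi ^ 2 * η ^ 2 := by rw [hk]; ring
  have hk3 : k ^ 2 ≤ 40 := by rw [hk2]; nlinarith [sq_nonneg η]
  have hk4 : 36 * η ^ 2 ≤ k ^ 2 := by rw [hk2]; nlinarith [sq_nonneg η]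
  have h1 := rtanhc_sq_mul_le k
  -- The bound `T² (1 + k²/2) ≤ 1` is compared with `(1 - k²/100)² (1 + k²/2) ≥ 1`, valid for `k² ≤
  -- 40`; that range covers `|η| ≤ 1`.
  have h2 : T ≤ 1 - k ^ 2 / 100 := by
    have h3 : 1 ≤ (1 - k ^ 2 / 100) ^ 2 * (1 + k ^ 2 / 2) := by
      nlinarith [sq_nonneg k, mul_nonneg (sq_nonneg k) (sub_nonneg.2 hk3),
        mul_nonneg (sq_nonneg k) (sq_nonneg (k ^ 2))]
    have h4 : T ^ 2 ≤ (1 - k ^ 2 / 100) ^ 2 := by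
      have h5 : 0 < 1 + k ^ 2 / 2 := by positivity
      exact le_of_mul_le_mul_right (h1.trans h3) h5
    exact le_of_sq_le_sq h4 (by linarith)
  have h6 : (ε ^ 2 + η ^ 2) / 6 ≤ 1 - gam ε * T := by
    unfold gam
    nlinarith [sq_nonneg η, sq_nonneg ε]
  have h7 : 0 < (ε ^ 2 + η ^ 2) / 6 := by positivity
  rw [abs_of_pos (h7.trans_le h6)]
  have h8 : (1 - gam ε * T)⁻¹ ≤ ((ε ^ 2 + η ^ 2) / 6)⁻¹ := inv_anti₀ h7 h6
  have h9 : (1 + |η| / ε) ^ 2 ≤ 2 * (ε ^ 2 + η ^ 2) / ε ^ 2 := by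
    have : 1 + |η| / ε = (ε + |η|) / ε := by field_simp
    rw [this, div_pow]
    refine div_le_div_of_nonneg_right ?_ (by positivity)
    rw [← sq_abs η]
    nlinarith [sq_nonneg (ε - |η|)]
  calc _ ≤ (2 * (ε ^ 2 + η ^ 2) / ε ^ 2) * ((ε ^ 2 + η ^ 2) / 6)⁻¹ :=
        mul_le_mul h9 h8 (inv_nonneg.2 (h7.le.trans h6)) (by positivity)
    _ = 12 / ε ^ 2 := by field_simp; ring

/-- No power of the weight is gained here. The missing smallness is supplied by the quadratic
nonlinearity. -/
theorem resSymbol_bound_high {ε η : ℝ} (hη : 1 ≤ |η|) :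
    ‖resSymbol ε ((2 * Real.pi * η : ℝ) : ℂ)‖ ≤ 2 := by
  rw [norm_resSymbol]
  set k := 2 * Real.pi * η with hk
  set T := rtanhc k with hT
  have hη2 : 1 ≤ η ^ 2 := by rw [← sq_abs]; exact one_le_pow₀ hη
  have hpi1 := Real.pi_gt_three
  have hk2 : 36 ≤ k ^ 2 := by
    rw [hk]; nlinarith [mul_nonneg (sub_nonneg.2 hη2) (sq_nonneg Real.pi)]
  have h1 := rtanhc_sq_mul_le k
  have h0 := rtanhc_nonneg k
  have h2 : T ≤ 1 / 2 := by
    refine le_of_sq_le_sq ?_ (by norm_num)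
    nlinarith [sq_nonneg T]
  have h3 : 1 / 2 ≤ 1 - gam ε * T := by
    unfold gam; nlinarith [sq_nonneg ε]
  rw [abs_of_pos (by linarith)]
  exact (inv_anti₀ (by norm_num) h3).trans (by norm_num)

/-! ### The nonlinearity -/

/-- Unconditional: if the integrand is not integrable, the integral takes its default value zero at
every `x`. Thus a solution of the fixed point equation is continuous before anything else is known
about it. -/
theorem continuous_fourierFun (m : ℂ → ℂ) (f : ℝ → ℝ) : Continuous (fourierFun m f) := by
  unfold fourierFun
  by_cases h : Integrable fun κ : ℝ => m ((2 * Real.pi * κ : ℝ) : ℂ) *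
      𝓕 (fun y : ℝ => (f y : ℂ)) κ
  · exact Complex.continuous_re.comp (continuous_fourierInv h)
  · have : ∀ x : ℝ, 𝓕⁻ (fun κ : ℝ => m ((2 * Real.pi * κ : ℝ) : ℂ) *
        𝓕 (fun y : ℝ => (f y : ℂ)) κ) x = 0 := fun x => by
      rw [Real.fourierInv_eq_fourier_neg, Real.fourier_eq]
      exact integral_undef fun hc => h ((Real.fourierIntegral_convergent_iff (-x)).1 hc)
    simp only [this]
    exact continuous_const

theorem wiener_tau {φ ω : ℝ → ℝ} {N : ℝ} (hφ : IsWeight φ) (hω : Integrable ω)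
    (h : Wiener φ ω N) : Wiener φ (tau ω) N :=
  h.fourierFun hφ hω ((measurable_const.mul measurable_complex_tanh).comp measurable_real_freq)
    norm_tanh_ofReal_le

theorem wiener_etaBar {φ ω : ℝ → ℝ} {N : ℝ} (hφ : IsWeight φ) (hω : Integrable ω)
    (h : Wiener φ ω N) : Wiener φ (etaBar ω) N :=
  h.fourierFun hφ hω (measurable_tanhc.comp measurable_real_freq) norm_tanhc_ofReal_le

theorem memLp_two_of_integrable_of_bdd {g : ℝ → ℂ} (hg : Integrable g) {C : ℝ}
    (hC : ∀ x, ‖g x‖ ≤ C) : MemLp g 2 volume := by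
  refine (memLp_two_iff_integrable_sq_norm hg.1).2 ?_
  refine (hg.norm.const_mul C).mono' (hg.1.norm.pow 2) (Filter.Eventually.of_forall fun x => ?_)
  rw [Real.norm_of_nonneg (sq_nonneg _), sq]
  exact mul_le_mul_of_nonneg_right (hC x) (norm_nonneg _)

/-- By Plancherel. Integrability of `τ` itself is not required, since `τ` enters the nonlinearity
only through `τ²`. -/
theorem integrable_tau_sq {φ ω : ℝ → ℝ} {N : ℝ} (hφ : IsWeight φ) (hω : Integrable ω)
    (h : Wiener φ ω N) : Integrable fun x => tau ω x ^ 2 := by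
  obtain ⟨G, hG, -⟩ := h
  have hae : 𝓕 (fun y : ℝ => (ω y : ℂ)) =ᵐ[volume] G :=
    fourier_ae_eq_of_eq_fourierInv hω.ofReal (hG.integrable hφ) hG.eq
  have hFi : Integrable (𝓕 fun y : ℝ => (ω y : ℂ)) := (hG.integrable hφ).congr hae.symm
  set H : ℝ → ℂ := fun κ => Complex.I * Complex.tanh ((2 * Real.pi * κ : ℝ) : ℂ) *
    𝓕 (fun y : ℝ => (ω y : ℂ)) κ with hH
  have hm : Measurable fun κ : ℝ => Complex.I * Complex.tanh ((2 * Real.pi * κ : ℝ) : ℂ) :=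
    (measurable_const.mul measurable_complex_tanh).comp measurable_real_freq
  have hle : ∀ κ, ‖H κ‖ ≤ ‖𝓕 (fun y : ℝ => (ω y : ℂ)) κ‖ := fun κ => by
    rw [hH, norm_mul]; exact mul_le_of_le_one_left (norm_nonneg _) (norm_tanh_ofReal_le _)
  have hHi : Integrable H := hFi.norm.mono' (hm.aestronglyMeasurable.mul hFi.1)
    (Filter.Eventually.of_forall hle)
  have hbd : ∀ κ, ‖H κ‖ ≤ ∫ x, ‖(ω x : ℂ)‖ := fun κ => by
    have := norm_fourierInv_le (fun y : ℝ => (ω y : ℂ)) (-κ)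
    rw [Real.fourierInv_eq_fourier_neg, neg_neg] at this
    exact (hle κ).trans this
  have hH2 : MemLp H 2 volume := memLp_two_of_integrable_of_bdd hHi hbd
  have h2 : MemLp (𝓕⁻ H) 2 volume :=
    (memLp_congr_ae (fourierInv_toLp_ae hHi hH2)).1 (Lp.memLp _)
  have h3 := (memLp_two_iff_integrable_sq_norm h2.1).1 h2
  refine h3.mono' ((continuous_fourierFun _ ω).pow 2).aestronglyMeasurable
    (Filter.Eventually.of_forall fun x => ?_)
  rw [Real.norm_of_nonneg (sq_nonneg _)]
  refine sq_le_sq.2 ?_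
  rw [abs_of_nonneg (norm_nonneg _)]
  exact Complex.abs_re_le_norm _

theorem gam_mem {ε : ℝ} (hε1 : ε ^ 2 ≤ 1 / 2) : 1 / 2 ≤ gam ε ∧ gam ε ≤ 1 := by
  unfold gam; constructor <;> nlinarith [sq_nonneg ε]

/-- The numerator is at least quadratic and the factor `(1 + ω)⁻²` is 1 plus an element of the
algebra. The uniformity of the constant over all weights is essential: the bootstrap below applies
the estimate to auxiliary weights containing a free parameter. -/
theorem exists_wiener_nonlin : ∃ C, 1 ≤ C ∧ ∀ (φ : ℝ → ℝ), IsWeight φ → ∀ (ε : ℝ),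
    ε ^ 2 ≤ 1 / 2 → ∀ (ω : ℝ → ℝ) (N : ℝ), Integrable ω → Wiener φ ω N → N ≤ 1 / 4 →
      Wiener φ (nonlin ε ω) (C * N ^ 2) ∧ Integrable (nonlin ε ω) := by
  obtain ⟨c, hc1, hc⟩ := Wiener.exists_one_add_rpow (-2)
  refine ⟨4 * (1 + c), by linarith, fun φ hφ ε hε ω N hi hω hN => ?_⟩
  have hN0 := hω.nonneg hφ
  obtain ⟨hg0, hg1⟩ := gam_mem hε
  have hτ := wiener_tau hφ hi hω
  have hη := wiener_etaBar hφ hi hω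
  have hA := (((hω.sq hφ).const_mul (3 / 2)).add hφ (hω.pow_succ hφ 2)).sub hφ
    (((hτ.sq hφ).const_mul (1 / 2)).sub hφ (((hτ.sq hφ).mul hφ hη).const_mul (gam ε)))
  set A : ℝ → ℝ := fun x => 3 / 2 * ω x ^ 2 + ω x ^ (2 + 1) -
    (1 / 2 * tau ω x ^ 2 - gam ε * (tau ω x ^ 2 * etaBar ω x)) with hAdef
  have hA' : Wiener φ A (4 * N ^ 2) := hA.mono (by
    rw [abs_of_nonneg (by norm_num : (0 : ℝ) ≤ 3 / 2), abs_of_nonneg (by norm_num : (0 : ℝ) ≤ 1 / 2),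
      abs_of_nonneg (by linarith : (0 : ℝ) ≤ gam ε)]
    have h1 : N ^ 3 ≤ N ^ 2 / 4 := by nlinarith [sq_nonneg N]
    have h2 : gam ε * (N ^ 2 * N) ≤ N ^ 2 * N := mul_le_of_le_one_left (by positivity) hg1
    nlinarith [sq_nonneg N])
  have hR := hc φ hφ ω N hω hN
  have hpos : ∀ x, 0 < 1 + ω x := fun x => by
    have := (abs_le.1 (hω.abs_le hφ x)).1; linarith
  have heq : ∀ x, nonlin ε ω x = A x + A x * ((1 + ω x) ^ (-2 : ℝ) - 1) := fun x => by
    have h2 : (1 + ω x) ^ (-2 : ℝ) = ((1 + ω x) ^ 2)⁻¹ := by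
      rw [Real.rpow_neg (hpos x).le]; norm_num
    rw [h2, mul_sub, mul_one, add_sub_cancel, ← div_eq_mul_inv]
    unfold nonlin
    congr 1
    rw [hAdef]; ring
  constructor
  · refine ((hA'.add hφ (hA'.mul hφ hR)).congr heq).mono ?_
    have : 4 * N ^ 2 * (c * N) ≤ 4 * N ^ 2 * c := by
      refine mul_le_mul_of_nonneg_left ?_ (by positivity)
      nlinarith
    linarith
  · have hωc := hω.continuous hφ
    have hτ2 := integrable_tau_sq hφ hi hω
    have hb : ∀ x, |ω x| ≤ 1 / 4 := fun x => (hω.abs_le hφ x).trans hN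
    have hb' : ∀ x, |etaBar ω x| ≤ 1 / 4 := fun x => (hη.abs_le hφ x).trans hN
    have hdom : Integrable fun x => 4 * (|ω x| + tau ω x ^ 2) := (hi.abs.add hτ2).const_mul 4
    have hcont : Continuous (nonlin ε ω) := by
      have : nonlin ε ω = fun x => A x + A x * ((1 + ω x) ^ (-2 : ℝ) - 1) := funext heq
      rw [this]
      exact (hA'.continuous hφ).add ((hA'.continuous hφ).mul (hR.continuous hφ))
    refine hdom.mono' hcont.aestronglyMeasurable (Filter.Eventually.of_forall fun x => ?_)
    unfold nonlin
    have hD : 9 / 16 ≤ (1 + ω x) ^ 2 := by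
      have := (abs_le.1 (hb x)).1; nlinarith
    rw [Real.norm_eq_abs, abs_div, abs_of_pos (by linarith : 0 < (1 + ω x) ^ 2),
      div_le_iff₀ (by linarith)]
    have t0 := sq_nonneg (tau ω x)
    have e1 : |3 / 2 * ω x ^ 2 + ω x ^ 3 - 1 / 2 * tau ω x ^ 2 * (1 - 2 * gam ε * etaBar ω x)| ≤
        |ω x| + tau ω x ^ 2 := by
      have a1 : |3 / 2 * ω x ^ 2 + ω x ^ 3| ≤ |ω x| := by
        have : 3 / 2 * ω x ^ 2 + ω x ^ 3 = ω x * (3 / 2 * ω x + ω x ^ 2) := by ring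
        rw [this, abs_mul]
        refine mul_le_of_le_one_right (abs_nonneg _) ?_
        have := abs_le.1 (hb x)
        rw [abs_le]; constructor <;> nlinarith
      have a2 : |1 / 2 * tau ω x ^ 2 * (1 - 2 * gam ε * etaBar ω x)| ≤ tau ω x ^ 2 := by
        have a3 : |1 - 2 * gam ε * etaBar ω x| ≤ 2 := by
          have := abs_le.1 (hb' x)
          rw [abs_le]; constructor <;> nlinarith
        rw [abs_mul, abs_mul, abs_of_nonneg t0, abs_of_nonneg (by norm_num : (0 : ℝ) ≤ 1 / 2)]
        nlinarith
      exact (abs_sub _ _).trans (add_le_add a1 a2)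
    nlinarith [abs_nonneg (ω x)]

/-! ### Regularity of the solitary wave -/

/-- For integrable `g` the representing function is unique, so bounds for different weights all
concern the single function `𝓕 g` and can be compared. -/
theorem Wiener.fourier_le {φ g : ℝ → ℝ} {N : ℝ} (hφ : IsWeight φ) (hg : Integrable g)
    (h : Wiener φ g N) : Integrable (fun η => φ η * ‖𝓕 (fun y : ℝ => (g y : ℂ)) η‖) ∧
      ∫ η, φ η * ‖𝓕 (fun y : ℝ => (g y : ℂ)) η‖ ≤ N := by
  obtain ⟨G, hG, hN⟩ := h
  have hae : 𝓕 (fun y : ℝ => (g y : ℂ)) =ᵐ[volume] G :=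
    fourier_ae_eq_of_eq_fourierInv hg.ofReal (hG.integrable hφ) hG.eq
  have hae' : (fun η => φ η * ‖G η‖) =ᵐ[volume]
      fun η => φ η * ‖𝓕 (fun y : ℝ => (g y : ℂ)) η‖ := by
    filter_upwards [hae] with η hη
    rw [hη]
  exact ⟨hG.weighted.congr hae', (integral_congr_ae hae') ▸ hN⟩

theorem Wiener.of_fourier_le {φ ψ g : ℝ → ℝ} {M N : ℝ} (hφ : IsWeight φ) (hg : Integrable g)
    (h : Wiener φ g M) (hi : Integrable fun η => ψ η * ‖𝓕 (fun y : ℝ => (g y : ℂ)) η‖)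
    (hN : ∫ η, ψ η * ‖𝓕 (fun y : ℝ => (g y : ℂ)) η‖ ≤ N) : Wiener ψ g N := by
  obtain ⟨G, hG, -⟩ := h
  have hae : 𝓕 (fun y : ℝ => (g y : ℂ)) =ᵐ[volume] G :=
    fourier_ae_eq_of_eq_fourierInv hg.ofReal (hG.integrable hφ) hG.eq
  have hae' : (fun η => ψ η * ‖𝓕 (fun y : ℝ => (g y : ℂ)) η‖) =ᵐ[volume]
      fun η => ψ η * ‖G η‖ := by
    filter_upwards [hae] with η hη
    rw [hη]
  exact ⟨G, ⟨hG.meas, hi.congr hae', hG.eq⟩, (integral_congr_ae hae') ▸ hN⟩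

/-- Truncation makes the stronger norms finite a priori. Submultiplicativity survives because `R ≥
1`. -/
theorem isWeight_min {φ : ℝ → ℝ} (hφ : IsWeight φ) {R : ℝ} (hR : 1 ≤ R) :
    IsWeight fun η => min (φ η) R where
  cont := hφ.cont.min continuous_const
  one_le x := le_min (hφ.one_le x) hR
  mul_le x y := by
    have h1 := hφ.one_le x
    have h2 := hφ.one_le y
    have h3 := hφ.mul_le x y
    rcases le_total (φ x) R with hx | hx <;> rcases le_total (φ y) R with hy | hy
    · rw [min_eq_left hx, min_eq_left hy]; exact (min_le_left _ _).trans h3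
    · rw [min_eq_left hx, min_eq_right hy]
      exact (min_le_right _ _).trans (le_mul_of_one_le_left (by linarith) h1)
    · rw [min_eq_right hx, min_eq_left hy]
      exact (min_le_right _ _).trans (le_mul_of_one_le_right (by linarith) h2)
    · rw [min_eq_right hx, min_eq_right hy]
      exact (min_le_right _ _).trans (le_mul_of_one_le_right (by linarith) hR)
  even x := by rw [hφ.even]

/-- The truncated weight is subadditive, and `1 + t * (subadditive)` is submultiplicative for every
`t ≥ 0`. The free parameter `t` plays the role of a Leibniz rule: it extracts an estimate linear in
the strongest norm. -/
theorem isWeight_one_add_mul_min {s t R : ℝ} (hs : 0 < s) (ht : 0 ≤ t) (hR : 1 ≤ R) :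
    IsWeight fun η => 1 + t * min (1 + |η| / s) R where
  cont := by fun_prop
  one_le x := by
    have := (isWeight_min (isWeight_one_add_abs hs) hR).pos x
    have : 0 ≤ t * min (1 + |x| / s) R := mul_nonneg ht this.le
    linarith
  mul_le x y := by
    have hx := (isWeight_min (isWeight_one_add_abs hs) hR).pos x
    have hy := (isWeight_min (isWeight_one_add_abs hs) hR).pos y
    have h1 : |x + y| / s ≤ |x| / s + |y| / s := by
      rw [← add_div]; exact div_le_div_of_nonneg_right (abs_add_le x y) hs.le
    have h2 : min (1 + |x + y| / s) R ≤ min (1 + |x| / s) R + min (1 + |y| / s) R := by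
      rcases le_total (1 + |x| / s) R with hx' | hx'
      · rcases le_total (1 + |y| / s) R with hy' | hy'
        · rw [min_eq_left hx', min_eq_left hy']
          exact (min_le_left _ _).trans (by linarith)
        · rw [min_eq_right hy']; exact (min_le_right _ _).trans (by linarith)
      · rw [min_eq_right hx']; exact (min_le_right _ _).trans (by linarith)
    have h3 := mul_le_mul_of_nonneg_left h2 ht
    have h4 : 0 ≤ t * min (1 + |x| / s) R * (t * min (1 + |y| / s) R) := by positivity
    nlinarith
  even x := by rw [abs_neg]

/-- The fixed point equation gains one derivative. -/
theorem exists_wiener_sq_of_fixed_point {C₁ : ℝ} (hC₁ : 1 ≤ C₁) :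
    ∃ C₂, 1 ≤ C₂ ∧ ∃ ε₁ > 0, ∀ ε, 0 < ε → ε < ε₁ → ∀ ω : ℝ → ℝ, Integrable ω →
      Wiener (fun η => 1 + |η| / ε) ω (C₁ * ε ^ 2) →
      (∀ x, ω x = fourierFun (resSymbol ε) (nonlin ε ω) x) →
      Wiener (fun η => (1 + |η| / ε) * (1 + |η| / ε)) ω (C₂ * ε ^ 2) := by
  obtain ⟨c, hc1, hc⟩ := exists_wiener_nonlin
  -- The argument ends with `D ≤ 12 c C₁² ε² + 8 c C₁ ε² (D + ε²)`; for `ε < 1 / (16 c C₁)` the last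
  -- coefficient is at most `1/2`, and absorbing `D / 2` gives this constant.
  refine ⟨24 * c * C₁ ^ 2 + 1, by nlinarith [sq_nonneg C₁], 1 / (16 * c * C₁), by positivity,
    fun ε hε hε1 ω hi hω hfix => ?_⟩
  rw [lt_div_iff₀ (by positivity)] at hε1
  have hcC : 1 ≤ c * C₁ := one_le_mul_of_one_le_of_one_le hc1 hC₁
  have hεs : ε < 1 / 16 := by nlinarith
  have hε2 : ε ^ 2 ≤ ε := by nlinarith
  have hεh : ε ^ 2 ≤ 1 / 2 := by nlinarith
  have hsmall : 16 * (c * C₁) * ε ^ 2 ≤ 1 := by nlinarith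
  have hsmall' : 2 * (C₁ * ε ^ 2) ≤ 1 / 4 := by
    have h0 : 0 ≤ (c - 1) * (C₁ * ε ^ 2) := mul_nonneg (sub_nonneg.2 hc1) (by positivity)
    nlinarith
  set φ : ℝ → ℝ := fun η => 1 + |η| / ε with hφdef
  have hφ : IsWeight φ := isWeight_one_add_abs hε
  set W : ℝ → ℂ := 𝓕 (fun y : ℝ => (ω y : ℂ)) with hW
  set V : ℝ → ℂ := 𝓕 (fun y : ℝ => (nonlin ε ω y : ℂ)) with hV
  obtain ⟨hn, hni⟩ := hc φ hφ ε hεh ω _ hi hω (by linarith [(by positivity : 0 ≤ C₁ * ε ^ 2)])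
  obtain ⟨hVi, hVle⟩ := hn.fourier_le hφ hni
  have hVm : AEStronglyMeasurable V volume := by
    obtain ⟨G, hG, -⟩ := hn
    exact hG.meas.congr (fourier_ae_eq_of_eq_fourierInv hni.ofReal (hG.integrable hφ) hG.eq).symm
  have hVi0 : Integrable V := integrable_of_weighted hφ hVm hVi
  obtain ⟨hWi, hWle⟩ := hω.fourier_le hφ hi
  have hmm : Measurable fun κ : ℝ => resSymbol ε ((2 * Real.pi * κ : ℝ) : ℂ) :=
    (measurable_resSymbol ε).comp measurable_real_freq
  have hMVm : AEStronglyMeasurable (fun κ : ℝ => resSymbol ε ((2 * Real.pi * κ : ℝ) : ℂ) * V κ)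
      volume := hmm.aestronglyMeasurable.mul hVm
  -- the uniform bound for the truncated weights
  have key : ∀ R : ℝ, 1 ≤ R →
      Integrable (fun η => φ η * min (φ η) R * ‖W η‖) ∧
      ∫ η, φ η * min (φ η) R * ‖W η‖ ≤ (24 * c * C₁ ^ 2 + 1) * ε ^ 2 := by
    intro R hR
    have hmin := isWeight_min hφ hR
    have hψ : IsWeight fun η => φ η * min (φ η) R := hφ.mul hmin
    -- The truncated weight is at most `R φ`, so the norm `D` below is finite, as the absorption
    -- requires.
    have hωψ : Wiener (fun η => φ η * min (φ η) R) ω (R * (C₁ * ε ^ 2)) :=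
      hω.of_weight_le_mul hψ (fun x => by
        rw [mul_comm]; exact mul_le_mul_of_nonneg_right (min_le_right _ _) (hφ.pos x).le)
        (by linarith)
    obtain ⟨hDi, -⟩ := hωψ.fourier_le hψ hi
    refine ⟨hDi, ?_⟩
    set D := ∫ η, φ η * min (φ η) R * ‖W η‖ with hD
    have hD0 : 0 ≤ D := integral_nonneg fun η => mul_nonneg (hψ.pos η).le (norm_nonneg _)
    -- With this `t` the norm of `ω` for the weight `φ (1 + t min(φ, R))` at most doubles. The
    -- quadratic estimate for the nonlinearity, divided by `t`, then bounds its truncated norm by a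
    -- multiple of `ε² (D + ε²)`. The summand `ε²` keeps the denominator positive.
    set t := C₁ * ε ^ 2 / (D + ε ^ 2) with ht
    have hDε : 0 < D + ε ^ 2 := by positivity
    have ht0 : 0 < t := by positivity
    have hφt : IsWeight fun η => φ η * (1 + t * min (φ η) R) :=
      hφ.mul (isWeight_one_add_mul_min hε ht0.le hR)
    have hsplit : ∀ (u : ℝ → ℂ), (fun η => φ η * (1 + t * min (φ η) R) * ‖u η‖) =
        fun η => φ η * ‖u η‖ + t * (φ η * min (φ η) R * ‖u η‖) := fun u => by
      ext η; ring
    have hωt : Wiener (fun η => φ η * (1 + t * min (φ η) R)) ω (2 * (C₁ * ε ^ 2)) := by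
      refine Wiener.of_fourier_le hφ hi hω ?_ ?_
      · rw [hsplit]; exact hWi.add (hDi.const_mul t)
      · rw [hsplit, integral_add hWi (hDi.const_mul t), integral_const_mul]
        have h1 : t * D ≤ C₁ * ε ^ 2 := by
          rw [ht, div_mul_eq_mul_div, div_le_iff₀ hDε]
          exact mul_le_mul_of_nonneg_left (by nlinarith) (by positivity)
        linarith
    obtain ⟨hnt, -⟩ := hc _ hφt ε hεh ω _ hi hωt hsmall'
    obtain ⟨hVt, hVtle⟩ := hnt.fourier_le hφt hni
    have hVψ : Integrable fun η => φ η * min (φ η) R * ‖V η‖ := by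
      refine (hVi.const_mul R).mono' (hψ.cont.aestronglyMeasurable.mul hVm.norm)
        (Filter.Eventually.of_forall fun η => ?_)
      rw [Real.norm_of_nonneg (mul_nonneg (hψ.pos η).le (norm_nonneg _)), ← mul_assoc]
      refine mul_le_mul_of_nonneg_right ?_ (norm_nonneg _)
      rw [mul_comm]; exact mul_le_mul_of_nonneg_right (min_le_right _ _) (hφ.pos η).le
    have hVψle : ∫ η, φ η * min (φ η) R * ‖V η‖ ≤ 4 * c * C₁ * ε ^ 2 * (D + ε ^ 2) := by
      rw [hsplit, integral_add hVi (hVψ.const_mul t), integral_const_mul] at hVtle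
      have h0 : 0 ≤ ∫ η, φ η * ‖V η‖ :=
        integral_nonneg fun η => mul_nonneg (hφ.pos η).le (norm_nonneg _)
      have h1 : t * ∫ η, φ η * min (φ η) R * ‖V η‖ ≤ c * (2 * (C₁ * ε ^ 2)) ^ 2 := by linarith
      rw [ht, div_mul_eq_mul_div, div_le_iff₀ hDε] at h1
      have h2 : 0 < C₁ * ε ^ 2 := by positivity
      refine le_of_mul_le_mul_left (h1.trans (le_of_eq ?_)) h2
      ring
    -- For `|η| ≤ 1` the inverse symbol absorbs both weights, leaving a norm already under control;
    -- for `|η| ≥ 1` it is merely bounded and the truncated norm of `V` is used.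
    have hpt : ∀ η, φ η * min (φ η) R * ‖resSymbol ε ((2 * Real.pi * η : ℝ) : ℂ) * V η‖ ≤
        12 / ε ^ 2 * (φ η * ‖V η‖) + 2 * (φ η * min (φ η) R * ‖V η‖) := fun η => by
      rw [norm_mul]
      have hp1 := (hψ.pos η).le
      have hp2 := hφ.one_le η
      rcases le_total |η| 1 with h | h
      · have h1 := resSymbol_bound_low hε hεh h
        have h2 : φ η * min (φ η) R * ‖resSymbol ε ((2 * Real.pi * η : ℝ) : ℂ)‖ ≤ 12 / ε ^ 2 := by
          refine le_trans ?_ h1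
          rw [sq]
          exact mul_le_mul_of_nonneg_right (mul_le_mul_of_nonneg_left (min_le_left _ _)
            (hφ.pos η).le) (norm_nonneg _)
        calc _ = φ η * min (φ η) R * ‖resSymbol ε ((2 * Real.pi * η : ℝ) : ℂ)‖ * ‖V η‖ := by ring
          _ ≤ 12 / ε ^ 2 * ‖V η‖ := mul_le_mul_of_nonneg_right h2 (norm_nonneg _)
          _ ≤ 12 / ε ^ 2 * (φ η * ‖V η‖) := by
              refine mul_le_mul_of_nonneg_left ?_ (by positivity)
              exact le_mul_of_one_le_left (norm_nonneg _) hp2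
          _ ≤ _ := le_add_of_nonneg_right (by positivity)
      · have h1 := resSymbol_bound_high (ε := ε) h
        calc _ ≤ φ η * min (φ η) R * (2 * ‖V η‖) := by gcongr
          _ = 2 * (φ η * min (φ η) R * ‖V η‖) := by ring
          _ ≤ _ := le_add_of_nonneg_left (by
            have := hφ.pos η
            positivity)
    have hMi : Integrable fun η => φ η * min (φ η) R *
        ‖resSymbol ε ((2 * Real.pi * η : ℝ) : ℂ) * V η‖ := by
      refine ((hVi.const_mul (12 / ε ^ 2)).add (hVψ.const_mul 2)).mono'
        (hψ.cont.aestronglyMeasurable.mul hMVm.norm) (Filter.Eventually.of_forall fun η => ?_)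
      rw [Real.norm_of_nonneg (mul_nonneg (hψ.pos η).le (norm_nonneg _))]
      exact hpt η
    have hωM := (Wiener.of_re hψ hMVm hMi).congr hfix
    have hDle := (hωM.fourier_le hψ hi).2
    have hD2 : D ≤ 12 / ε ^ 2 * (c * (C₁ * ε ^ 2) ^ 2) +
        2 * (4 * c * C₁ * ε ^ 2 * (D + ε ^ 2)) := by
      refine hDle.trans ((integral_mono hMi ((hVi.const_mul (12 / ε ^ 2)).add
        (hVψ.const_mul 2)) hpt).trans ?_)
      simp only [Pi.add_apply]
      rw [integral_add (hVi.const_mul _) (hVψ.const_mul _), integral_const_mul,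
        integral_const_mul]
      gcongr
    have e1 : 12 / ε ^ 2 * (c * (C₁ * ε ^ 2) ^ 2) = 12 * c * C₁ ^ 2 * ε ^ 2 := by
      field_simp
    rw [e1] at hD2
    nlinarith
  -- monotone convergence
  have hφ2 : IsWeight fun η => φ η * φ η := hφ.mul hφ
  have hnn : ∀ η, 0 ≤ φ η * φ η * ‖W η‖ := fun η => mul_nonneg (hφ2.pos η).le (norm_nonneg _)
  have hWm : AEStronglyMeasurable W volume := by
    obtain ⟨G, hG, -⟩ := hω
    exact hG.meas.congr (fourier_ae_eq_of_eq_fourierInv hi.ofReal (hG.integrable hφ) hG.eq).symm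
  have hlim : ∫⁻ η, ENNReal.ofReal (φ η * φ η * ‖W η‖) ≤
      ENNReal.ofReal ((24 * c * C₁ ^ 2 + 1) * ε ^ 2) := by
    have htends := lintegral_tendsto_of_tendsto_of_monotone (μ := (volume : Measure ℝ))
      (f := fun (n : ℕ) η => ENNReal.ofReal (φ η * min (φ η) (n + 1) * ‖W η‖))
      (F := fun η => ENNReal.ofReal (φ η * φ η * ‖W η‖)) (fun n => by
        have := (key (n + 1) (by linarith [(Nat.cast_nonneg n : (0 : ℝ) ≤ n)])).1
        exact this.1.aemeasurable.ennreal_ofReal)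
      (Filter.Eventually.of_forall fun η => by
        intro n n' hnn'
        refine ENNReal.ofReal_le_ofReal ?_
        have h1 : (n : ℝ) ≤ n' := by exact_mod_cast hnn'
        have := (hφ.pos η).le
        gcongr)
      (Filter.Eventually.of_forall fun η => by
        refine tendsto_const_nhds.congr' ?_
        obtain ⟨n₀, hn₀⟩ := exists_nat_ge (φ η)
        filter_upwards [Filter.eventually_ge_atTop n₀] with n hn
        have h1 : (n₀ : ℝ) ≤ n := by exact_mod_cast hn
        rw [min_eq_left (by linarith)])
    refine le_of_tendsto' htends fun n => ?_
    have hk := key (n + 1) (by linarith [(Nat.cast_nonneg n : (0 : ℝ) ≤ n)])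
    rw [← ofReal_integral_eq_lintegral_ofReal hk.1 (Filter.Eventually.of_forall fun η => by
      have := (hφ.pos η).le
      have h2 : 0 ≤ min (φ η) ((n : ℝ) + 1) := le_min this (by positivity)
      positivity)]
    exact ENNReal.ofReal_le_ofReal hk.2
  have hint : Integrable fun η => φ η * φ η * ‖W η‖ := by
    refine ⟨hφ2.cont.aestronglyMeasurable.mul hWm.norm, ?_⟩
    rw [hasFiniteIntegral_iff_ofReal (Filter.Eventually.of_forall hnn)]
    exact hlim.trans_lt ENNReal.ofReal_lt_top
  refine Wiener.of_fourier_le hφ hi hω hint ?_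
  rw [integral_eq_lintegral_of_nonneg_ae (Filter.Eventually.of_forall hnn) hint.1]
  exact ENNReal.toReal_le_of_le_ofReal (by positivity) hlim

/-! ### A priori bounds for the solitary wave -/

theorem weight_apply_ae (a : ℝ) (f : L2w a) :
    weight a f =ᵐ[volume] fun x => (Real.exp (a * x) : ℂ) * f x :=
  MemLp.coeFn_toLp (memLp_weight (Lp.memLp f))

/-- A pointwise arithmetic–geometric mean inequality, to be integrated: the Wiener norm is bounded
by a constant plus half the squared Sobolev norm. The condition `m ≥ 2` makes the Sobolev weight
dominate `1 + η²`. -/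
theorem one_add_abs_mul_le {m : ℕ} (hm : 2 ≤ m) (η y : ℝ) :
    (1 + |η|) * y ≤ (1 + η ^ 2)⁻¹ +
      ((1 + (2 * Real.pi * η) ^ 2) ^ ((m : ℝ) / 2) * y) ^ 2 / 2 := by
  have hpi := Real.pi_gt_three
  have h1 : 1 + η ^ 2 ≤ 1 + (2 * Real.pi * η) ^ 2 := by
    nlinarith [mul_nonneg (sq_nonneg η) (by nlinarith : 0 ≤ Real.pi ^ 2 - 1)]
  have h0 : 1 ≤ 1 + η ^ 2 := by nlinarith [sq_nonneg η]
  have h2 : (1 + η ^ 2) ≤ (1 + (2 * Real.pi * η) ^ 2) ^ ((m : ℝ) / 2) := by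
    have hm' : (1 : ℝ) ≤ (m : ℝ) / 2 := by
      have : (2 : ℝ) ≤ m := by exact_mod_cast hm
      linarith
    calc 1 + η ^ 2 ≤ (1 + (2 * Real.pi * η) ^ 2) ^ (1 : ℝ) := by rw [Real.rpow_one]; exact h1
      _ ≤ _ := Real.rpow_le_rpow_of_exponent_le (h0.trans h1) hm'
  set w := (1 + (2 * Real.pi * η) ^ 2) ^ ((m : ℝ) / 2) with hw
  have h3 : (1 + |η|) ^ 2 ≤ 2 * (1 + η ^ 2) := by
    rw [← sq_abs η]; nlinarith [sq_nonneg (1 - |η|)]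
  have h4 : ((1 + η ^ 2) * y) ^ 2 ≤ (w * y) ^ 2 := by
    rw [mul_pow, mul_pow]
    exact mul_le_mul_of_nonneg_right (pow_le_pow_left₀ (by linarith) h2 2) (sq_nonneg y)
  have h5 : (1 + |η|) * y ≤ (1 + η ^ 2)⁻¹ + ((1 + η ^ 2) * y) ^ 2 / 2 := by
    set t := 1 + η ^ 2 with ht
    have e : t⁻¹ * t = 1 := inv_mul_cancel₀ (by linarith)
    have h6 : 0 ≤ t⁻¹ := inv_nonneg.2 (by linarith)
    have h7 : ((1 + |η|) * t⁻¹) ^ 2 ≤ 2 * t⁻¹ := by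
      rw [mul_pow]
      calc _ ≤ 2 * t * t⁻¹ ^ 2 := mul_le_mul_of_nonneg_right h3 (sq_nonneg _)
        _ = 2 * t⁻¹ * (t⁻¹ * t) := by ring
        _ = _ := by rw [e, mul_one]
    have h8 : (1 + |η|) * y = ((1 + |η|) * t⁻¹) * (t * y) := by
      rw [show ((1 + |η|) * t⁻¹) * (t * y) = (1 + |η|) * y * (t⁻¹ * t) by ring, e, mul_one]
    rw [h8]
    nlinarith [sq_nonneg ((1 + |η|) * t⁻¹ - t * y)]
  linarith

/-- Functions in the unit ball of `H^m_a`, `m ≥ 2`, are in the Wiener algebra after multiplication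
by the exponential weight. -/
theorem exists_wiener_weight {m : ℕ} (hm : 2 ≤ m) : ∃ B, ∀ (a : ℝ) (f : L2w a),
    sobolevNorm a m f ≤ 1 → ∃ Φ : ℝ → ℝ, Wiener (fun η => 1 + |η|) Φ B ∧
      MemLp Φ 2 volume ∧ ∀ᵐ x, (weight a f x).re = Φ x := by
  refine ⟨(∫ η : ℝ, (1 + η ^ 2)⁻¹) + 1 / 2, fun a f hf => ?_⟩
  have hφ : IsWeight fun η => 1 + |η| := by simpa using isWeight_one_add_abs one_pos
  set F : Lp ℂ 2 (volume : Measure ℝ) := 𝓕 (weight a f) with hF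
  set w : ℝ → ℂ := fun κ : ℝ => (((1 + (2 * Real.pi * κ) ^ 2) ^ ((m : ℝ) / 2) : ℝ) : ℂ) * F κ
    with hw
  have hf' : eLpNorm w 2 volume ≤ 1 := hf
  have hwm : AEStronglyMeasurable w volume := by
    refine AEStronglyMeasurable.mul ?_ (Lp.memLp F).1
    refine Measurable.aestronglyMeasurable ?_
    fun_prop
  have hw2 : MemLp w 2 volume := ⟨hwm, hf'.trans_lt ENNReal.one_lt_top⟩
  have hwi : Integrable fun κ => ‖w κ‖ ^ 2 := hw2.norm.integrable_sq
  have hwint : ∫ κ, ‖w κ‖ ^ 2 ≤ 1 := by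
    have h1 := hw2.eLpNorm_eq_integral_rpow_norm (by norm_num) (by norm_num)
    rw [h1, ← ENNReal.ofReal_one, ENNReal.ofReal_le_ofReal_iff zero_le_one] at hf'
    simp only [ENNReal.toReal_ofNat, Real.rpow_two] at hf'
    have h2 : 0 ≤ ∫ κ, ‖w κ‖ ^ 2 := integral_nonneg fun _ => sq_nonneg _
    by_contra hlt
    push Not at hlt
    exact absurd hf' (not_le.2 (Real.one_lt_rpow hlt (by norm_num)))
  have hpt : ∀ η, (1 + |η|) * ‖F η‖ ≤ (1 + η ^ 2)⁻¹ + ‖w η‖ ^ 2 / 2 := fun η => by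
    have h := one_add_abs_mul_le hm η ‖F η‖
    have e : ‖w η‖ = (1 + (2 * Real.pi * η) ^ 2) ^ ((m : ℝ) / 2) * ‖F η‖ := by
      rw [hw]
      simp only [norm_mul, Complex.norm_real]
      rw [Real.norm_of_nonneg (Real.rpow_nonneg (by positivity) _)]
    rwa [e]
  have hdom : Integrable fun η => (1 + η ^ 2)⁻¹ + ‖w η‖ ^ 2 / 2 :=
    integrable_inv_one_add_sq.add (hwi.div_const 2)
  have hFi : Integrable fun η => (1 + |η|) * ‖F η‖ := by
    refine hdom.mono' (hφ.cont.aestronglyMeasurable.mul (Lp.memLp F).1.norm)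
      (Filter.Eventually.of_forall fun η => ?_)
    rw [Real.norm_of_nonneg (mul_nonneg (hφ.pos η).le (norm_nonneg _))]
    exact hpt η
  have hFle : ∫ η, (1 + |η|) * ‖F η‖ ≤ (∫ η : ℝ, (1 + η ^ 2)⁻¹) + 1 / 2 := by
    refine (integral_mono hFi hdom hpt).trans ?_
    rw [integral_add integrable_inv_one_add_sq (hwi.div_const 2), integral_div]
    linarith
  have hFint : Integrable F := integrable_of_weighted hφ (Lp.memLp F).1 hFi
  have hinv : weight a f =ᵐ[volume] 𝓕⁻ (F : ℝ → ℂ) := by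
    have h := fourierInv_toLp_ae hFint (Lp.memLp F)
    rwa [Lp.toLp_coeFn, hF, FourierTransform.fourierInv_fourier_eq] at h
  refine ⟨fun x => (𝓕⁻ (F : ℝ → ℂ) x).re, (Wiener.of_re hφ (Lp.memLp F).1 hFi).mono hFle,
    ?_, ?_⟩
  · have h1 : MemLp (𝓕⁻ (F : ℝ → ℂ)) 2 volume := (memLp_congr_ae hinv).1 (Lp.memLp _)
    exact h1.re
  · filter_upwards [hinv] with x hx
    rw [hx]

theorem memLp_two_inv_cosh_mul {b : ℝ} (hb : 0 < b) :
    MemLp (fun x => (Real.cosh (b * x))⁻¹) 2 volume := by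
  have hc : Continuous fun x => (Real.cosh (b * x))⁻¹ :=
    (Real.continuous_cosh.comp (by fun_prop)).inv₀ fun x => (Real.cosh_pos _).ne'
  have hi : Integrable fun x => (Real.cosh (b * x))⁻¹ :=
    integrable_inv_cosh.comp_mul_left' hb.ne'
  rw [memLp_two_iff_integrable_sq hc.aestronglyMeasurable]
  refine hi.mono' (hc.pow 2).aestronglyMeasurable (Filter.Eventually.of_forall fun x => ?_)
  have h1 : 0 ≤ (Real.cosh (b * x))⁻¹ := inv_nonneg.2 (Real.cosh_pos _).le
  have h2 : (Real.cosh (b * x))⁻¹ ≤ 1 := inv_le_one_of_one_le₀ (Real.one_le_cosh _)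
  rw [Real.norm_of_nonneg (by positivity)]
  nlinarith

/-- A solitary wave is integrable and `ε⁻² ω(· / ε)` is bounded in the Wiener algebra with one
derivative. -/
theorem exists_wiener_of_isSolitaryWave {α : ℝ} (hα : 0 < α) {m : ℕ} (hm : 2 ≤ m) {μ : ℝ}
    (hμ : 0 < μ) : ∃ C, 1 ≤ C ∧ ∀ ε, 0 < ε → ε < 1 → ∀ ω : ℝ → ℝ, IsSolitaryWave α m μ ε ω →
      Integrable ω ∧ Wiener (fun η => 1 + |η| / ε) ω (C * ε ^ 2) := by
  obtain ⟨B, hB⟩ := exists_wiener_weight hm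
  obtain ⟨Nα, hNα⟩ := exists_wiener_inv_cosh_mul hα
  have h3 : (0 : ℝ) < √3 / 2 := by positivity
  obtain ⟨Ns, hNs⟩ := exists_wiener_inv_cosh_mul h3
  have hφ : IsWeight fun η => 1 + |η| := by simpa using isWeight_one_add_abs one_pos
  refine ⟨max 1 (Ns ^ 2 + Nα * (|1 / 2| * (B + B))), le_max_left _ _,
    fun ε hε hε1 ω hω => ?_⟩
  obtain ⟨f, hf, hfs⟩ := hω.near_sech
  obtain ⟨Φ, hΦW, hΦ2, hΦe⟩ := hB α f (hfs.le.trans (by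
    rw [← ENNReal.ofReal_one]
    exact ENNReal.ofReal_le_ofReal (Real.rpow_le_one hε.le hε1.le hμ.le)))
  -- The remainder `r = Ω - sech²` satisfies `e^(αx) r(x) = Φ(x)`, hence `e^(-αx) r(x) = Φ(-x)` by
  -- evenness. Adding the two, `r = sech(αx) (Φ(x) + Φ(-x)) / 2`, which decays at both ends although
  -- the weight controls only one.
  set g : ℝ → ℝ := fun x => (Real.cosh (√3 / 2 * x))⁻¹ ^ 2 +
    (Real.cosh (α * x))⁻¹ * (1 / 2 * (Φ x + Φ (-x))) with hg
  have hgW : Wiener (fun η => 1 + |η|) g (Ns ^ 2 + Nα * (|1 / 2| * (B + B))) :=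
    (hNs.sq hφ).add hφ (hNα.mul hφ ((hΦW.add hφ (hΦW.comp_neg hφ)).const_mul (1 / 2)))
  have hgi : Integrable g := by
    have h1 : MemLp (fun x => Φ (-x)) 2 volume :=
      hΦ2.comp_measurePreserving (Measure.measurePreserving_neg volume)
    exact (memLp_two_inv_cosh_mul h3).integrable_sq.add
      ((memLp_two_inv_cosh_mul hα).integrable_mul ((hΦ2.add h1).const_mul (1 / 2)))
  -- Continuity turns the almost everywhere identity with `g` into an identity at every point.
  have hωc : Continuous ω := by
    rw [funext hω.fixed_point]; exact continuous_fourierFun _ _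
  have hE : ∀ᵐ x, Real.exp (α * x) * (ω (x / ε) / ε ^ 2 - 1 / Real.cosh (√3 * x / 2) ^ 2) = Φ x := by
    filter_upwards [hΦe, weight_apply_ae α f, ac_wMeasure α hf] with x h1 h2 h4
    rw [← h1, h2, h4, ← Complex.ofReal_mul, Complex.ofReal_re]
  have hE' : ∀ᵐ x, Real.exp (-(α * x)) * (ω (x / ε) / ε ^ 2 - 1 / Real.cosh (√3 * x / 2) ^ 2) =
      Φ (-x) := by
    have h := (Measure.measurePreserving_neg (volume : Measure ℝ)).quasiMeasurePreserving.ae hE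
    filter_upwards [h] with x hx
    rw [← hx, neg_div, hω.even, mul_neg, mul_neg, neg_div, Real.cosh_neg]
  have hae : (fun x => ω (x / ε) / ε ^ 2) =ᵐ[volume] g := by
    filter_upwards [hE, hE'] with x h1 h2
    simp only [hg]
    rw [← h1, ← h2, show √3 * x / 2 = √3 / 2 * x by ring]
    have hc : Real.exp (α * x) = 2 * Real.cosh (α * x) - Real.exp (-(α * x)) := by
      rw [Real.cosh_eq]; ring
    rw [hc]
    have := (Real.cosh_pos (α * x)).ne'
    field_simp
    ring
  have hgε : ∀ y, ω y = ε ^ 2 * g (ε * y) := fun y => by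
    have h := (Continuous.ae_eq_iff_eq volume (by fun_prop) (hgW.continuous hφ)).1 hae
    have h' := congrFun h (ε * y)
    rw [← h', mul_div_cancel_left₀ _ hε.ne']
    field_simp
  refine ⟨?_, ?_⟩
  · rw [funext hgε]
    exact (hgi.comp_mul_left' hε.ne').const_mul _
  · refine (((hgW.comp_mul hε).const_mul (ε ^ 2)).congr hgε).mono ?_
    rw [abs_of_nonneg (sq_nonneg ε), mul_comm]
    exact mul_le_mul_of_nonneg_right (le_max_right _ _) (sq_nonneg ε)

/-! ### The coefficients of the linearized operator -/

/-- Bounds for the coefficients of the linearized operator. -/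
structure CoeffBounds (M ε : ℝ) (ω : ℝ → ℝ) : Prop where
  wiener_p : Wiener (fun η => 1 + |η| / ε) (fun x => p ω x - 1) (M * ε ^ 2)
  wiener_sqrt_p : Wiener (fun η => 1 + |η| / ε) (fun x => √(p ω x) - 1) (M * ε ^ 2)
  wiener_q : Wiener (fun η => 1 + |η| / ε) (fun x => q ε ω x - 1) (M * ε ^ 2)
  wiener_rho : Wiener (fun η => 1 + |η| / ε) (fun x => rho ε ω x - 1) (M * ε ^ 2)
  continuous_deriv_p : Continuous (deriv (p ω))
  abs_deriv_p_le : ∀ x, |deriv (p ω) x| ≤ M * ε ^ 3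
  continuous_r : Continuous fun x => deriv (q ε ω) x * p ω x * (q ε ω x)⁻¹
  abs_r_le : ∀ x, |deriv (q ε ω) x * p ω x * (q ε ω x)⁻¹| ≤ M * ε ^ 3

-- Every coefficient is built from `ω`, `τ` and `v̄'` by algebra, inverses and square roots, so it
-- stays in the algebra. One power of the weight is spent on `v̄'` inside `q`, the second on `q'`;
-- each derivative also produces a factor `ε`, whence the `ε³` bounds on `p'` and `R₁`.
set_option maxHeartbeats 1000000 in
theorem exists_coeffBounds_of_wiener : ∃ c, 1 ≤ c ∧ ∀ ε, 0 < ε → ε ^ 2 ≤ 1 / 2 →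
    ∀ (ω : ℝ → ℝ) (C : ℝ), 0 ≤ C → Integrable ω →
      Wiener (fun η => (1 + |η| / ε) * (1 + |η| / ε)) ω (C * ε ^ 2) → c * (C * ε ^ 2) ≤ 1 →
      CoeffBounds (c * C) ε ω := by
  obtain ⟨c₁, hc₁, hinv⟩ := Wiener.exists_one_add_rpow (-1)
  obtain ⟨c₂, hc₂, hsqrt⟩ := Wiener.exists_one_add_rpow (1 / 2)
  set c := max c₁ c₂ with hc
  have hc1 : 1 ≤ c := hc₁.trans (le_max_left _ _)
  -- The power `c⁴` is reached along the chain from `u₁`, `v̄` through `(1 - v₁)/(1 + ω)` and `q` to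
  -- `ρ`, one factor for each nested inverse or root. The number 3200 exceeds `904 π`, the factor in
  -- the bound for `q' p q⁻¹`.
  refine ⟨3200 * c ^ 4, by nlinarith [one_le_pow₀ hc1 (n := 4)],
    fun ε hε hε2 ω C hC hi hω hsm => ?_⟩
  set N := C * ε ^ 2 with hN
  have hN0 : 0 ≤ N := by positivity
  have hε1 : ε ≤ 1 := by nlinarith
  set φ : ℝ → ℝ := fun η => 1 + |η| / ε with hφd
  have hφ : IsWeight φ := isWeight_one_add_abs hε
  set φ₂ : ℝ → ℝ := fun η => (1 + |η| / ε) * (1 + |η| / ε) with hφ₂d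
  have hφ₂ : IsWeight φ₂ := hφ.mul hφ
  have hle : ∀ x, φ x ≤ φ₂ x := fun x => le_mul_of_one_le_left (hφ.pos x).le (hφ.one_le x)
  have hinv' : ∀ (ψ : ℝ → ℝ), IsWeight ψ → ∀ (w : ℝ → ℝ) (K : ℝ), Wiener ψ w K → K ≤ 1 / 4 →
      Wiener ψ (fun x => (1 + w x)⁻¹ - 1) (c * K) := fun ψ hψ w K hw hK => by
    refine ((hinv ψ hψ w K hw hK).congr fun x => ?_).mono
      (mul_le_mul_of_nonneg_right (le_max_left _ _) (hw.nonneg hψ))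
    rw [Real.rpow_neg_one]
  have hsqrt' : ∀ (ψ : ℝ → ℝ), IsWeight ψ → ∀ (w : ℝ → ℝ) (K : ℝ), Wiener ψ w K → K ≤ 1 / 4 →
      Wiener ψ (fun x => √(1 + w x) - 1) (c * K) := fun ψ hψ w K hw hK => by
    refine ((hsqrt ψ hψ w K hw hK).congr fun x => ?_).mono
      (mul_le_mul_of_nonneg_right (le_max_right _ _) (hw.nonneg hψ))
    rw [Real.sqrt_eq_rpow]
  have k2 : c ≤ c ^ 2 := by nlinarith
  have k3 : c ^ 2 ≤ c ^ 3 := by nlinarith [sq_nonneg c]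
  have k4 : c ^ 3 ≤ c ^ 4 := by nlinarith [pow_nonneg (zero_le_one.trans hc1) 3]
  have l4 : 3200 * (c ^ 4 * N) ≤ 1 := by linarith
  have l3 : c ^ 3 * N ≤ c ^ 4 * N := mul_le_mul_of_nonneg_right k4 hN0
  have l2 : c ^ 2 * N ≤ c ^ 3 * N := mul_le_mul_of_nonneg_right k3 hN0
  have l1 : c * N ≤ c ^ 2 * N := mul_le_mul_of_nonneg_right k2 hN0
  have l0 : N ≤ c * N := le_mul_of_one_le_left hN0 hc1
  have hcN : 0 ≤ c * N := hN0.trans l0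
  have hτ : Wiener φ₂ (tau ω) N := wiener_tau hφ₂ hi hω
  have hd : Wiener φ₂ (fun x => 2 * ω x + ω x ^ 2 + tau ω x ^ 2) (4 * N) :=
    (((hω.const_mul 2).add hφ₂ (hω.sq hφ₂)).add hφ₂ (hτ.sq hφ₂)).mono (by
      rw [abs_of_pos two_pos]; nlinarith)
  have he := hinv' φ₂ hφ₂ _ _ hd (by linarith)
  have hden : ∀ x, (1 + ω x) ^ 2 + tau ω x ^ 2 = 1 + (2 * ω x + ω x ^ 2 + tau ω x ^ 2) :=
    fun x => by ring
  have hn : Wiener φ₂ (fun x => ω x + ω x ^ 2 + tau ω x ^ 2) (3 * N) :=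
    ((hω.add hφ₂ (hω.sq hφ₂)).add hφ₂ (hτ.sq hφ₂)).mono (by nlinarith)
  have hu : Wiener φ₂ (u₁ ω) (6 * (c * N)) := by
    refine ((hn.add hφ₂ (hn.mul hφ₂ he)).congr fun x => ?_).mono (by nlinarith)
    rw [u₁, hden, div_eq_mul_inv]; ring
  have hv : Wiener φ₂ (vBar ω) (2 * (c * N)) := by
    refine ((hτ.add hφ₂ (hτ.mul hφ₂ he)).const_mul (-1) |>.congr fun x => ?_).mono (by
      rw [abs_neg, abs_one]; nlinarith)
    rw [vBar, hden, div_eq_mul_inv]; ring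
  have hf := hinv' φ₂ hφ₂ _ _ hω (by linarith)
  have hp : Wiener φ₂ (fun x => p ω x - 1) (13 * (c ^ 2 * N)) := by
    refine (((hf.sub hφ₂ hu).sub hφ₂ (hu.mul hφ₂ hf)).congr fun x => ?_).mono (by nlinarith)
    rw [p, div_eq_mul_inv]; ring
  have hp1 : Wiener φ (fun x => p ω x - 1) (13 * (c ^ 2 * N)) := hp.of_weight_le hφ hle
  have hpb : ∀ x, |p ω x - 1| ≤ 1 / 4 := fun x => (hp.abs_le hφ₂ x).trans (by linarith)
  have hπ := Real.pi_lt_d2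
  have hπ0 := Real.pi_pos
  have hv' : Wiener φ (deriv (vBar ω)) (14 * (c * N)) := by
    refine (Wiener.hasDerivAt hε hφ hv).2.mono ?_
    have : Real.pi * ε ≤ 3.15 := by nlinarith
    nlinarith
  obtain ⟨hγ1, hγ2⟩ := gam_mem hε2
  have hγ0 : 0 < gam ε := by linarith
  have hv₁ : Wiener φ (v₁ ε ω) (56 * (c * N)) := by
    refine (((hv'.add hφ (hv'.mul hφ hp1)).const_mul (gam ε)⁻¹).congr fun x => ?_).mono ?_
    · rw [v₁, p, div_eq_mul_inv, mul_inv]; ring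
    · rw [abs_of_pos (inv_pos.2 hγ0)]
      have h1 : (gam ε)⁻¹ ≤ 2 := by
        rw [inv_le_comm₀ hγ0 two_pos]; linarith
      have h2 : 14 * (c * N) + 14 * (c * N) * (13 * (c ^ 2 * N)) ≤ 28 * (c * N) := by nlinarith
      have h3 : 0 ≤ 14 * (c * N) + 14 * (c * N) * (13 * (c ^ 2 * N)) := by positivity
      nlinarith
  have hf1 := hf.of_weight_le hφ hle
  have hq2 : Wiener φ (fun x => (1 - v₁ ε ω x) / (1 + ω x) - 1) (113 * (c ^ 2 * N)) := by
    refine (((hf1.sub hφ hv₁).sub hφ (hv₁.mul hφ hf1)).congr fun x => ?_).mono (by nlinarith)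
    rw [div_eq_mul_inv]; ring
  have hq : Wiener φ (fun x => q ε ω x - 1) (113 * (c ^ 3 * N)) := by
    refine ((hsqrt' φ hφ _ _ hq2 (by linarith)).congr fun x => ?_).mono (le_of_eq (by ring))
    rw [q, add_sub_cancel]
  have hρ : Wiener φ (fun x => rho ε ω x - 1) (113 * (c ^ 4 * N)) := by
    refine ((hsqrt' φ hφ _ _ hq (by linarith)).congr fun x => ?_).mono (le_of_eq (by ring))
    rw [rho, add_sub_cancel]
  have hsp : Wiener φ (fun x => √(p ω x) - 1) (13 * (c ^ 3 * N)) := by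
    refine ((hsqrt' φ hφ _ _ hp1 (by linarith)).congr fun x => ?_).mono (le_of_eq (by ring))
    rw [add_sub_cancel]
  have hqb : ∀ x, |q ε ω x - 1| ≤ 1 / 4 := fun x => (hq.abs_le hφ x).trans (by linarith)
  have hdp : deriv (p ω) = deriv (fun x => p ω x - 1) := by
    ext x; rw [deriv_sub_const]
  have hdq : deriv (q ε ω) = deriv (fun x => q ε ω x - 1) := by
    ext x; rw [deriv_sub_const]
  have hp' := (Wiener.hasDerivAt hε hφ hp).2
  have hq' := (Wiener.hasDerivAt hε isWeight_one
    (hq.of_weight_le (ψ := fun η => 1 * (1 + |η| / ε)) (by simpa using hφ)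
      fun x => by rw [one_mul])).2
  have hpc : Continuous (p ω) := by
    have := (hp1.continuous hφ).add_const 1
    simpa using this
  have hqc : Continuous (q ε ω) := by
    have := (hq.continuous hφ).add_const 1
    simpa using this
  have hq0 : ∀ x, 3 / 4 ≤ q ε ω x := fun x => by linarith [(abs_le.1 (hqb x)).1]
  have e1 : 3200 * c ^ 4 * C * ε ^ 2 = 3200 * (c ^ 4 * N) := by rw [hN]; ring
  have e2 : 3200 * c ^ 4 * C * ε ^ 3 = 3200 * (c ^ 4 * N) * ε := by rw [hN]; ring
  have l40 : 0 ≤ c ^ 4 * N := by positivity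
  refine ⟨hp1.mono ?_, hsp.mono ?_, hq.mono ?_, hρ.mono ?_, ?_, fun x => ?_, ?_, fun x => ?_⟩
  · rw [e1]; linarith
  · rw [e1]; linarith
  · rw [e1]; linarith
  · rw [e1]; linarith
  · rw [hdp]; exact hp'.continuous hφ
  · rw [hdp, e2]
    refine (hp'.abs_le hφ x).trans ?_
    calc _ = 2 * Real.pi * (13 * (c ^ 2 * N)) * ε := by ring
      _ ≤ _ := mul_le_mul_of_nonneg_right (by nlinarith) hε.le
  · rw [hdq]
    exact ((hq'.continuous isWeight_one).mul hpc).mul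
      (hqc.inv₀ fun x => (by linarith [hq0 x] : 0 < q ε ω x).ne')
  · rw [hdq, e2, abs_mul, abs_mul, abs_inv, abs_of_pos (by linarith [hq0 x] : 0 < q ε ω x)]
    have h1 := hq'.abs_le isWeight_one x
    have h2 : |p ω x| ≤ 2 := by
      have := abs_le.1 (hpb x)
      rw [abs_le]; constructor <;> linarith [this.1, this.2]
    have h3 : (q ε ω x)⁻¹ ≤ 2 := by
      rw [inv_le_comm₀ (by linarith [hq0 x]) two_pos]; linarith [hq0 x]
    have h4 : 0 ≤ 2 * Real.pi * ε * (113 * (c ^ 3 * N)) := by positivity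
    calc _ ≤ (2 * Real.pi * ε * (113 * (c ^ 3 * N))) * 2 * 2 := by
          refine mul_le_mul (mul_le_mul h1 h2 (abs_nonneg _) h4) h3 ?_ (by positivity)
          exact inv_nonneg.2 (by linarith [hq0 x])
      _ = 904 * Real.pi * (c ^ 3 * N) * ε := by ring
      _ ≤ _ := mul_le_mul_of_nonneg_right (by nlinarith) hε.le

theorem exists_coeffBounds {α : ℝ} (hα : 0 < α) {m : ℕ} (hm : 2 ≤ m) {μ : ℝ} (hμ : 0 < μ) :
    ∃ M, 1 ≤ M ∧ ∃ ε₁ > 0, ∀ ε, 0 < ε → ε < ε₁ → ∀ ω : ℝ → ℝ, IsSolitaryWave α m μ ε ω →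
      CoeffBounds M ε ω := by
  obtain ⟨C₁, hC₁, h₁⟩ := exists_wiener_of_isSolitaryWave hα hm hμ
  obtain ⟨C₂, hC₂, ε₁, hε₁, h₂⟩ := exists_wiener_sq_of_fixed_point hC₁
  obtain ⟨c, hc, h₃⟩ := exists_coeffBounds_of_wiener
  have hcC : 1 ≤ c * C₂ := one_le_mul_of_one_le_of_one_le hc hC₂
  refine ⟨c * C₂, hcC, min ε₁ (1 / (2 * (c * C₂))), lt_min hε₁ (by positivity),
    fun ε hε hlt ω hω => ?_⟩
  have hε' := hlt.trans_le (min_le_right _ _)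
  rw [lt_div_iff₀ (by positivity)] at hε'
  have hεh : ε < 1 / 2 := by nlinarith
  obtain ⟨hi, hW⟩ := h₁ ε hε (by linarith) ω hω
  have hW2 := h₂ ε hε (hlt.trans_le (min_le_left _ _)) ω hi hW hω.fixed_point
  exact h₃ ε hε (by nlinarith) ω C₂ (by linarith) hi hW2 (by nlinarith)

/-! ### The symbols on the line `Im ξ = a` -/

/-- The point `k + i a`. -/
def freq (a k : ℝ) : ℂ := (k : ℂ) + Complex.I * a

@[simp] theorem freq_re (a k : ℝ) : (freq a k).re = k := by simp [freq]

@[simp] theorem freq_im (a k : ℝ) : (freq a k).im = a := by simp [freq]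

theorem norm_freq_sq (a k : ℝ) : ‖freq a k‖ ^ 2 = k ^ 2 + a ^ 2 := by
  rw [Complex.sq_norm, Complex.normSq_apply, freq_re, freq_im]; ring

theorem abs_le_norm_freq (a k : ℝ) : |k| ≤ ‖freq a k‖ := by
  simpa using Complex.abs_re_le_norm (freq a k)

theorem norm_freq_pos {a : ℝ} (ha : 0 < a) (k : ℝ) : 0 < ‖freq a k‖ := by
  rw [norm_pos_iff]
  intro h
  have := congrArg Complex.im h
  simp at this
  exact ha.ne' this

theorem norm_freq_le {a : ℝ} (ha : 0 ≤ a) (k : ℝ) : ‖freq a k‖ ≤ |k| + a := by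
  have := Complex.norm_le_abs_re_add_abs_im (freq a k)
  rwa [freq_re, freq_im, abs_of_nonneg ha] at this

theorem sinh_freq (a k : ℝ) : Complex.sinh (freq a k) =
    ⟨Real.sinh k * Real.cos a, Real.cosh k * Real.sin a⟩ := by
  rw [freq, mul_comm, Complex.sinh_add, Complex.sinh_mul_I, Complex.cosh_mul_I]
  rw [← Complex.ofReal_sinh, ← Complex.ofReal_cosh, ← Complex.ofReal_sin, ← Complex.ofReal_cos]
  apply Complex.ext <;> simp only [Complex.add_re, Complex.add_im, Complex.mul_re, Complex.mul_im,
    Complex.ofReal_re, Complex.ofReal_im, Complex.I_re, Complex.I_im] <;> ring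

theorem cosh_freq (a k : ℝ) : Complex.cosh (freq a k) =
    ⟨Real.cosh k * Real.cos a, Real.sinh k * Real.sin a⟩ := by
  rw [freq, mul_comm, Complex.cosh_add, Complex.sinh_mul_I, Complex.cosh_mul_I]
  rw [← Complex.ofReal_sinh, ← Complex.ofReal_cosh, ← Complex.ofReal_sin, ← Complex.ofReal_cos]
  apply Complex.ext <;> simp only [Complex.add_re, Complex.add_im, Complex.mul_re, Complex.mul_im,
    Complex.ofReal_re, Complex.ofReal_im, Complex.I_re, Complex.I_im] <;> ring

theorem norm_sinh_freq_sq (a k : ℝ) :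
    ‖Complex.sinh (freq a k)‖ ^ 2 = Real.sinh k ^ 2 + Real.sin a ^ 2 := by
  rw [Complex.sq_norm, Complex.normSq_apply, sinh_freq]
  have h1 := Real.cosh_sq k
  have h2 := Real.sin_sq_add_cos_sq a
  simp only
  linear_combination Real.sin a ^ 2 * h1 + Real.sinh k ^ 2 * h2

theorem norm_cosh_freq_sq (a k : ℝ) :
    ‖Complex.cosh (freq a k)‖ ^ 2 = Real.cosh k ^ 2 - Real.sin a ^ 2 := by
  rw [Complex.sq_norm, Complex.normSq_apply, cosh_freq]
  have h1 := Real.cosh_sq k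
  have h2 := Real.sin_sq_add_cos_sq a
  simp only
  linear_combination -Real.sin a ^ 2 * h1 + Real.cosh k ^ 2 * h2

theorem sin_sq_le_quarter {a : ℝ} (ha : 0 < a) (ha' : a ≤ 1 / 2) :
    0 < Real.sin a ∧ Real.sin a ^ 2 ≤ a ^ 2 ∧ a ^ 2 ≤ 4 * Real.sin a ^ 2 ∧ 0 < Real.cos a := by
  have h1 := Real.sin_gt_sub_cube ha
  have h2 := Real.sin_lt ha
  have h3 : 0 < Real.cos a := Real.cos_pos_of_mem_Ioo ⟨by linarith [Real.pi_pos],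
    by linarith [Real.pi_gt_three]⟩
  have h5 : a ^ 3 ≤ a := by nlinarith [sq_nonneg a]
  have h4 : a / 2 ≤ Real.sin a := by nlinarith
  refine ⟨by linarith, by nlinarith, by nlinarith, h3⟩

theorem cosh_sq_sub_pos {a : ℝ} (ha : 0 < a) (ha' : a ≤ 1 / 2) (k : ℝ) :
    3 / 4 * Real.cosh k ^ 2 ≤ Real.cosh k ^ 2 - Real.sin a ^ 2 := by
  have h1 := (sin_sq_le_quarter ha ha').2.1
  have h2 := one_le_pow₀ (Real.one_le_cosh k) (n := 2)
  nlinarith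

theorem cosh_freq_ne_zero {a : ℝ} (ha : 0 < a) (ha' : a ≤ 1 / 2) (k : ℝ) :
    Complex.cosh (freq a k) ≠ 0 := by
  intro h
  have h1 := norm_cosh_freq_sq a k
  rw [h, norm_zero] at h1
  have h2 := cosh_sq_sub_pos ha ha' k
  have h3 := Real.cosh_pos k
  nlinarith [pow_pos h3 2]

theorem tanh_freq (a k : ℝ) :
    (Complex.tanh (freq a k)).re =
      Real.sinh k * Real.cosh k / (Real.cosh k ^ 2 - Real.sin a ^ 2) ∧
    (Complex.tanh (freq a k)).im =
      Real.sin a * Real.cos a / (Real.cosh k ^ 2 - Real.sin a ^ 2) := by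
  have hc := Complex.sq_norm (Complex.cosh (freq a k))
  rw [norm_cosh_freq_sq] at hc
  rw [Complex.tanh_eq_sinh_div_cosh, Complex.div_re, Complex.div_im, ← hc, sinh_freq, cosh_freq]
  simp only
  have h1 := Real.cosh_sq k
  have h2 := Real.sin_sq_add_cos_sq a
  rw [← add_div, ← sub_div]
  constructor
  · congr 1; linear_combination Real.sinh k * Real.cosh k * h2
  · congr 1; linear_combination Real.sin a * Real.cos a * h1

theorem norm_tanh_freq_sq (a k : ℝ) : ‖Complex.tanh (freq a k)‖ ^ 2 =
    (Real.sinh k ^ 2 + Real.sin a ^ 2) / (Real.cosh k ^ 2 - Real.sin a ^ 2) := by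
  rw [Complex.tanh_eq_sinh_div_cosh, norm_div, div_pow, norm_sinh_freq_sq, norm_cosh_freq_sq]

/-! ### Size and signs of `tanh ξ` on the line `Im ξ = a`. -/

section bounds

variable {a : ℝ} (ha : 0 < a) (ha' : a ≤ 1 / 2) (k : ℝ)
include ha ha'

theorem cosh_sq_sub_pos' : 0 < Real.cosh k ^ 2 - Real.sin a ^ 2 := by
  have := cosh_sq_sub_pos ha ha' k
  have h3 := pow_pos (Real.cosh_pos k) 2
  linarith

/-- The bound on `tanh k / k` carried to the shifted line. The loss `1 - a²` comes from `|cosh ξ|² =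
cosh² k - sin² a ≥ (1 - a²) cosh² k`. -/
theorem norm_tanh_freq_sq_mul_le :
    ‖Complex.tanh (freq a k)‖ ^ 2 * ((1 + k ^ 2 / 2) * (1 - a ^ 2)) ≤ ‖freq a k‖ ^ 2 := by
  obtain ⟨h1, h2, h3, h4⟩ := sin_sq_le_quarter ha ha'
  rw [norm_tanh_freq_sq, norm_freq_sq, div_mul_eq_mul_div, div_le_iff₀ (cosh_sq_sub_pos' ha ha' k)]
  have h5 := sinh_sq_mul_le k
  have h6 : 1 + k ^ 2 / 2 ≤ Real.cosh k ^ 2 := by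
    have := one_add_half_sq_le_cosh k
    nlinarith [Real.one_le_cosh k]
  have h7 : Real.cosh k ^ 2 * (1 - a ^ 2) ≤ Real.cosh k ^ 2 - Real.sin a ^ 2 := by
    have := one_le_pow₀ (Real.one_le_cosh k) (n := 2)
    nlinarith [mul_nonneg (sub_nonneg.2 this) (sq_nonneg a)]
  have h8 : Real.sin a ^ 2 * (1 + k ^ 2 / 2) ≤ a ^ 2 * Real.cosh k ^ 2 :=
    mul_le_mul h2 h6 (by positivity) (by positivity)
  have h9 : 0 ≤ 1 - a ^ 2 := by nlinarith
  calc _ = (Real.sinh k ^ 2 * (1 + k ^ 2 / 2) + Real.sin a ^ 2 * (1 + k ^ 2 / 2)) * (1 - a ^ 2) := by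
        ring
    _ ≤ (k ^ 2 * Real.cosh k ^ 2 + a ^ 2 * Real.cosh k ^ 2) * (1 - a ^ 2) :=
        mul_le_mul_of_nonneg_right (add_le_add h5 h8) h9
    _ = (k ^ 2 + a ^ 2) * (Real.cosh k ^ 2 * (1 - a ^ 2)) := by ring
    _ ≤ _ := mul_le_mul_of_nonneg_left h7 (by positivity)

theorem norm_tanh_freq_le_one : ‖Complex.tanh (freq a k)‖ ≤ 1 := by
  rw [← sq_le_one_iff₀ (norm_nonneg _), norm_tanh_freq_sq, div_le_one (cosh_sq_sub_pos' ha ha' k)]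
  have := (sin_sq_le_quarter ha ha').2.1
  rw [Real.cosh_sq]
  nlinarith

/-- A lower bound for `tanh ξ`, from which the growth of `|ξ / S|` follows. It rests on `cosh k =
|sinh k| + e^(-|k|)` and `|k| ≤ |sinh k|`. -/
theorem norm_freq_le_mul_norm_tanh :
    ‖freq a k‖ ≤ 2 * (1 + |k|) * ‖Complex.tanh (freq a k)‖ := by
  obtain ⟨h1, h2, h3, h4⟩ := sin_sq_le_quarter ha ha'
  rw [← abs_of_nonneg (norm_nonneg (freq a k)), ← abs_of_nonneg
    (by positivity : 0 ≤ 2 * (1 + |k|) * ‖Complex.tanh (freq a k)‖), ← sq_le_sq, mul_pow, mul_pow,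
    norm_tanh_freq_sq, norm_freq_sq, mul_div_assoc', le_div_iff₀ (cosh_sq_sub_pos' ha ha' k)]
  have h5 : k ^ 2 * Real.cosh k ^ 2 ≤ Real.sinh k ^ 2 * (1 + |k|) ^ 2 := by
    rw [← mul_pow, ← mul_pow, sq_le_sq, abs_mul, abs_mul, abs_of_pos (Real.cosh_pos k),
      abs_of_pos (by positivity : 0 < 1 + |k|)]
    have hs := abs_le_abs_sinh k
    have e1 : Real.cosh k = |Real.sinh k| + Real.exp (-|k|) := by
      rw [Real.abs_sinh, ← Real.cosh_abs k, ← Real.cosh_sub_sinh |k|]; ring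
    have e2 : Real.exp (-|k|) ≤ 1 := Real.exp_le_one_iff.2 (by simp)
    rw [e1]
    nlinarith [abs_nonneg k]
  have h6 : 1 ≤ (1 + |k|) ^ 2 := one_le_pow₀ (by linarith [abs_nonneg k])
  have h7 : Real.cosh k ^ 2 = Real.sinh k ^ 2 + 1 := Real.cosh_sq k
  calc (k ^ 2 + a ^ 2) * (Real.cosh k ^ 2 - Real.sin a ^ 2)
      ≤ (k ^ 2 + a ^ 2) * Real.cosh k ^ 2 :=
        mul_le_mul_of_nonneg_left (by linarith [sq_nonneg (Real.sin a)]) (by positivity)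
    _ = k ^ 2 * Real.cosh k ^ 2 + a ^ 2 * Real.sinh k ^ 2 + a ^ 2 := by rw [h7]; ring
    _ ≤ Real.sinh k ^ 2 * (1 + |k|) ^ 2 + 1 * Real.sinh k ^ 2 + 4 * Real.sin a ^ 2 := by
        gcongr
        nlinarith
    _ ≤ 2 ^ 2 * (1 + |k|) ^ 2 * (Real.sinh k ^ 2 + Real.sin a ^ 2) := by
        nlinarith [mul_nonneg (sub_nonneg.2 h6) (sq_nonneg (Real.sinh k)),
          mul_nonneg (sub_nonneg.2 h6) (sq_nonneg (Real.sin a)), sq_nonneg (Real.sinh k)]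

/-- The last inequality says `k * Im (tanh ξ / ξ) ≤ 0`; it determines on which side of the real axis
the root of `tanh ξ / ξ` lies. -/
theorem tanh_freq_signs :
    0 < (Complex.tanh (freq a k)).im ∧ 0 ≤ k * (Complex.tanh (freq a k)).re ∧
    k ^ 2 * (Complex.tanh (freq a k)).im ≤ a * (k * (Complex.tanh (freq a k)).re) := by
  obtain ⟨h1, h2, h3, h4⟩ := sin_sq_le_quarter ha ha'
  have hD := cosh_sq_sub_pos' ha ha' k
  obtain ⟨e1, e2⟩ := tanh_freq a k
  rw [e1, e2]
  have hks : k ^ 2 ≤ k * Real.sinh k := by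
    rcases le_total 0 k with hk | hk
    · nlinarith [Real.self_le_sinh_iff.2 hk]
    · nlinarith [Real.sinh_le_self_iff.2 hk]
  have hc := Real.one_le_cosh k
  refine ⟨by positivity, ?_, ?_⟩
  · rw [mul_div_assoc', ← mul_assoc]
    have : 0 ≤ k * Real.sinh k := (sq_nonneg k).trans hks
    positivity
  · rw [mul_div_assoc', mul_div_assoc', mul_div_assoc']
    refine div_le_div_of_nonneg_right ?_ hD.le
    have hs := Real.sin_lt ha
    have hcos := Real.cos_le_one a
    have h5 : Real.sin a * Real.cos a ≤ a := by nlinarith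
    have h6 : 0 ≤ k * Real.sinh k := (sq_nonneg k).trans hks
    calc k ^ 2 * (Real.sin a * Real.cos a) ≤ (k * Real.sinh k) * a :=
          mul_le_mul hks h5 (by positivity) h6
      _ = a * (k * (Real.sinh k * 1)) := by ring
      _ ≤ a * (k * (Real.sinh k * Real.cosh k)) := by
          rw [← mul_assoc k, ← mul_assoc k]
          gcongr

end bounds

/-! ### The symbol of `S` on the line `Im ξ = a`. -/

theorem sSymbol_sq (ε : ℝ) (ξ : ℂ) :
    sSymbol ε ξ ^ 2 = -(gam ε : ℂ) * ξ * Complex.tanh ξ := by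
  rw [sSymbol, ← Complex.cpow_nat_mul]
  norm_num

theorem cpow_half_re_nonneg (z : ℂ) : 0 ≤ (z ^ (1 / 2 : ℂ)).re := by
  by_cases hz : z = 0
  · simp [hz]
  · rw [Complex.cpow_def_of_ne_zero hz, Complex.exp_re]
    refine mul_nonneg (Real.exp_pos _).le (Real.cos_nonneg_of_mem_Icc ?_)
    have e : (Complex.log z * (1 / 2)).im = z.arg / 2 := by
      rw [show Complex.log z * (1 / 2) = Complex.log z / (2 : ℕ) by push_cast; ring,
        Complex.div_natCast_im, Complex.log_im]
      norm_num
    rw [e]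
    constructor <;> linarith [Complex.neg_pi_lt_arg z, Complex.arg_le_pi z]

theorem sSymbol_freq_sq_im (ε a k : ℝ) :
    2 * ((sSymbol ε (freq a k)).re * (sSymbol ε (freq a k)).im) =
      -(gam ε * (k * (Complex.tanh (freq a k)).im + a * (Complex.tanh (freq a k)).re)) := by
  have h := congrArg Complex.im (sSymbol_sq ε (freq a k))
  rw [sq, Complex.mul_im, mul_assoc, neg_mul, Complex.neg_im, Complex.im_ofReal_mul,
    Complex.mul_im, freq_re, freq_im] at h
  linarith

theorem sSymbol_freq_sq_re (ε a k : ℝ) :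
    (sSymbol ε (freq a k)).re ^ 2 - (sSymbol ε (freq a k)).im ^ 2 =
      -(gam ε * (k * (Complex.tanh (freq a k)).re - a * (Complex.tanh (freq a k)).im)) := by
  have h := congrArg Complex.re (sSymbol_sq ε (freq a k))
  rw [sq, Complex.mul_re, mul_assoc, neg_mul, Complex.neg_re, Complex.re_ofReal_mul,
    Complex.mul_re, freq_re, freq_im] at h
  linarith

section symbol

variable {a ε : ℝ} (ha : 0 < a) (ha' : a ≤ 1 / 2) (hε : ε ^ 2 ≤ 1 / 2) (k : ℝ)
include ha ha' hε

/-- A principal root has nonnegative real part. If it vanished, `S²` would be real and nonpositive;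
a real `S²` forces `k = 0`, where `S² = γ a Im tanh(ia) > 0`. -/
theorem sSymbol_freq_re_pos : 0 < (sSymbol ε (freq a k)).re := by
  have hγ := (gam_mem hε).1
  obtain ⟨h1, h2, h3⟩ := tanh_freq_signs ha ha' k
  refine lt_of_le_of_ne (cpow_half_re_nonneg _) fun h0 => ?_
  have e1 := sSymbol_freq_sq_im ε a k
  have e2 := sSymbol_freq_sq_re ε a k
  rw [← h0] at e1 e2
  have e3 : k * (k * (Complex.tanh (freq a k)).im + a * (Complex.tanh (freq a k)).re) = 0 := by
    have : gam ε * (k * (Complex.tanh (freq a k)).im + a * (Complex.tanh (freq a k)).re) = 0 := by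
      linarith
    rcases mul_eq_zero.1 this with h | h
    · linarith
    · rw [h, mul_zero]
  have hk : k = 0 := by
    by_contra hk
    have := mul_pos (pow_pos (abs_pos.2 hk) 2) h1
    rw [sq_abs] at this
    nlinarith
  subst hk
  have : 0 < gam ε * (a * (Complex.tanh (freq a 0)).im) := by positivity
  nlinarith [sq_nonneg (sSymbol ε (freq a 0)).im]

theorem sSymbol_freq_im_mul_neg (hk : k ≠ 0) : k * (sSymbol ε (freq a k)).im < 0 := by
  have hγ := (gam_mem hε).1
  obtain ⟨h1, h2, h3⟩ := tanh_freq_signs ha ha' k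
  have hr := sSymbol_freq_re_pos ha ha' hε k
  have e1 := sSymbol_freq_sq_im ε a k
  have h4 : 0 < k ^ 2 * (Complex.tanh (freq a k)).im := by positivity
  have h5 : (sSymbol ε (freq a k)).re * (k * (sSymbol ε (freq a k)).im) < 0 := by
    have h6 : 0 < gam ε * (k ^ 2 * (Complex.tanh (freq a k)).im +
      a * (k * (Complex.tanh (freq a k)).re)) := by positivity
    have e2 : 2 * ((sSymbol ε (freq a k)).re * (k * (sSymbol ε (freq a k)).im)) =
        -(gam ε * (k ^ 2 * (Complex.tanh (freq a k)).im +
      a * (k * (Complex.tanh (freq a k)).re))) := by linear_combination k * e1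
    linarith
  by_contra hcon
  push Not at hcon
  exact absurd h5 (not_lt.2 (mul_nonneg hr.le hcon))

theorem sSymbol_freq_zero_im : (sSymbol ε (freq a 0)).im = 0 := by
  have hr := sSymbol_freq_re_pos ha ha' hε 0
  have e1 := sSymbol_freq_sq_im ε a 0
  have e2 : (Complex.tanh (freq a 0)).re = 0 := by
    rw [(tanh_freq a 0).1]; simp
  rw [e2] at e1
  have : (sSymbol ε (freq a 0)).re * (sSymbol ε (freq a 0)).im = 0 := by linarith
  exact (mul_eq_zero.1 this).resolve_left hr.ne'

theorem norm_sSymbol_freq_sq :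
    ‖sSymbol ε (freq a k)‖ ^ 2 = gam ε * (‖freq a k‖ * ‖Complex.tanh (freq a k)‖) := by
  have hγ := (gam_mem hε).1
  rw [← norm_pow, sSymbol_sq, norm_mul, norm_mul, norm_neg, Complex.norm_real,
    Real.norm_of_nonneg (by linarith)]
  ring

theorem norm_sSymbol_freq_sq_le_norm : ‖sSymbol ε (freq a k)‖ ^ 2 ≤ ‖freq a k‖ := by
  obtain ⟨h1, h2⟩ := gam_mem hε
  rw [norm_sSymbol_freq_sq ha ha' hε]
  have h3 := norm_tanh_freq_le_one ha ha' k
  calc _ ≤ 1 * (‖freq a k‖ * 1) := by gcongr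
    _ = _ := by ring

/-- With `S = -iξ r`, `r = √(γ tanh ξ / ξ)`, the real part of `S` is at most `a |r|`. -/
theorem sSymbol_freq_re_mul_norm_le :
    (sSymbol ε (freq a k)).re * ‖freq a k‖ ≤ a * ‖sSymbol ε (freq a k)‖ := by
  set ξ := freq a k with hξ
  set t := Complex.tanh ξ with ht
  set S := sSymbol ε ξ with hS
  have hξ0 : ξ ≠ 0 := norm_pos_iff.1 (norm_freq_pos ha k)
  obtain ⟨h1, h2, h3⟩ := tanh_freq_signs ha ha' k
  have hr := sSymbol_freq_re_pos ha ha' hε k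
  have hγ := (gam_mem hε).1
  -- `w = i S / ξ` satisfies `w ^ 2 = γ t / ξ`
  set w := Complex.I * S / ξ with hw
  have hw2 : w ^ 2 = gam ε * (t / ξ) := by
    rw [hw, div_pow, mul_pow, Complex.I_sq, sSymbol_sq, ← ht]
    field_simp
  have hSw : S = -Complex.I * ξ * w := by
    rw [hw, mul_div_assoc', mul_assoc, mul_comm ξ, ← mul_assoc, ← mul_assoc,
      mul_div_cancel_right₀ _ hξ0, neg_mul, Complex.I_mul_I]
    ring
  have hSre : S.re = k * w.im + a * w.re := by
    have := congrArg Complex.re hSw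
    rw [this]
    simp [hξ]
  have hSim : S.im = -(k * w.re - a * w.im) := by
    have := congrArg Complex.im hSw
    rw [this]
    simp [hξ]
    ring
  have hn : 0 < Complex.normSq ξ := Complex.normSq_pos.2 hξ0
  have hti : k * (t / ξ).im ≤ 0 := by
    rw [Complex.div_im, hξ, freq_re, freq_im, ← hξ, ← sub_div, mul_div_assoc']
    exact div_nonpos_of_nonpos_of_nonneg (by nlinarith) hn.le
  have htr : 0 < (t / ξ).re := by
    rw [Complex.div_re, hξ, freq_re, freq_im, ← hξ, ← add_div]
    exact div_pos (by nlinarith) hn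
  have hwi : 2 * (w.re * (k * w.im)) = gam ε * (k * (t / ξ).im) := by
    have := congrArg Complex.im hw2
    rw [sq, Complex.mul_im, Complex.im_ofReal_mul] at this
    linear_combination k * this
  have hwr : w.re ^ 2 - w.im ^ 2 = gam ε * (t / ξ).re := by
    have := congrArg Complex.re hw2
    rw [sq, Complex.mul_re, Complex.re_ofReal_mul] at this
    linear_combination this
  -- This fixes the branch of the root: `Re w < 0` would contradict `Re S > 0` at `k = 0` and `k Im
  -- S < 0` elsewhere. Then `k Im w ≤ 0`, so `Re S = k Im w + a Re w` is at most `a |w|`.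
  have hwr0 : 0 < w.re := by
    have hsq : 0 < w.re ^ 2 := by nlinarith [mul_pos (by linarith : 0 < gam ε) htr, sq_nonneg w.im]
    rcases lt_or_gt_of_ne (pow_ne_zero_iff two_ne_zero |>.1 hsq.ne') with hneg | hpos
    · exfalso
      have h5 : 0 ≤ k * w.im := by
        by_contra hc
        push Not at hc
        nlinarith [mul_pos_of_neg_of_neg hneg hc,
          mul_nonpos_of_nonneg_of_nonpos (by linarith : 0 ≤ gam ε) hti]
      by_cases hk : k = 0
      · rw [hk] at hSre
        nlinarith
      · have h6 := sSymbol_freq_im_mul_neg ha ha' hε k hk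
        rw [← hξ, ← hS, hSim] at h6
        have h7 : 0 < k ^ 2 := by positivity
        nlinarith
    · exact hpos
  have hkw : k * w.im ≤ 0 := by
    by_contra hc
    push Not at hc
    nlinarith [mul_pos hwr0 hc, mul_nonpos_of_nonneg_of_nonpos (by linarith : 0 ≤ gam ε) hti]
  have hn2 : ‖S‖ = ‖ξ‖ * ‖w‖ := by
    rw [hSw, norm_mul, norm_mul, norm_neg, Complex.norm_I, one_mul]
  have hwn : w.re ≤ ‖w‖ := Complex.re_le_norm w
  rw [hn2, hSre]
  have : k * w.im + a * w.re ≤ a * ‖w‖ := by nlinarith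
  calc _ ≤ a * ‖w‖ * ‖ξ‖ := mul_le_mul_of_nonneg_right this (norm_nonneg _)
    _ = _ := by ring

/-- Fourth power bound for `|S| / |ξ|`. -/
theorem norm_sSymbol_freq_pow_four_le :
    ‖sSymbol ε (freq a k)‖ ^ 4 * ((1 + k ^ 2 / 2) * (1 - a ^ 2)) ≤ ‖freq a k‖ ^ 4 := by
  obtain ⟨h1, h2⟩ := gam_mem hε
  have h3 := norm_tanh_freq_sq_mul_le ha ha' k
  have e : ‖sSymbol ε (freq a k)‖ ^ 4 =
      gam ε ^ 2 * ‖freq a k‖ ^ 2 * ‖Complex.tanh (freq a k)‖ ^ 2 := by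
    rw [show ‖sSymbol ε (freq a k)‖ ^ 4 = (‖sSymbol ε (freq a k)‖ ^ 2) ^ 2 by ring,
      norm_sSymbol_freq_sq ha ha' hε]
    ring
  have hg : gam ε ^ 2 ≤ 1 := pow_le_one₀ (by linarith) h2
  have h9 : 0 ≤ 1 - a ^ 2 := by nlinarith
  calc _ = gam ε ^ 2 * (‖freq a k‖ ^ 2 *
        (‖Complex.tanh (freq a k)‖ ^ 2 * ((1 + k ^ 2 / 2) * (1 - a ^ 2)))) := by rw [e]; ring
    _ ≤ 1 * (‖freq a k‖ ^ 2 * ‖freq a k‖ ^ 2) := by gcongr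
    _ = _ := by ring

/-- The factor `b` is left free for two regimes: `b = 1 + a²` at all frequencies and `b = 1 - δ²/16`
on `|k| ≥ δ`. -/
theorem norm_sSymbol_freq_le {b : ℝ} (hb : 0 ≤ b)
    (h : 1 ≤ b ^ 4 * ((1 + k ^ 2 / 2) * (1 - a ^ 2))) :
    ‖sSymbol ε (freq a k)‖ ≤ b * ‖freq a k‖ := by
  have h9 : 0 < 1 - a ^ 2 := by nlinarith
  have h1 := norm_sSymbol_freq_pow_four_le ha ha' hε k
  refine le_of_pow_le_pow_left₀ (n := 4) (by norm_num) (by positivity) ?_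
  refine le_of_mul_le_mul_right (a := (1 + k ^ 2 / 2) * (1 - a ^ 2)) ?_ (by positivity)
  calc _ ≤ 1 * ‖freq a k‖ ^ 4 := by rw [one_mul]; exact h1
    _ ≤ (b ^ 4 * ((1 + k ^ 2 / 2) * (1 - a ^ 2))) * ‖freq a k‖ ^ 4 := by gcongr
    _ = _ := by ring

theorem sSymbol_freq_re_le {b : ℝ} (hb : 0 ≤ b)
    (h : 1 ≤ b ^ 4 * ((1 + k ^ 2 / 2) * (1 - a ^ 2))) :
    (sSymbol ε (freq a k)).re ≤ a * b := by
  have h1 := sSymbol_freq_re_mul_norm_le ha ha' hε k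
  have h2 := norm_sSymbol_freq_le ha ha' hε k hb h
  refine le_of_mul_le_mul_right (h1.trans ?_) (norm_freq_pos ha k)
  calc _ ≤ a * (b * ‖freq a k‖) := by gcongr
    _ = _ := by ring

omit hε in
theorem one_le_of_cube : 1 ≤ (1 + a ^ 2) ^ 4 * ((1 + k ^ 2 / 2) * (1 - a ^ 2)) := by
  have h0 : a ^ 2 ≤ 1 / 4 := by nlinarith
  have h1 : 1 ≤ (1 + a ^ 2) ^ 4 * (1 - a ^ 2) := by
    set x := a ^ 2 with hx
    have hx0 : 0 ≤ x := sq_nonneg a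
    nlinarith [pow_nonneg hx0 2, pow_nonneg hx0 3, pow_nonneg hx0 4,
      mul_nonneg (pow_nonneg hx0 4) (sub_nonneg.2 h0)]
  calc 1 ≤ (1 + a ^ 2) ^ 4 * (1 - a ^ 2) := h1
    _ ≤ (1 + a ^ 2) ^ 4 * (1 - a ^ 2) * (1 + k ^ 2 / 2) :=
      le_mul_of_one_le_right (by linarith) (by linarith [sq_nonneg k])
    _ = _ := by ring

/-- Since `∂` contributes `-a`, the growth rate of `∂ + S` is at most `a³` at any frequency, which
is below the gap. -/
theorem sSymbol_freq_re_le_low : (sSymbol ε (freq a k)).re ≤ a + a ^ 3 :=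
  (sSymbol_freq_re_le ha ha' hε k (by positivity) (one_le_of_cube ha ha' k)).trans
    (le_of_eq (by ring))

theorem norm_sSymbol_freq_le_two : ‖sSymbol ε (freq a k)‖ ≤ 2 * ‖freq a k‖ := by
  refine (norm_sSymbol_freq_le ha ha' hε k (by positivity) (one_le_of_cube ha ha' k)).trans ?_
  exact mul_le_mul_of_nonneg_right (by nlinarith) (norm_nonneg _)

/-- The spectral gap. With `s = δ²/16` one has `1 + k²/2 ≥ 1 + 8s` and `1 - a² ≥ 1 - s`, and `(1 -
s)⁴ (1 + 8s) (1 - s) ≥ 1` for `s ≤ 1/16`. -/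
theorem sSymbol_freq_re_le_high {δ : ℝ} (hδ : 0 < δ) (hδ1 : δ ≤ 1) (haδ : a ^ 2 ≤ δ ^ 2 / 16)
    (hk : δ ≤ |k|) : (sSymbol ε (freq a k)).re ≤ a - a * δ ^ 2 / 16 := by
  have hk2 : δ ^ 2 ≤ k ^ 2 := by rw [← sq_abs k]; exact pow_le_pow_left₀ hδ.le hk 2
  set s := δ ^ 2 / 16 with hs
  have hs0 : 0 < s := by positivity
  have hs1 : s ≤ 1 / 16 := by rw [hs]; nlinarith
  refine (sSymbol_freq_re_le ha ha' hε k (b := 1 - s) (by linarith) ?_).trans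
    (le_of_eq (by rw [hs]; ring))
  have h1 : 1 - 4 * s ≤ (1 - s) ^ 4 := by nlinarith [sq_nonneg s, sq_nonneg (s * (2 - s))]
  have h2 : 1 + 8 * s ≤ 1 + k ^ 2 / 2 := by rw [hs]; linarith
  have h3 : 1 - s ≤ 1 - a ^ 2 := by linarith
  calc (1 : ℝ) ≤ (1 - 4 * s) * ((1 + 8 * s) * (1 - s)) := by
        nlinarith [mul_nonneg hs0.le (sub_nonneg.2 hs1), pow_pos hs0 3]
    _ ≤ _ := mul_le_mul h1 (mul_le_mul h2 h3 (by linarith) (by positivity))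
        (mul_nonneg (by linarith) (by linarith)) (by positivity)

/-- `|ξ| / |S|` grows at most like `√|k|`. -/
theorem norm_freq_sq_le :
    ‖freq a k‖ ^ 2 ≤ 4 * (1 + |k|) * ‖sSymbol ε (freq a k)‖ ^ 2 := by
  obtain ⟨h1, h2⟩ := gam_mem hε
  rw [norm_sSymbol_freq_sq ha ha' hε]
  have h3 := norm_freq_le_mul_norm_tanh ha ha' k
  have h4 := norm_nonneg (freq a k)
  calc ‖freq a k‖ ^ 2 = ‖freq a k‖ * ‖freq a k‖ := sq _
    _ ≤ ‖freq a k‖ * (2 * (1 + |k|) * ‖Complex.tanh (freq a k)‖) := by gcongr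
    _ = 4 * (1 + |k|) * (1 / 2 * (‖freq a k‖ * ‖Complex.tanh (freq a k)‖)) := by ring
    _ ≤ _ := by gcongr

theorem norm_sSymbol_freq_pos : 0 < ‖sSymbol ε (freq a k)‖ :=
  (sSymbol_freq_re_pos ha ha' hε k).trans_le (Complex.re_le_norm _)

/-- For frequencies of the same sign the two values of `S` lie in a common quadrant, so their sum
has no cancellation. This permits division of `S² - S'²` by `S + S'`. -/
theorem norm_add_le_norm_add {k' : ℝ} (hkk : 0 ≤ k * k') :
    ‖sSymbol ε (freq a k)‖ ≤ ‖sSymbol ε (freq a k) + sSymbol ε (freq a k')‖ := by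
  have hr := sSymbol_freq_re_pos ha ha' hε k
  have hr' := sSymbol_freq_re_pos ha ha' hε k'
  have hi : 0 ≤ (sSymbol ε (freq a k)).im * (sSymbol ε (freq a k')).im := by
    by_cases hk : k = 0
    · rw [hk, sSymbol_freq_zero_im ha ha' hε, zero_mul]
    by_cases hk' : k' = 0
    · rw [hk', sSymbol_freq_zero_im ha ha' hε, mul_zero]
    have h1 := sSymbol_freq_im_mul_neg ha ha' hε k hk
    have h2 := sSymbol_freq_im_mul_neg ha ha' hε k' hk'
    have h3 := mul_pos_of_neg_of_neg h1 h2
    have h4 : 0 < k * k' := lt_of_le_of_ne hkk (mul_ne_zero hk hk').symm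
    by_contra hc
    push Not at hc
    nlinarith [mul_neg_of_pos_of_neg h4 hc]
  refine le_of_sq_le_sq ?_ (norm_nonneg _)
  rw [Complex.sq_norm, Complex.sq_norm, Complex.normSq_apply, Complex.normSq_apply,
    Complex.add_re, Complex.add_im]
  nlinarith [mul_pos hr hr', sq_nonneg (sSymbol ε (freq a k')).re,
    sq_nonneg (sSymbol ε (freq a k')).im]

-- The difference equals `sinh(k - k') / (cosh ξ cosh ξ')`, and `cosh(k - k') cosh k' ≤ cosh k` when
-- `k'` lies between `0` and `k`.
omit hε in
theorem norm_tanh_freq_sub_le {k' : ℝ} (hkk : 0 ≤ k * k') (hle : |k'| ≤ |k|) :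
    ‖Complex.tanh (freq a k) - Complex.tanh (freq a k')‖ * Real.cosh k' ^ 2 ≤
      4 / 3 * |k - k'| := by
  set d := k - k' with hd
  have hc := cosh_freq_ne_zero ha ha' k
  have hc' := cosh_freq_ne_zero ha ha' k'
  have e1 : Complex.tanh (freq a k) - Complex.tanh (freq a k') =
      (Real.sinh d : ℂ) / (Complex.cosh (freq a k) * Complex.cosh (freq a k')) := by
    rw [Complex.tanh_eq_sinh_div_cosh, Complex.tanh_eq_sinh_div_cosh, div_sub_div _ _ hc hc']
    congr 1
    rw [Complex.ofReal_sinh, show ((d : ℝ) : ℂ) = freq a k - freq a k' by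
      rw [hd, freq, freq]; push_cast; ring, Complex.sinh_sub]
  have hlow : ∀ x : ℝ, 3 / 4 * Real.cosh x ^ 2 ≤ ‖Complex.cosh (freq a x)‖ ^ 2 := fun x => by
    rw [norm_cosh_freq_sq]; exact cosh_sq_sub_pos ha ha' x
  have hprod : 3 / 4 * (Real.cosh k * Real.cosh k') ≤
      ‖Complex.cosh (freq a k)‖ * ‖Complex.cosh (freq a k')‖ := by
    refine le_of_sq_le_sq ?_ (by positivity)
    calc _ = (3 / 4 * Real.cosh k ^ 2) * (3 / 4 * Real.cosh k' ^ 2) := by ring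
      _ ≤ ‖Complex.cosh (freq a k)‖ ^ 2 * ‖Complex.cosh (freq a k')‖ ^ 2 :=
        mul_le_mul (hlow k) (hlow k') (by positivity) (by positivity)
      _ = _ := by ring
  have hcd : Real.cosh d * Real.cosh k' ≤ Real.cosh k := by
    have hk'd : 0 ≤ k' * d := by
      have h1 : k' ^ 2 ≤ k * k' := by
        rw [← abs_of_nonneg hkk, abs_mul, ← sq_abs k', sq]
        exact mul_le_mul_of_nonneg_right hle (abs_nonneg _)
      rw [hd]; nlinarith
    have h2 : 0 ≤ Real.sinh k' * Real.sinh d := by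
      rcases le_total 0 k' with h | h
      · rcases h.eq_or_lt with h0 | h0
        · rw [← h0]; simp
        · exact mul_nonneg (Real.sinh_nonneg_iff.2 h)
            (Real.sinh_nonneg_iff.2 (nonneg_of_mul_nonneg_right hk'd h0))
      · rcases h.eq_or_lt with h0 | h0
        · rw [h0]; simp
        · exact mul_nonneg_of_nonpos_of_nonpos (Real.sinh_nonpos_iff.2 h)
            (Real.sinh_nonpos_iff.2 (by nlinarith))
    have h3 : Real.cosh k = Real.cosh k' * Real.cosh d + Real.sinh k' * Real.sinh d := by
      rw [← Real.cosh_add, hd, add_sub_cancel]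
    linarith
  have hpos := Real.cosh_pos k
  have hpos' := Real.cosh_pos k'
  have hdenpos : 0 < ‖Complex.cosh (freq a k)‖ * ‖Complex.cosh (freq a k')‖ :=
    lt_of_lt_of_le (by positivity) hprod
  rw [e1, norm_div, norm_mul, Complex.norm_real, Real.norm_eq_abs, div_mul_eq_mul_div,
    div_le_iff₀ hdenpos]
  calc |Real.sinh d| * Real.cosh k' ^ 2 ≤ (|d| * Real.cosh d) * Real.cosh k' ^ 2 := by
        gcongr; exact abs_sinh_le_mul_cosh d
    _ = |d| * Real.cosh k' * (Real.cosh d * Real.cosh k') := by ring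
    _ ≤ |d| * Real.cosh k' * Real.cosh k := by gcongr
    _ = 4 / 3 * |d| * (3 / 4 * (Real.cosh k * Real.cosh k')) := by ring
    _ ≤ _ := by gcongr

omit ha ha' hε in
theorem norm_freq_le_two_mul_cosh_sq (ha0 : 0 ≤ a) (ha1 : a ≤ 1 / 2) :
    ‖freq a k‖ ≤ 3 / 2 * Real.cosh k ^ 2 := by
  have h1 := norm_freq_le ha0 k
  have h2 := one_add_half_sq_le_cosh k
  have h3 := Real.one_le_cosh k
  have h4 : |k| ≤ Real.cosh k := by
    rw [← sq_abs] at h2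
    nlinarith [sq_nonneg (|k| - 1)]
  nlinarith

/-- At high frequency `S` resembles a square root, so its difference quotient decays like `(1 +
|k|)^(-1/2)`. Divide `S² - S'² = -γ ((ξ - ξ') t + ξ' (t - t'))` by `S + S'` and use `|ξ| ≤ 2 √(1 +
|k|) |S|`. -/
theorem norm_sSymbol_sub_mul_sqrt_le_of_same_sign {k' : ℝ} (hkk : 0 ≤ k * k') (hle : |k'| ≤ |k|) :
    ‖sSymbol ε (freq a k) - sSymbol ε (freq a k')‖ * √(1 + |k|) ≤ 13 * |k - k'| := by
  set ξ := freq a k with hξ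
  set ξ' := freq a k' with hξ'
  set S := sSymbol ε ξ with hS
  set S' := sSymbol ε ξ' with hS'
  set t := Complex.tanh ξ with ht
  set t' := Complex.tanh ξ' with ht'
  obtain ⟨hγ1, hγ2⟩ := gam_mem hε
  have hξp := norm_freq_pos ha k
  have hSp := norm_sSymbol_freq_pos ha ha' hε k
  rw [← hξ] at hξp
  rw [← hξ, ← hS] at hSp
  have hsum : ‖S‖ ≤ ‖S + S'‖ := norm_add_le_norm_add ha ha' hε k hkk
  have hdiff : (S - S') * (S + S') = -(gam ε : ℂ) * ((ξ - ξ') * t + ξ' * (t - t')) := by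
    have h1 := sSymbol_sq ε ξ
    have h2 := sSymbol_sq ε ξ'
    rw [← hS, ← ht] at h1
    rw [← hS', ← ht'] at h2
    linear_combination h1 - h2
  have hd : ‖ξ - ξ'‖ = |k - k'| := by
    rw [hξ, hξ', freq, freq, add_sub_add_right_eq_sub, ← Complex.ofReal_sub, Complex.norm_real,
      Real.norm_eq_abs]
  have hcosh := one_le_pow₀ (Real.one_le_cosh k') (n := 2)
  have htt : ‖t - t'‖ ≤ 4 / 3 * |k - k'| / Real.cosh k' ^ 2 := by
    rw [le_div_iff₀ (by positivity)]
    exact norm_tanh_freq_sub_le ha ha' k hkk hle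
  have hbig : ‖S - S'‖ * ‖S‖ ≤ |k - k'| * (‖t‖ + 4 / 3 * (‖ξ'‖ / Real.cosh k' ^ 2)) := by
    calc _ ≤ ‖S - S'‖ * ‖S + S'‖ := by gcongr
      _ = gam ε * ‖(ξ - ξ') * t + ξ' * (t - t')‖ := by
          rw [← norm_mul, hdiff, norm_mul, norm_neg, Complex.norm_real,
            Real.norm_of_nonneg (by linarith)]
      _ ≤ 1 * (|k - k'| * ‖t‖ + ‖ξ'‖ * (4 / 3 * |k - k'| / Real.cosh k' ^ 2)) := by
          gcongr
          refine (norm_add_le _ _).trans ?_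
          rw [norm_mul, norm_mul, hd]
          gcongr
      _ = _ := by ring
  -- it remains to compare with `‖S‖ / √(1 + |k|)`
  have hξξ : ‖ξ'‖ ≤ ‖ξ‖ := by
    refine le_of_sq_le_sq ?_ (norm_nonneg _)
    rw [hξ, hξ', norm_freq_sq, norm_freq_sq, ← sq_abs k, ← sq_abs k']
    gcongr
  have ht1 : ‖t‖ * (1 + |k|) ≤ 3 * ‖ξ‖ := by
    have h1 : ‖t‖ ≤ 1 := norm_tanh_freq_le_one ha ha' k
    have h2 : ‖t‖ ≤ 2 * ‖ξ‖ := by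
      have h3 := norm_tanh_freq_sq_mul_le ha ha' k
      rw [← hξ, ← ht] at h3
      refine le_of_sq_le_sq ?_ (by positivity)
      have h4 : 1 / 4 ≤ (1 + k ^ 2 / 2) * (1 - a ^ 2) := by
        have : a ^ 2 ≤ 1 / 4 := by nlinarith
        nlinarith [sq_nonneg k, mul_nonneg (sq_nonneg k) (sub_nonneg.2 this)]
      nlinarith [mul_le_mul_of_nonneg_left h4 (sq_nonneg ‖t‖)]
    have h3 : |k| ≤ ‖ξ‖ := abs_le_norm_freq a k
    nlinarith [norm_nonneg t, abs_nonneg k]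
  have hc1 : ‖ξ'‖ / Real.cosh k' ^ 2 * (1 + |k|) ≤ 5 / 2 * ‖ξ‖ := by
    have h1 : ‖ξ'‖ / Real.cosh k' ^ 2 ≤ 3 / 2 := by
      rw [div_le_iff₀ (by positivity)]
      exact norm_freq_le_two_mul_cosh_sq k' ha.le ha'
    have h2 : ‖ξ'‖ / Real.cosh k' ^ 2 ≤ ‖ξ‖ := (div_le_self (norm_nonneg _) hcosh).trans hξξ
    have h3 : |k| ≤ ‖ξ‖ := abs_le_norm_freq a k
    have h4 : 0 ≤ ‖ξ'‖ / Real.cosh k' ^ 2 := by positivity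
    nlinarith [abs_nonneg k]
  have hs : ‖ξ‖ ≤ 2 * √(1 + |k|) * ‖S‖ := by
    refine le_of_sq_le_sq ?_ (by positivity)
    rw [mul_pow, mul_pow, Real.sq_sqrt (by positivity)]
    have := norm_freq_sq_le ha ha' hε k
    rw [← hξ, ← hS] at this
    linarith
  have h1k : 0 < 1 + |k| := by positivity
  have hsq : √(1 + |k|) * √(1 + |k|) = 1 + |k| := Real.mul_self_sqrt h1k.le
  refine le_of_mul_le_mul_right (a := ‖S‖ * √(1 + |k|)) ?_ (by positivity)
  calc _ = ‖S - S'‖ * ‖S‖ * (√(1 + |k|) * √(1 + |k|)) := by ring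
    _ = ‖S - S'‖ * ‖S‖ * (1 + |k|) := by rw [hsq]
    _ ≤ |k - k'| * (‖t‖ + 4 / 3 * (‖ξ'‖ / Real.cosh k' ^ 2)) * (1 + |k|) := by gcongr
    _ = |k - k'| * (‖t‖ * (1 + |k|) + 4 / 3 * (‖ξ'‖ / Real.cosh k' ^ 2 * (1 + |k|))) := by ring
    _ ≤ |k - k'| * (3 * ‖ξ‖ + 4 / 3 * (5 / 2 * ‖ξ‖)) := by gcongr
    _ = 19 / 3 * |k - k'| * ‖ξ‖ := by ring
    _ ≤ 19 / 3 * |k - k'| * (2 * √(1 + |k|) * ‖S‖) := by gcongr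
    _ ≤ _ := by
        have : 0 ≤ |k - k'| * (√(1 + |k|) * ‖S‖) := by positivity
        linarith

/-- Frequencies of opposite sign are compared through `0`, where `|k - k'| = |k| + |k'|`; this
doubles the constant. -/
theorem norm_sSymbol_sub_mul_sqrt_le (k' : ℝ) :
    ‖sSymbol ε (freq a k) - sSymbol ε (freq a k')‖ * √(1 + |k|) ≤ 26 * |k - k'| := by
  rcases le_total 0 (k * k') with hkk | hkk
  · rcases le_total |k'| |k| with hle | hle
    · have := norm_sSymbol_sub_mul_sqrt_le_of_same_sign ha ha' hε k hkk hle
      linarith [abs_nonneg (k - k')]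
    · have := norm_sSymbol_sub_mul_sqrt_le_of_same_sign ha ha' hε k' (by rwa [mul_comm]) hle
      rw [norm_sub_rev, abs_sub_comm] at this
      calc _ ≤ ‖sSymbol ε (freq a k) - sSymbol ε (freq a k')‖ * √(1 + |k'|) := by gcongr
        _ ≤ _ := by linarith [abs_nonneg (k - k')]
  · have h1 := norm_sSymbol_sub_mul_sqrt_le_of_same_sign ha ha' hε k (k' := 0) (by simp) (by simp)
    have h2 := norm_sSymbol_sub_mul_sqrt_le_of_same_sign ha ha' hε k' (k' := 0) (by simp) (by simp)
    rw [sub_zero] at h1 h2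
    have hd : |k - k'| = |k| + |k'| := by
      rw [← abs_neg k', sub_eq_add_neg]
      rcases le_total 0 k with h | h
      · rcases h.eq_or_lt with h0 | h0
        · rw [← h0]; simp
        · have : k' ≤ 0 := by nlinarith
          rw [abs_of_nonneg h, abs_of_nonneg (by linarith : 0 ≤ -k'), abs_of_nonneg (by linarith)]
      · rcases h.eq_or_lt with h0 | h0
        · rw [h0]; simp
        · have : 0 ≤ k' := by nlinarith
          rw [abs_of_nonpos h, abs_of_nonpos (by linarith : -k' ≤ 0), abs_of_nonpos (by linarith)]
          ring
    set S₀ := sSymbol ε (freq a 0)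
    set y := |k|
    set x := |k'|
    have hy : 0 ≤ y := abs_nonneg k
    have hx : 0 ≤ x := abs_nonneg k'
    have h3 : x * √(1 + y) ≤ (y + x) * √(1 + x) := by
      refine le_of_sq_le_sq ?_ (by positivity)
      rw [mul_pow, mul_pow, Real.sq_sqrt (by positivity), Real.sq_sqrt (by positivity)]
      nlinarith [mul_nonneg hx hy, mul_nonneg (mul_nonneg hx hx) hy, pow_nonneg hx 3,
        mul_nonneg (mul_nonneg hy hy) hx, sq_nonneg y]
    have h4 : ‖sSymbol ε (freq a k') - S₀‖ * √(1 + y) ≤ 13 * (y + x) := by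
      refine le_of_mul_le_mul_right (a := √(1 + x)) ?_ (Real.sqrt_pos.2 (by positivity))
      calc _ = ‖sSymbol ε (freq a k') - S₀‖ * √(1 + x) * √(1 + y) := by ring
        _ ≤ 13 * x * √(1 + y) := by gcongr
        _ = 13 * (x * √(1 + y)) := by ring
        _ ≤ 13 * ((y + x) * √(1 + x)) := by gcongr
        _ = _ := by ring
    have h5 : ‖sSymbol ε (freq a k) - sSymbol ε (freq a k')‖ ≤
        ‖sSymbol ε (freq a k) - S₀‖ + ‖sSymbol ε (freq a k') - S₀‖ := by
      rw [norm_sub_rev (sSymbol ε (freq a k')) S₀]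
      exact norm_sub_le_norm_sub_add_norm_sub _ _ _
    rw [hd]
    calc _ ≤ (‖sSymbol ε (freq a k) - S₀‖ + ‖sSymbol ε (freq a k') - S₀‖) * √(1 + y) := by gcongr
      _ ≤ 13 * y + 13 * (y + x) := by rw [add_mul]; linarith
      _ ≤ _ := by linarith

theorem norm_sSymbol_sub_le (k' : ℝ) :
    ‖sSymbol ε (freq a k) - sSymbol ε (freq a k')‖ ≤ 26 * |k - k'| := by
  refine le_trans ?_ (norm_sSymbol_sub_mul_sqrt_le ha ha' hε k k')
  exact le_mul_of_one_le_right (norm_nonneg _) (Real.one_le_sqrt.2 (by linarith [abs_nonneg k]))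

theorem norm_freq_div_sSymbol_le :
    ‖Complex.I * freq a k / sSymbol ε (freq a k)‖ ≤ 2 * √(1 + |k|) := by
  rw [norm_div, norm_mul, Complex.norm_I, one_mul,
    div_le_iff₀ (norm_sSymbol_freq_pos ha ha' hε k)]
  refine le_of_sq_le_sq ?_ (by positivity)
  rw [mul_pow, mul_pow, Real.sq_sqrt (by positivity)]
  have := norm_freq_sq_le ha ha' hε k
  linarith

/-- The decay of the Lipschitz constant of `S` compensates the growth of `S⁻¹ ∂`, so that `[p, S]
S⁻¹ ∂` is an operator of order zero. -/
theorem norm_sSymbol_sub_mul_le (k' : ℝ) :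
    ‖sSymbol ε (freq a k) - sSymbol ε (freq a k')‖ *
      ‖Complex.I * freq a k' / sSymbol ε (freq a k')‖ ≤ 52 * |k - k'| := by
  have h1 := norm_sSymbol_sub_mul_sqrt_le ha ha' hε k' k
  have h2 := norm_freq_div_sSymbol_le ha ha' hε k'
  rw [norm_sub_rev, abs_sub_comm] at h1
  calc _ ≤ ‖sSymbol ε (freq a k) - sSymbol ε (freq a k')‖ * (2 * √(1 + |k'|)) := by gcongr
    _ = 2 * (‖sSymbol ε (freq a k) - sSymbol ε (freq a k')‖ * √(1 + |k'|)) := by ring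
    _ ≤ _ := by linarith

/-- The real part is at least 3, and the imaginary part is at least `|k|/2 - 1` in modulus because
`S` has order one half. The former suffices for `|k| ≤ 8`, the latter beyond. -/
theorem le_norm_sub_symbol {s : ℝ} (hs : s = 1 ∨ s = -1) :
    (1 + |k|) / 4 ≤ ‖(4 : ℂ) - (Complex.I * freq a k + s * sSymbol ε (freq a k))‖ := by
  set S := sSymbol ε (freq a k) with hS
  have hre : ((4 : ℂ) - (Complex.I * freq a k + s * S)).re = 4 + a - s * S.re := by
    simp; ring
  have him : ((4 : ℂ) - (Complex.I * freq a k + s * S)).im = -k - s * S.im := by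
    simp; ring
  have h1 := Complex.abs_re_le_norm ((4 : ℂ) - (Complex.I * freq a k + s * S))
  have h2 := Complex.abs_im_le_norm ((4 : ℂ) - (Complex.I * freq a k + s * S))
  rw [hre] at h1
  rw [him] at h2
  have hr0 := sSymbol_freq_re_pos ha ha' hε k
  have hr1 := sSymbol_freq_re_le_low ha ha' hε k
  rw [← hS] at hr0 hr1
  have ha3 : a ^ 3 ≤ 1 := pow_le_one₀ ha.le (by linarith)
  have h3 : 3 ≤ |4 + a - s * S.re| := by
    refine le_trans ?_ (le_abs_self _)
    rcases hs with rfl | rfl <;> linarith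
  have hsim : |s * S.im| ≤ |k| / 2 + 1 := by
    have e : |s * S.im| = |S.im| := by
      rcases hs with rfl | rfl <;> simp
    rw [e]
    refine (Complex.abs_im_le_norm S).trans ?_
    have h4 := norm_sSymbol_freq_sq_le_norm ha ha' hε k
    have h5 := norm_freq_le ha.le k
    refine le_of_sq_le_sq ?_ (by positivity)
    nlinarith [sq_nonneg |k|]
  have h6 : |k| - |s * S.im| ≤ |-k - s * S.im| := by
    have := abs_sub_abs_le_abs_sub (-k) (s * S.im)
    rwa [abs_neg] at this
  rcases le_total |k| 8 with h8 | h8 <;> linarith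

end symbol

/-! ### Graphs of unbounded operators -/

section graph

variable {E F G : Type*} [AddCommGroup E] [Module ℂ E] [AddCommGroup F] [Module ℂ F]
    [AddCommGroup G] [Module ℂ G]

/-- `x` is in the domain of `T` and `T x = y`. -/
def Acts (T : E →ₗ.[ℂ] F) (x : E) (y : F) : Prop := ∃ h : x ∈ T.domain, T ⟨x, h⟩ = y

theorem Acts.mem {T : E →ₗ.[ℂ] F} {x : E} {y : F} (h : Acts T x y) : x ∈ T.domain := h.1

theorem Acts.apply_eq {T : E →ₗ.[ℂ] F} {x : E} {y : F} (h : Acts T x y) (hx : x ∈ T.domain) :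
    T ⟨x, hx⟩ = y := h.2

theorem Acts.add {A B : E →ₗ.[ℂ] F} {x : E} {y z : F} (hA : Acts A x y) (hB : Acts B x z) :
    Acts (A + B) x (y + z) := by
  obtain ⟨h₁, rfl⟩ := hA
  obtain ⟨h₂, rfl⟩ := hB
  exact ⟨⟨h₁, h₂⟩, LinearPMap.add_apply _ _ _⟩

theorem Acts.sub {A B : E →ₗ.[ℂ] F} {x : E} {y z : F} (hA : Acts A x y) (hB : Acts B x z) :
    Acts (A - B) x (y - z) := by
  obtain ⟨h₁, rfl⟩ := hA
  obtain ⟨h₂, rfl⟩ := hB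
  exact ⟨⟨h₁, h₂⟩, LinearPMap.sub_apply _ _ _⟩

theorem Acts.smul {A : E →ₗ.[ℂ] F} {x : E} {y : F} (c : ℂ) (hA : Acts A x y) :
    Acts (c • A) x (c • y) := by
  obtain ⟨h₁, rfl⟩ := hA
  exact ⟨h₁, LinearPMap.smul_apply _ _ _⟩

theorem Acts.pcomp {B : F →ₗ.[ℂ] G} {A : E →ₗ.[ℂ] F} {x : E} {y : F} {z : G} (hA : Acts A x y)
    (hB : Acts B y z) : Acts (B ⊚ A) x z := by
  obtain ⟨h₁, rfl⟩ := hA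
  obtain ⟨h₂, rfl⟩ := hB
  exact ⟨⟨⟨x, h₁⟩, h₂, rfl⟩, rfl⟩

theorem exists_acts_of_mem_pcomp {B : F →ₗ.[ℂ] G} {A : E →ₗ.[ℂ] F} {x : E}
    (h : x ∈ (B ⊚ A).domain) : ∃ y, Acts A x y ∧ y ∈ B.domain := by
  obtain ⟨y, hy, rfl⟩ := h
  exact ⟨A y, ⟨y.2, rfl⟩, hy⟩

theorem Acts.comm {A B : E →ₗ.[ℂ] E} {x y z u v : E} (hB : Acts B x y) (hAB : Acts A y z)
    (hA : Acts A x u) (hBA : Acts B u v) : Acts (comm A B) x (z - v) :=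
  (hB.pcomp hAB).sub (hA.pcomp hBA)

theorem acts_toPMap (L : E →ₗ[ℂ] F) (x : E) : Acts (L.toPMap ⊤) x (L x) :=
  ⟨Submodule.mem_top, rfl⟩

end graph

/-! ### Multiplication operators -/

/-- Multiplication by the bounded continuous function `g` on `L²_a`. -/
def mulB (a : ℝ) (g : BoundedContinuousFunction ℝ ℝ) : L2w a →L[ℂ] L2w a :=
  mulCLM (wMeasure a) (fun x => (g x : ℂ)) ‖g‖
    (Complex.continuous_ofReal.comp g.continuous).aestronglyMeasurable
    fun x => by rw [Complex.norm_real]; exact g.norm_coe_le_norm x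

theorem mulB_ae (a : ℝ) (g : BoundedContinuousFunction ℝ ℝ) (f : L2w a) :
    mulB a g f =ᵐ[wMeasure a] fun x => (g x : ℂ) * f x := mulCLM_ae _ _ _

theorem acts_mult {a : ℝ} {g : ℝ → ℝ} {f h : L2w a}
    (hh : h =ᵐ[wMeasure a] fun x => (g x : ℂ) * f x) : Acts (mult a g) f h := by
  have hm : MemLp (fun x => (g x : ℂ) * f x) 2 (wMeasure a) := (memLp_congr_ae hh).1 (Lp.memLp h)
  refine ⟨hm, Lp.ext ?_⟩
  exact hm.coeFn_toLp.trans hh.symm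

theorem acts_mulB (a : ℝ) (g : BoundedContinuousFunction ℝ ℝ) (f : L2w a) :
    Acts (mult a g) f (mulB a g f) := acts_mult (mulB_ae a g f)

theorem norm_mulB_le {a C : ℝ} {g : BoundedContinuousFunction ℝ ℝ}
    (hg : ∀ x, |g x| ≤ C) (f : L2w a) : ‖mulB a g f‖ ≤ C * ‖f‖ := by
  refine Lp.norm_le_mul_norm_of_ae_le_mul ?_
  filter_upwards [mulB_ae a g f] with x hx
  rw [hx, norm_mul, Complex.norm_real]
  exact mul_le_mul_of_nonneg_right (hg x) (norm_nonneg _)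

theorem mulB_congr_mul {a : ℝ} {g h gh : BoundedContinuousFunction ℝ ℝ}
    (e : ∀ x, gh x = g x * h x) (f : L2w a) : mulB a g (mulB a h f) = mulB a gh f := by
  refine Lp.ext ?_
  filter_upwards [mulB_ae a g (mulB a h f), mulB_ae a h f, mulB_ae a gh f] with x h₁ h₂ h₃
  rw [h₁, h₂, h₃, e]
  push_cast
  ring

theorem mulB_congr_sub_one {a : ℝ} {g h : BoundedContinuousFunction ℝ ℝ}
    (e : ∀ x, h x = g x - 1) (f : L2w a) : mulB a h f = mulB a g f - f := by
  refine Lp.ext ?_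
  filter_upwards [mulB_ae a g f, mulB_ae a h f, Lp.coeFn_sub (mulB a g f) f] with x h₁ h₂ h₃
  rw [h₂, h₃, Pi.sub_apply, h₁, e]
  push_cast
  ring

theorem inner_mulB (a : ℝ) (g : BoundedContinuousFunction ℝ ℝ) (f h : L2w a) :
    inner ℂ (mulB a g f) h = inner ℂ f (mulB a g h) := by
  rw [L2.inner_def, L2.inner_def]
  refine integral_congr_ae ?_
  filter_upwards [mulB_ae a g f, mulB_ae a g h] with x h₁ h₂
  rw [h₁, h₂]
  simp only [RCLike.inner_apply, map_mul, Complex.conj_ofReal]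
  ring

/-! ### Fourier multipliers -/

/-- The isometry `f ↦ f̂(· + ia)` of `L²_a` onto `L²`. -/
def fourierW (a : ℝ) : L2w a ≃ₗᵢ[ℂ] Lp ℂ 2 (volume : Measure ℝ) :=
  (weight a).trans (Lp.fourierTransformₗᵢ ℝ ℂ)

/-- The graph of the Fourier multiplier `m(D)` in `L²_a`. -/
def FM (a : ℝ) (m : ℂ → ℂ) (f g : L2w a) : Prop :=
  fourierW a g =ᵐ[volume] fun κ => m (freq a (2 * Real.pi * κ)) * fourierW a f κ

theorem FM.acts {a : ℝ} {m : ℂ → ℂ} {f g : L2w a} (h : FM a m f g) : Acts (fourierOp a m) f g := by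
  have h1 := acts_toPMap (fourierW a).toLinearEquiv.toLinearMap f
  have hm : MemLp (fun κ : ℝ => m ((2 * Real.pi * κ : ℝ) + Complex.I * a) * fourierW a f κ) 2
    volume := (memLp_congr_ae h).1 (Lp.memLp _)
  have h2 : Acts (mulOp volume fun κ : ℝ => m ((2 * Real.pi * κ : ℝ) + Complex.I * a))
      (fourierW a f) (fourierW a g) := ⟨hm, Lp.ext (hm.coeFn_toLp.trans h.symm)⟩
  have h3 := acts_toPMap (fourierW a).symm.toLinearEquiv.toLinearMap (fourierW a g)
  have h4 : (fourierW a).symm.toLinearEquiv.toLinearMap (fourierW a g) = g :=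
    (fourierW a).symm_apply_apply g
  rw [h4] at h3
  exact (h1.pcomp h2).pcomp h3

theorem exists_FM_of_mem {a : ℝ} {m : ℂ → ℂ} {f : L2w a} (h : f ∈ (fourierOp a m).domain) :
    ∃ g, FM a m f g := by
  obtain ⟨_, hy, -⟩ := exists_acts_of_mem_pcomp h
  obtain ⟨_, ⟨_, rfl⟩, hm⟩ := exists_acts_of_mem_pcomp hy.mem
  refine ⟨(fourierW a).symm (mulOp volume _ ⟨_, hm⟩), ?_⟩
  rw [FM, LinearIsometryEquiv.apply_symm_apply]
  exact MemLp.coeFn_toLp hm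

theorem exists_FM_of_memLp {a : ℝ} {m : ℂ → ℂ} {f : L2w a}
    (h : MemLp (fun κ => m (freq a (2 * Real.pi * κ)) * fourierW a f κ) 2 volume) :
    ∃ g, FM a m f g := by
  refine ⟨(fourierW a).symm h.toLp, ?_⟩
  rw [FM, LinearIsometryEquiv.apply_symm_apply]
  exact h.coeFn_toLp

theorem FM.memLp {a : ℝ} {m : ℂ → ℂ} {f g : L2w a} (h : FM a m f g) :
    MemLp (fun κ => m (freq a (2 * Real.pi * κ)) * fourierW a f κ) 2 volume :=
  (memLp_congr_ae h).1 (Lp.memLp _)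

theorem FM.sub {a : ℝ} {m : ℂ → ℂ} {f g f' g' : L2w a} (h : FM a m f g) (h' : FM a m f' g') :
    FM a m (f - f') (g - g') := by
  unfold FM
  rw [map_sub, map_sub]
  filter_upwards [h, h', Lp.coeFn_sub (fourierW a f) (fourierW a f'),
    Lp.coeFn_sub (fourierW a g) (fourierW a g')] with κ h1 h2 h3 h4
  rw [h4, h3, Pi.sub_apply, Pi.sub_apply, h1, h2, mul_sub]

theorem fourierW_mulB_ae {a : ℝ} {g : BoundedContinuousFunction ℝ ℝ} {G : ℝ → ℂ}
    (hG : Integrable G) (hg : ∀ x, (g x : ℂ) = 𝓕⁻ G x) (f : L2w a) :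
    fourierW a (mulB a g f) =ᵐ[volume] fun κ => ∫ η, G η * fourierW a f (κ - η) := by
  refine fourier_mul_ae hG ?_
  filter_upwards [weight_apply_ae a (mulB a g f), weight_apply_ae a f,
    ac_wMeasure a (mulB_ae a g f)] with x h1 h2 h3
  change weight a (mulB a g f) x = _ * weight a f x
  rw [h1, h2, h3, hg]
  ring

/-- Commutator estimate: `m(D) g h = g m(D) h + e` for `h = b(D) f`, with `e` controlled by `f`,
provided that `|m(k) - m(k')| |b(k')| ≤ K |k - k'|`. -/
theorem exists_FM_mulB {a s N K : ℝ} (hs : 0 < s) {g : BoundedContinuousFunction ℝ ℝ}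
    (hg : Wiener (fun η => 1 + |η| / s) (fun x => g x - 1) N) (hK : 0 ≤ K) {m b : ℂ → ℂ}
    (hm : Measurable fun κ : ℝ => m (freq a (2 * Real.pi * κ)))
    (hmb : ∀ k k' : ℝ, ‖m (freq a k) - m (freq a k')‖ * ‖b (freq a k')‖ ≤ K * |k - k'|)
    {f h mh : L2w a} (hfh : FM a b f h) (hh : FM a m h mh) :
    ∃ e, FM a m (mulB a g h) (mulB a g mh + e) ∧ ‖e‖ ≤ 7 * K * s * N * ‖f‖ := by
  obtain ⟨G, hG, hGN⟩ := hg
  have hφ := isWeight_one_add_abs hs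
  have hGi : Integrable G := hG.integrable hφ
  set g₀ : BoundedContinuousFunction ℝ ℝ := g - 1 with hg₀
  have hg₀e : ∀ x, g₀ x = g x - 1 := fun x => rfl
  have hg₀G : ∀ x, (g₀ x : ℂ) = 𝓕⁻ G x := fun x => hG.eq x
  -- Only `g - 1` has an integrable transform; the constant 1 commutes with `m(D)` and contributes
  -- nothing to the error.
  have e1 : mulB a g h = h + mulB a g₀ h := by rw [mulB_congr_sub_one hg₀e]; abel
  have e2 : mulB a g mh = mh + mulB a g₀ mh := by rw [mulB_congr_sub_one hg₀e]; abel
  -- the kernel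
  set H : ℝ → ℂ := fun η => (((2 * Real.pi * K : ℝ) * η : ℝ) : ℂ) * G η with hH
  have hHm : AEStronglyMeasurable H volume := by
    refine AEStronglyMeasurable.mul ?_ hG.meas
    exact Continuous.aestronglyMeasurable (by fun_prop)
  have hHle : ∀ η, ‖H η‖ ≤ 7 * K * s * ((1 + |η| / s) * ‖G η‖) := fun η => by
    rw [hH]
    simp only [norm_mul, Complex.norm_real, Real.norm_eq_abs, abs_two,
      abs_of_pos Real.pi_pos, abs_of_nonneg hK]
    have hpi : 2 * Real.pi ≤ 7 := by linarith [Real.pi_lt_d2]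
    have h1 : |η| ≤ s * (1 + |η| / s) := by
      rw [mul_add, mul_div_cancel₀ _ hs.ne']; linarith
    calc 2 * Real.pi * K * |η| * ‖G η‖ ≤ 7 * K * (s * (1 + |η| / s)) * ‖G η‖ := by gcongr
      _ = _ := by ring
  have hHi : Integrable H := (hG.weighted.const_mul (7 * K * s)).mono' hHm
    (Filter.Eventually.of_forall hHle)
  have hHN : ∫ η, ‖H η‖ ≤ 7 * K * s * N := by
    refine (integral_mono hHi.norm (hG.weighted.const_mul (7 * K * s)) hHle).trans ?_
    rw [integral_const_mul]
    exact mul_le_mul_of_nonneg_left hGN (by positivity)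
  -- the error
  set w : ℝ → ℂ := fun κ => m (freq a (2 * Real.pi * κ)) * fourierW a (mulB a g₀ h) κ -
    fourierW a (mulB a g₀ mh) κ with hw
  have hwm : AEStronglyMeasurable w volume :=
    (hm.aestronglyMeasurable.mul (Lp.memLp _).1).sub (Lp.memLp _).1
  -- On the Fourier side the error has kernel `(m(k) - m(k')) b(k') G(η)` with `k - k' = 2πη`, so it
  -- is dominated by the convolution of `|H|` with `|f̂|`. The factor `η` in `H` costs one power of
  -- the weight and yields the factor `s`.
  have hwb : ∀ᵐ κ, ‖w κ‖ₑ ≤ ∫⁻ η, ‖H η‖ₑ * ‖fourierW a f (κ - η)‖ₑ := by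
    have hq : ∀ κ : ℝ, Measure.QuasiMeasurePreserving (fun η : ℝ => κ - η) volume volume :=
      fun κ => quasiMeasurePreserving_sub_left volume κ
    filter_upwards [fourierW_mulB_ae hGi hg₀G h, fourierW_mulB_ae hGi hg₀G mh,
      ae_integrable_conv hGi (Lp.memLp (fourierW a h)),
      ae_integrable_conv hGi (Lp.memLp (fourierW a mh))] with κ h1 h2 h3 h4
    simp only [hw]
    rw [h1, h2, ← integral_const_mul, ← integral_sub (h3.const_mul _) h4]
    refine (enorm_integral_le_lintegral_enorm _).trans (lintegral_mono_ae ?_)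
    filter_upwards [(hq κ).ae hfh, (hq κ).ae hh] with η h5 h6
    rw [h6, h5, ← enorm_mul, ← ofReal_norm, ← ofReal_norm]
    refine ENNReal.ofReal_le_ofReal ?_
    set c := fourierW a f (κ - η)
    have h7 := hmb (2 * Real.pi * κ) (2 * Real.pi * (κ - η))
    have h8 : |2 * Real.pi * κ - 2 * Real.pi * (κ - η)| = 2 * Real.pi * |η| := by
      rw [show 2 * Real.pi * κ - 2 * Real.pi * (κ - η) = 2 * Real.pi * η by ring, abs_mul,
        abs_of_pos (by positivity)]
    rw [h8] at h7
    set m₁ := m (freq a (2 * Real.pi * κ))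
    set m₂ := m (freq a (2 * Real.pi * (κ - η)))
    set b₂ := b (freq a (2 * Real.pi * (κ - η)))
    calc ‖m₁ * (G η * (b₂ * c)) - G η * (m₂ * (b₂ * c))‖
        = (‖m₁ - m₂‖ * ‖b₂‖) * ‖G η‖ * ‖c‖ := by
          rw [← norm_mul, ← norm_mul, ← norm_mul]; congr 1; ring
      _ ≤ (K * (2 * Real.pi * |η|)) * ‖G η‖ * ‖c‖ := by gcongr
      _ = ‖H η * c‖ := by
          rw [hH]
          simp only [norm_mul, Complex.norm_real, Real.norm_eq_abs, abs_two,
            abs_of_pos Real.pi_pos, abs_of_nonneg hK]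
          ring
  have hwle := eLpNorm_le_of_le_conv hHi (Lp.memLp (fourierW a f)) hwb
  have hw2 : MemLp w 2 volume := ⟨hwm, hwle.trans_lt
    (ENNReal.mul_lt_top ENNReal.ofReal_lt_top (Lp.memLp (fourierW a f)).2)⟩
  refine ⟨(fourierW a).symm hw2.toLp, ?_, ?_⟩
  · rw [FM, map_add, LinearIsometryEquiv.apply_symm_apply, e1, e2, map_add, map_add]
    filter_upwards [hw2.coeFn_toLp, hh, Lp.coeFn_add (fourierW a h) (fourierW a (mulB a g₀ h)),
      Lp.coeFn_add (fourierW a mh) (fourierW a (mulB a g₀ mh)),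
      Lp.coeFn_add (fourierW a mh + fourierW a (mulB a g₀ mh)) hw2.toLp] with κ h1 h2 h3 h4 h5
    rw [h5, Pi.add_apply, h4, h3, Pi.add_apply, Pi.add_apply, h1, h2]
    simp only [hw]
    ring
  · rw [LinearIsometryEquiv.norm_map, Lp.norm_toLp]
    refine (ENNReal.toReal_mono (ENNReal.mul_lt_top ENNReal.ofReal_lt_top
      (Lp.memLp (fourierW a f)).2).ne hwle).trans ?_
    rw [ENNReal.toReal_mul, ENNReal.toReal_ofReal (integral_nonneg fun _ => norm_nonneg _),
      ← Lp.norm_def, LinearIsometryEquiv.norm_map]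
    exact mul_le_mul_of_nonneg_right hHN (norm_nonneg _)

/-! ### The linearized operator on `H¹_a` -/

theorem acts_mult_of_coe_eq {a : ℝ} {g : BoundedContinuousFunction ℝ ℝ} {h : ℝ → ℝ}
    (e : ∀ x, g x = h x) (f : L2w a) : Acts (mult a h) f (mulB a g f) := by
  have := acts_mulB a g f
  rwa [funext e] at this

theorem acts_mult_sub_one {a : ℝ} {g : BoundedContinuousFunction ℝ ℝ} {h : ℝ → ℝ}
    (e : ∀ x, g x = h x) (f : L2w a) : Acts (mult a fun x => h x - 1) f (mulB a g f - f) := by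
  rw [← mulB_congr_sub_one (h := g - 1) (fun x => rfl)]
  exact acts_mult_of_coe_eq (fun x => by simp [e]) f

/-- The coefficients of the linearized operator as bounded continuous functions. -/
structure Coeffs (M ε : ℝ) (ω : ℝ → ℝ) where
  P : BoundedContinuousFunction ℝ ℝ
  sP : BoundedContinuousFunction ℝ ℝ
  Q : BoundedContinuousFunction ℝ ℝ
  sQ : BoundedContinuousFunction ℝ ℝ
  dP : BoundedContinuousFunction ℝ ℝ
  R : BoundedContinuousFunction ℝ ℝ
  P_eq : ∀ x, P x = p ω x
  sP_eq : ∀ x, sP x = √(p ω x)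
  Q_eq : ∀ x, Q x = q ε ω x
  sQ_eq : ∀ x, sQ x = rho ε ω x
  dP_eq : ∀ x, dP x = deriv (p ω) x
  R_eq : ∀ x, R x = deriv (q ε ω) x * p ω x * (q ε ω x)⁻¹
  P_mul : ∀ x, P x = sP x * sP x
  Q_mul : ∀ x, Q x = sQ x * sQ x
  wiener_P : Wiener (fun η => 1 + |η| / ε) (fun x => P x - 1) (M * ε ^ 2)
  wiener_sP : Wiener (fun η => 1 + |η| / ε) (fun x => sP x - 1) (M * ε ^ 2)
  wiener_Q : Wiener (fun η => 1 + |η| / ε) (fun x => Q x - 1) (M * ε ^ 2)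
  wiener_sQ : Wiener (fun η => 1 + |η| / ε) (fun x => sQ x - 1) (M * ε ^ 2)
  dP_le : ∀ x, |dP x| ≤ M * ε ^ 3
  R_le : ∀ x, |R x| ≤ M * ε ^ 3

theorem CoeffBounds.nonempty_coeffs {M ε : ℝ} {ω : ℝ → ℝ} (hε : 0 < ε) (hM : M * ε ^ 2 ≤ 1 / 4)
    (h : CoeffBounds M ε ω) : Nonempty (Coeffs M ε ω) := by
  have hφ := isWeight_one_add_abs hε
  have key : ∀ g : ℝ → ℝ, Wiener (fun η => 1 + |η| / ε) (fun x => g x - 1) (M * ε ^ 2) →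
      Continuous g ∧ ∀ x, ‖g x‖ ≤ 2 := fun g hg => by
    refine ⟨by simpa using (hg.continuous hφ).add_const 1, fun x => ?_⟩
    have := abs_le.1 (hg.abs_le hφ x)
    rw [Real.norm_eq_abs, abs_le]
    constructor <;> linarith [this.1, this.2]
  have hp := key _ h.wiener_p
  have hsp := key _ h.wiener_sqrt_p
  have hq := key _ h.wiener_q
  have hr := key _ h.wiener_rho
  exact ⟨{
    P := .ofNormedAddCommGroup _ hp.1 2 hp.2
    sP := .ofNormedAddCommGroup _ hsp.1 2 hsp.2
    Q := .ofNormedAddCommGroup _ hq.1 2 hq.2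
    sQ := .ofNormedAddCommGroup _ hr.1 2 hr.2
    dP := .ofNormedAddCommGroup _ h.continuous_deriv_p _ h.abs_deriv_p_le
    R := .ofNormedAddCommGroup _ h.continuous_r _ h.abs_r_le
    P_eq := fun _ => rfl
    sP_eq := fun _ => rfl
    Q_eq := fun _ => rfl
    sQ_eq := fun _ => rfl
    dP_eq := fun _ => rfl
    R_eq := fun _ => rfl
    P_mul := fun x => by
      have := abs_le.1 (h.wiener_p.abs_le hφ x)
      exact (Real.mul_self_sqrt (by linarith [this.1] : 0 ≤ p ω x)).symm
    Q_mul := fun x => (Real.mul_self_sqrt (Real.sqrt_nonneg _)).symm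
    wiener_P := h.wiener_p
    wiener_sP := h.wiener_sqrt_p
    wiener_Q := h.wiener_q
    wiener_sQ := h.wiener_rho
    dP_le := h.abs_deriv_p_le
    R_le := h.abs_r_le }⟩

/-- The symbol of `∂`. -/
abbrev dSymbol (ξ : ℂ) : ℂ := Complex.I * ξ

theorem measurable_freq (a : ℝ) : Measurable fun κ : ℝ => freq a (2 * Real.pi * κ) := by
  unfold freq; fun_prop

theorem measurable_sSymbol (ε : ℝ) : Measurable (sSymbol ε) :=
  ((measurable_const.mul measurable_id).mul measurable_complex_tanh).pow_const _

theorem FM_one {a : ℝ} (f : L2w a) : FM a (fun _ => 1) f f := by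
  unfold FM; simp

theorem mem_dOp_of_mem_pCommOp {a ε : ℝ} {ω : ℝ → ℝ} {f : L2w a} (h : f ∈ (pCommOp a ε ω).domain) :
    f ∈ (dOp a).domain := by
  obtain ⟨_, h1, -⟩ := exists_acts_of_mem_pcomp h
  obtain ⟨_, h2, -⟩ := exists_acts_of_mem_pcomp h1.mem
  exact h2.mem

section operators

variable {a ε : ℝ} (ha : 0 < a) (ha' : a ≤ 1 / 2) (hε2 : ε ^ 2 ≤ 1 / 2)
include ha ha' hε2

theorem exists_FM_sSymbol {f df : L2w a} (hdf : FM a dSymbol f df) :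
    ∃ sf, FM a (sSymbol ε) f sf ∧ ‖sf‖ ≤ 2 * ‖df‖ := by
  have hpt : ∀ᵐ κ, ‖sSymbol ε (freq a (2 * Real.pi * κ)) * fourierW a f κ‖ ≤
      2 * ‖fourierW a df κ‖ := by
    filter_upwards [hdf] with κ hκ
    rw [hκ, norm_mul, norm_mul, norm_mul, Complex.norm_I, one_mul, ← mul_assoc]
    exact mul_le_mul_of_nonneg_right (norm_sSymbol_freq_le_two ha ha' hε2 _) (norm_nonneg _)
  obtain ⟨sf, hsf⟩ := exists_FM_of_memLp (a := a) (m := sSymbol ε) (f := f)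
    (MemLp.of_le_mul (Lp.memLp (fourierW a df)) ((((measurable_sSymbol ε).comp
      (measurable_freq a)).aestronglyMeasurable).mul (Lp.memLp _).1) hpt)
  refine ⟨sf, hsf, ?_⟩
  rw [← (fourierW a).norm_map sf, ← (fourierW a).norm_map df]
  refine Lp.norm_le_mul_norm_of_ae_le_mul ?_
  filter_upwards [hpt, hsf] with κ h1 h2
  rwa [h2]

/-- On the line `|ξ| ≥ a`, so `1/|S| ≤ 2 (1 + 1/a)` and `S⁻¹` is bounded. This bound, which
degenerates as `a → 0`, serves existence only and enters no estimate. -/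
theorem exists_FM_sSymbol_inv {f df : L2w a} (hdf : FM a dSymbol f df) :
    ∃ h, FM a (fun ξ => (sSymbol ε ξ)⁻¹) df h ∧ FM a (sSymbol ε) h df ∧
      FM a (fun ξ => Complex.I * ξ / sSymbol ε ξ) f h := by
  have hS : ∀ k, sSymbol ε (freq a k) ≠ 0 := fun k =>
    norm_pos_iff.1 (norm_sSymbol_freq_pos ha ha' hε2 k)
  have hb : ∀ κ : ℝ, ‖(sSymbol ε (freq a (2 * Real.pi * κ)))⁻¹‖ ≤ 2 * (1 + 1 / a) := fun κ => by
    set k := 2 * Real.pi * κ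
    have h1 := norm_freq_div_sSymbol_le ha ha' hε2 k
    rw [div_eq_mul_inv, norm_mul, norm_mul, Complex.norm_I, one_mul] at h1
    have h2 : √(1 + |k|) ≤ 1 + |k| := by
      rw [Real.sqrt_le_left (by positivity)]
      nlinarith [abs_nonneg k]
    have h3 : 1 + |k| ≤ (1 + 1 / a) * ‖freq a k‖ := by
      have h4 : a ≤ ‖freq a k‖ := by
        have := Complex.abs_im_le_norm (freq a k)
        rwa [freq_im, abs_of_pos ha] at this
      have h5 : 1 ≤ 1 / a * ‖freq a k‖ := by
        rw [one_div, inv_mul_eq_div, one_le_div ha]; exact h4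
      have := abs_le_norm_freq a k
      linarith
    refine le_of_mul_le_mul_left ?_ (norm_freq_pos ha k)
    calc _ ≤ 2 * √(1 + |k|) := h1
      _ ≤ 2 * ((1 + 1 / a) * ‖freq a k‖) := by linarith
      _ = _ := by ring
  obtain ⟨h, hh⟩ := exists_FM_of_memLp (a := a) (m := fun ξ => (sSymbol ε ξ)⁻¹) (f := df)
    (memLp_bdd_mul (((measurable_sSymbol ε).inv.comp (measurable_freq a)).aestronglyMeasurable)
      hb (Lp.memLp _))
  refine ⟨h, hh, ?_, ?_⟩
  · filter_upwards [hh] with κ hκ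
    rw [hκ, mul_inv_cancel_left₀ (hS _)]
  · filter_upwards [hh, hdf] with κ h1 h2
    rw [h1, h2, div_eq_mul_inv]
    ring

end operators

/-- The action of the blocks of `𝒜` on `f ∈ H¹_a`, with `df = ∂ f`. -/
structure BlockFormula {M ε : ℝ} {ω : ℝ → ℝ} (c : Coeffs M ε ω) (a κ : ℝ) (f df sf : L2w a)
    (d₁ s₁ g₁ g₂ j₁₁ j₁₂ j₂₁ e₁₁ e₂₂ : L2w a) : Prop where
  d_sP : FM a dSymbol (mulB a c.sP f) d₁
  s_sQ : FM a (sSymbol ε) (mulB a c.sQ f) s₁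
  s_f : FM a (sSymbol ε) f sf
  d_P : FM a dSymbol (mulB a c.P f - f) g₁
  s_Q : FM a (sSymbol ε) (mulB a c.Q f - f) g₂
  -- Two expressions for one vector: the symmetrized form serves the energy identity, while in the
  -- next one `∂` and `S` act last, so that a low-frequency cutoff makes them small.
  acts₁₁ : Acts (A₁₁ a ε ω) f (mulB a c.sP d₁ + mulB a c.sQ s₁ + e₁₁)
  acts₁₁' : Acts (A₁₁ a ε ω) f (df + sf + (g₁ + g₂) + j₁₁)
  acts₁₂ : Acts (J₁₂ a ε ω) f j₁₂
  acts₂₁ : Acts (J₂₁ a ε ω) f j₂₁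
  acts₂₂ : Acts (A₂₂ a ε ω) f (mulB a c.sP d₁ - mulB a c.sQ s₁ + e₂₂)
  norm_j₁₁ : ‖j₁₁‖ ≤ 8 * κ * ‖f‖
  norm_j₁₂ : ‖j₁₂‖ ≤ 8 * κ * ‖f‖
  norm_j₂₁ : ‖j₂₁‖ ≤ 8 * κ * ‖f‖
  norm_e₁₁ : ‖e₁₁‖ ≤ 8 * κ * ‖f‖
  norm_e₂₂ : ‖e₂₂‖ ≤ 8 * κ * ‖f‖
  norm_d₁ : ‖mulB a c.sP d₁ - df‖ ≤ M * ε ^ 2 * ‖df‖ + 2 * κ * ‖f‖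
  norm_s₁ : ‖mulB a c.sQ s₁ - sf‖ ≤ M * ε ^ 2 * ‖sf‖ + 2 * κ * ‖f‖
  norm_g₁ : ‖g₁ - (mulB a c.sP d₁ - df)‖ ≤ 2 * κ * ‖f‖
  norm_g₂ : ‖g₂ - (mulB a c.sQ s₁ - sf)‖ ≤ 2 * κ * ‖f‖

theorem Wiener.abs_le_two {ε N : ℝ} (hε : 0 < ε) {g : ℝ → ℝ}
    (h : Wiener (fun η => 1 + |η| / ε) (fun x => g x - 1) N) (hN : N ≤ 1 / 4) (x : ℝ) :
    |g x| ≤ 2 := by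
  have := _root_.abs_le.1 (h.abs_le (isWeight_one_add_abs hε) x)
  rw [_root_.abs_le]
  constructor <;> linarith [this.1, this.2]

theorem norm_half_smul_le {E : Type*} [NormedAddCommGroup E] [NormedSpace ℂ E] {v : E} {C : ℝ}
    (h : ‖v‖ ≤ 2 * C) : ‖(-(1 / 2) : ℂ) • v‖ ≤ C := by
  rw [norm_smul]
  have : ‖(-(1 / 2) : ℂ)‖ = 1 / 2 := by norm_num
  rw [this]
  linarith

/-- Everything reduces to five commutator errors: `x₁ = [∂, √p] f`, `y₁ = [S, ρ] f`, `x₂` and `y₂`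
(the same commutators at `√p f` and `ρ f`), and `w = [S, p] S⁻¹ ∂ f`. Thus `∂ p f = √p ∂ √p f + x₂`
and `S q f = ρ S ρ f + y₂`, while `[S, q] f = ρ y₁ + y₂` and `[[S, ρ], ρ] f = y₂ - ρ y₁`. -/
theorem exists_blockFormula {M ε a : ℝ} {ω : ℝ → ℝ} (c : Coeffs M ε ω) (hM0 : 0 ≤ M)
    (ha : 0 < a) (ha' : a ≤ 1 / 2) (hε : 0 < ε) (hε2 : ε ^ 2 ≤ 1 / 2) (hM : M * ε ^ 2 ≤ 1 / 4)
    {f df : L2w a} (hdf : FM a dSymbol f df) :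
    ∃ sf d₁ s₁ g₁ g₂ j₁₁ j₁₂ j₂₁ e₁₁ e₂₂,
      BlockFormula c a (400 * M * ε ^ 3) f df sf d₁ s₁ g₁ g₂ j₁₁ j₁₂ j₂₁ e₁₁ e₂₂ := by
  -- The commutator constants are `K = 1`, 26 and 52, and `7 * 52 ≤ 400`.
  set κ := 400 * M * ε ^ 3 with hκ
  have hκ0 : 0 ≤ κ := by positivity
  have hdm : Measurable fun κ : ℝ => dSymbol (freq a (2 * Real.pi * κ)) :=
    (measurable_freq a).const_mul _
  have hsm : Measurable fun κ : ℝ => sSymbol ε (freq a (2 * Real.pi * κ)) :=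
    (measurable_sSymbol ε).comp (measurable_freq a)
  have hdd : ∀ k k' : ℝ, ‖dSymbol (freq a k) - dSymbol (freq a k')‖ * ‖(1 : ℂ)‖ ≤
      1 * |k - k'| := fun k k' => by
    rw [norm_one, mul_one, one_mul, ← mul_sub, norm_mul, Complex.norm_I, one_mul, freq, freq,
      add_sub_add_right_eq_sub, ← Complex.ofReal_sub, Complex.norm_real, Real.norm_eq_abs]
  have hss : ∀ k k' : ℝ, ‖sSymbol ε (freq a k) - sSymbol ε (freq a k')‖ * ‖(1 : ℂ)‖ ≤
      26 * |k - k'| := fun k k' => by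
    rw [norm_one, mul_one]
    exact norm_sSymbol_sub_le ha ha' hε2 k k'
  have hsP2 : ∀ x, |c.sP x| ≤ 2 := fun x => c.wiener_sP.abs_le_two hε hM x
  have hsQ2 : ∀ x, |c.sQ x| ≤ 2 := fun x => c.wiener_sQ.abs_le_two hε hM x
  have hb : ∀ (K : ℝ) (u : L2w a) (e : L2w a), 0 ≤ K → K ≤ 52 →
      ‖e‖ ≤ 7 * K * ε * (M * ε ^ 2) * ‖u‖ → ‖e‖ ≤ κ * ‖u‖ := fun K u e hK0 hK he => by
    refine he.trans (mul_le_mul_of_nonneg_right ?_ (norm_nonneg _))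
    rw [hκ]
    have : 0 ≤ M * ε ^ 3 := by positivity
    nlinarith [mul_le_mul_of_nonneg_right hK this]
  obtain ⟨sf, hsf, -⟩ := exists_FM_sSymbol ha ha' hε2 hdf
  obtain ⟨h, hh1, hh2, hh3⟩ := exists_FM_sSymbol_inv ha ha' hε2 hdf
  obtain ⟨x₁, hx₁, hx₁n⟩ := exists_FM_mulB hε c.wiener_sP zero_le_one hdm hdd (FM_one f) hdf
  obtain ⟨x₂, hx₂, hx₂n⟩ := exists_FM_mulB hε c.wiener_sP zero_le_one hdm hdd (FM_one _) hx₁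
  obtain ⟨y₁, hy₁, hy₁n⟩ := exists_FM_mulB hε c.wiener_sQ (by norm_num) hsm hss (FM_one f) hsf
  obtain ⟨y₂, hy₂, hy₂n⟩ := exists_FM_mulB hε c.wiener_sQ (by norm_num) hsm hss (FM_one _) hy₁
  obtain ⟨w, hw, hwn⟩ := exists_FM_mulB hε c.wiener_P (by norm_num) hsm
    (norm_sSymbol_sub_mul_le ha ha' hε2) hh3 hh2
  set d₁ := mulB a c.sP df + x₁ with hd₁
  set s₁ := mulB a c.sQ sf + y₁ with hs₁
  have nx₁ : ‖x₁‖ ≤ κ * ‖f‖ := hb _ _ _ (by norm_num) (by norm_num) hx₁n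
  have ny₁ : ‖y₁‖ ≤ κ * ‖f‖ := hb _ _ _ (by norm_num) (by norm_num) hy₁n
  have nw : ‖w‖ ≤ κ * ‖f‖ := hb _ _ _ (by norm_num) (by norm_num) hwn
  have nx₂ : ‖x₂‖ ≤ 2 * κ * ‖f‖ := by
    refine (hb _ _ _ (by norm_num) (by norm_num) hx₂n).trans ?_
    calc _ ≤ κ * (2 * ‖f‖) := by gcongr; exact norm_mulB_le hsP2 f
      _ = _ := by ring
  have ny₂ : ‖y₂‖ ≤ 2 * κ * ‖f‖ := by
    refine (hb _ _ _ (by norm_num) (by norm_num) hy₂n).trans ?_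
    calc _ ≤ κ * (2 * ‖f‖) := by gcongr; exact norm_mulB_le hsQ2 f
      _ = _ := by ring
  have nQy₁ : ‖mulB a c.sQ y₁‖ ≤ 2 * κ * ‖f‖ := (norm_mulB_le hsQ2 y₁).trans (by linarith)
  have nPx₁ : ‖mulB a c.sP x₁‖ ≤ 2 * κ * ‖f‖ := (norm_mulB_le hsP2 x₁).trans (by linarith)
  have hMκ : M * ε ^ 3 ≤ κ := by
    have : 0 ≤ M * ε ^ 3 := by positivity
    rw [hκ]; linarith
  have ndP : ‖mulB a c.dP f‖ ≤ κ * ‖f‖ :=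
    (norm_mulB_le c.dP_le f).trans (mul_le_mul_of_nonneg_right hMκ (norm_nonneg _))
  have nR : ‖mulB a c.R f‖ ≤ κ * ‖f‖ :=
    (norm_mulB_le c.R_le f).trans (mul_le_mul_of_nonneg_right hMκ (norm_nonneg _))
  rw [mulB_congr_mul c.P_mul] at hx₂
  rw [mulB_congr_mul c.Q_mul] at hy₂
  have hκf : 0 ≤ κ * ‖f‖ := by positivity
  have hPd : mulB a c.sP d₁ = mulB a c.P df + mulB a c.sP x₁ := by
    rw [hd₁, map_add, mulB_congr_mul c.P_mul]
  have hQs : mulB a c.sQ s₁ = mulB a c.Q sf + mulB a c.sQ y₁ := by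
    rw [hs₁, map_add, mulB_congr_mul c.Q_mul]
  -- the elementary operators
  have aP : ∀ u, Acts (mult a (p ω)) u (mulB a c.P u) := acts_mult_of_coe_eq c.P_eq
  have asP : ∀ u, Acts (mult a fun x => √(p ω x)) u (mulB a c.sP u) := acts_mult_of_coe_eq c.sP_eq
  have aQ : ∀ u, Acts (mult a (q ε ω)) u (mulB a c.Q u) := acts_mult_of_coe_eq c.Q_eq
  have asQ : ∀ u, Acts (mult a (rho ε ω)) u (mulB a c.sQ u) := acts_mult_of_coe_eq c.sQ_eq
  have aR : Acts (R₁ a ε ω) f (mulB a c.R f) := acts_mult_of_coe_eq c.R_eq f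
  have adP : Acts (mult a (deriv (p ω))) f (mulB a c.dP f) := acts_mult_of_coe_eq c.dP_eq f
  have apc : Acts (pCommOp a ε ω) f (-w) := by
    have h2 : Acts (SolitaryWave.comm (mult a (p ω)) (sOp a ε)) h
        (mulB a c.P df - (mulB a c.P df + w)) := hh2.acts.comm (aP df) (aP h) hw.acts
    rw [show mulB a c.P df - (mulB a c.P df + w) = -w by abel] at h2
    exact (hdf.acts.pcomp hh1.acts).pcomp h2
  have aR₂ : Acts (R₂ a ε ω) f (mulB a c.dP f + -w) := adP.add apc
  have aqc : Acts (qComm a ε ω) f (mulB a c.sQ y₁ + y₂) := by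
    have h2 : Acts (qComm a ε ω) f ((mulB a c.sQ s₁ + y₂) - mulB a c.Q sf) :=
      (aQ f).comm hy₂.acts hsf.acts (aQ sf)
    rwa [show (mulB a c.sQ s₁ + y₂) - mulB a c.Q sf = mulB a c.sQ y₁ + y₂ by
      rw [hQs]; abel] at h2
  have aρρ : Acts (SolitaryWave.comm (SolitaryWave.comm (sOp a ε) (mult a (rho ε ω)))
      (mult a (rho ε ω))) f (y₂ - mulB a c.sQ y₁) := by
    have h1 : Acts (SolitaryWave.comm (sOp a ε) (mult a (rho ε ω))) f (s₁ - mulB a c.sQ sf) :=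
      (asQ f).comm hy₁.acts hsf.acts (asQ sf)
    have h2 : Acts (SolitaryWave.comm (sOp a ε) (mult a (rho ε ω))) (mulB a c.sQ f)
        ((mulB a c.sQ s₁ + y₂) - mulB a c.sQ s₁) := by
      refine (asQ _).comm ?_ hy₁.acts (asQ s₁)
      rw [mulB_congr_mul c.Q_mul]
      exact hy₂.acts
    rw [hs₁, add_sub_cancel_left] at h1
    rw [add_sub_cancel_left] at h2
    exact (asQ f).comm h2 h1 (asQ y₁)
  have aJ₁₁ : Acts (J₁₁ a ε ω) f
      ((-(1 / 2) : ℂ) • (mulB a c.dP f + -w + mulB a c.R f + (mulB a c.sQ y₁ + y₂))) :=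
    ((aR₂.add aR).add aqc).smul _
  have aJ₁₂ : Acts (J₁₂ a ε ω) f
      ((-(1 / 2) : ℂ) • (mulB a c.R f - (mulB a c.dP f + -w) - (mulB a c.sQ y₁ + y₂))) :=
    ((aR.sub aR₂).sub aqc).smul _
  have aJ₂₁ : Acts (J₂₁ a ε ω) f
      ((-(1 / 2) : ℂ) • (mulB a c.R f - (mulB a c.dP f + -w) + (mulB a c.sQ y₁ + y₂))) :=
    ((aR.sub aR₂).add aqc).smul _
  have aJ₂₂ : Acts (J₂₂ a ε ω) f
      ((-(1 / 2) : ℂ) • (mulB a c.R f + -w + (y₂ - mulB a c.sQ y₁))) :=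
    ((aR.add apc).add aρρ).smul _
  have nR₂ : ‖mulB a c.dP f + -w‖ ≤ 2 * (κ * ‖f‖) := by
    refine (norm_add_le _ _).trans ?_
    rw [norm_neg]; linarith
  have nqc : ‖mulB a c.sQ y₁ + y₂‖ ≤ 4 * (κ * ‖f‖) := (norm_add_le _ _).trans (by linarith)
  set j₁₁ := (-(1 / 2) : ℂ) • (mulB a c.dP f + -w + mulB a c.R f + (mulB a c.sQ y₁ + y₂)) with hj₁₁
  have nj₁₁ : ‖j₁₁‖ ≤ 4 * (κ * ‖f‖) := norm_half_smul_le (by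
    refine (norm_add_le _ _).trans ?_
    have := norm_add_le (mulB a c.dP f + -w) (mulB a c.R f)
    linarith)
  have nd₁ : ‖mulB a c.sP d₁ - df‖ ≤ M * ε ^ 2 * ‖df‖ + 2 * κ * ‖f‖ := by
    rw [hPd, show mulB a c.P df + mulB a c.sP x₁ - df = (mulB a c.P df - df) + mulB a c.sP x₁ by
      abel, ← mulB_congr_sub_one (h := c.P - 1) (fun x => rfl)]
    refine (norm_add_le _ _).trans (add_le_add (norm_mulB_le (fun x => ?_) df) nPx₁)
    exact c.wiener_P.abs_le (isWeight_one_add_abs hε) x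
  have ns₁ : ‖mulB a c.sQ s₁ - sf‖ ≤ M * ε ^ 2 * ‖sf‖ + 2 * κ * ‖f‖ := by
    rw [hQs, show mulB a c.Q sf + mulB a c.sQ y₁ - sf = (mulB a c.Q sf - sf) + mulB a c.sQ y₁ by
      abel, ← mulB_congr_sub_one (h := c.Q - 1) (fun x => rfl)]
    refine (norm_add_le _ _).trans (add_le_add (norm_mulB_le (fun x => ?_) sf) nQy₁)
    exact c.wiener_Q.abs_le (isWeight_one_add_abs hε) x
  have hg₁ : FM a dSymbol (mulB a c.P f - f) (mulB a c.sP d₁ + x₂ - df) := hx₂.sub hdf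
  have hg₂ : FM a (sSymbol ε) (mulB a c.Q f - f) (mulB a c.sQ s₁ + y₂ - sf) := hy₂.sub hsf
  have aA₁₁ : Acts (A₁₁ a ε ω) f (df + sf + ((mulB a c.sP d₁ + x₂ - df) +
      (mulB a c.sQ s₁ + y₂ - sf)) + j₁₁) :=
    ((hdf.acts.add hsf.acts).add (((acts_mult_sub_one c.P_eq f).pcomp hg₁.acts).add
      ((acts_mult_sub_one c.Q_eq f).pcomp hg₂.acts))).add aJ₁₁
  refine ⟨sf, d₁, s₁, mulB a c.sP d₁ + x₂ - df, mulB a c.sQ s₁ + y₂ - sf, j₁₁, _, _,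
    x₂ + y₂ + j₁₁, _,
    { d_sP := hx₁
      s_sQ := hy₁
      s_f := hsf
      d_P := hg₁
      s_Q := hg₂
      acts₁₁ := ?_
      acts₁₁' := aA₁₁
      acts₁₂ := aJ₁₂
      acts₂₁ := aJ₂₁
      acts₂₂ := (((asP f).pcomp hx₁.acts).pcomp (asP d₁) |>.sub
        (((asQ f).pcomp hy₁.acts).pcomp (asQ s₁))).add aJ₂₂
      norm_j₁₁ := by linarith
      norm_j₁₂ := norm_half_smul_le ?_
      norm_j₂₁ := norm_half_smul_le ?_
      norm_e₁₁ := ?_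
      norm_e₂₂ := norm_half_smul_le ?_
      norm_d₁ := nd₁
      norm_s₁ := ns₁
      norm_g₁ := ?_
      norm_g₂ := ?_ }⟩
  · convert aA₁₁ using 1
    abel
  · refine (norm_sub_le _ _).trans ?_
    have := norm_sub_le (mulB a c.R f) (mulB a c.dP f + -w)
    linarith
  · refine (norm_add_le _ _).trans ?_
    have := norm_sub_le (mulB a c.R f) (mulB a c.dP f + -w)
    linarith
  · refine (norm_add_le _ _).trans ?_
    have := norm_add_le x₂ y₂
    linarith
  · refine (norm_add_le _ _).trans ?_
    have h1 := norm_add_le (mulB a c.R f) (-w)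
    have h2 := norm_sub_le y₂ (mulB a c.sQ y₁)
    rw [norm_neg] at h1
    linarith
  · rwa [show mulB a c.sP d₁ + x₂ - df - (mulB a c.sP d₁ - df) = x₂ by abel]
  · rwa [show mulB a c.sQ s₁ + y₂ - sf - (mulB a c.sQ s₁ - sf) = y₂ by abel]

/-! ### The domain of the linearized operator -/

/-- Since `a > 0`, the quantity `|ξ|² = k² + a²` is comparable with `1 + k²`, so `∂` alone
determines `H¹_a`. -/
theorem mem_dOp_iff {a : ℝ} (ha : 0 < a) (ha' : a ≤ 1 / 2) (f : L2w a) :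
    f ∈ (dOp a).domain ↔ sobolevNorm a 1 f < ⊤ := by
  have hw : ∀ κ : ℝ, ‖(((1 + (2 * Real.pi * κ) ^ 2) ^ ((1 : ℝ) / 2) : ℝ) : ℂ)‖ =
      √(1 + (2 * Real.pi * κ) ^ 2) := fun κ => by
    rw [← Real.sqrt_eq_rpow, Complex.norm_real, Real.norm_of_nonneg (Real.sqrt_nonneg _)]
  have hd : ∀ κ : ℝ, ‖dSymbol (freq a (2 * Real.pi * κ))‖ = √((2 * Real.pi * κ) ^ 2 + a ^ 2) :=
    fun κ => by
      rw [norm_mul, Complex.norm_I, one_mul, ← norm_freq_sq, Real.sqrt_sq (norm_nonneg _)]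
  have hwm : AEStronglyMeasurable (fun κ : ℝ => (((1 + (2 * Real.pi * κ) ^ 2) ^ ((1 : ℝ) / 2) : ℝ)
      : ℂ) * fourierW a f κ) volume := by
    refine AEStronglyMeasurable.mul (Measurable.aestronglyMeasurable ?_) (Lp.memLp _).1
    fun_prop
  constructor
  · intro h
    obtain ⟨g, hg⟩ := exists_FM_of_mem h
    have : MemLp (fun κ : ℝ => (((1 + (2 * Real.pi * κ) ^ 2) ^ ((1 : ℝ) / 2) : ℝ) : ℂ) *
        fourierW a f κ) 2 volume := by
      refine hg.memLp.of_le_mul (c := 1 / a) hwm (Filter.Eventually.of_forall fun κ => ?_)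
      rw [norm_mul, norm_mul, hw, hd, ← mul_assoc]
      refine mul_le_mul_of_nonneg_right ?_ (norm_nonneg _)
      refine Real.sqrt_le_iff.2 ⟨by positivity, ?_⟩
      rw [mul_pow (1 / a), Real.sq_sqrt (by positivity), one_div, inv_pow, inv_mul_eq_div,
        le_div_iff₀ (by positivity)]
      nlinarith [sq_nonneg (2 * Real.pi * κ), mul_nonneg (sq_nonneg (2 * Real.pi * κ))
        (by nlinarith : 0 ≤ 1 - a ^ 2)]
    exact this.2
  · intro h
    have hm : MemLp (fun κ : ℝ => (((1 + (2 * Real.pi * κ) ^ 2) ^ ((1 : ℝ) / 2) : ℝ) : ℂ) *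
        fourierW a f κ) 2 volume := ⟨hwm, h⟩
    obtain ⟨g, hg⟩ := exists_FM_of_memLp (a := a) (m := dSymbol) (f := f) (by
      refine hm.of_le_mul (c := 1) ((((measurable_freq a).const_mul _).aestronglyMeasurable).mul
        (Lp.memLp _).1) (Filter.Eventually.of_forall fun κ => ?_)
      rw [one_mul, norm_mul (dSymbol _), hd, norm_mul, hw]
      refine mul_le_mul_of_nonneg_right (Real.sqrt_le_sqrt ?_) (norm_nonneg _)
      nlinarith)
    exact hg.acts.mem

theorem acts_opA {a ε : ℝ} {ω : ℝ → ℝ} {z : WithLp 2 (L2w a × L2w a)} {u v w x : L2w a}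
    (h₁₁ : Acts (A₁₁ a ε ω) z.fst u) (h₁₂ : Acts (J₁₂ a ε ω) z.snd v)
    (h₂₁ : Acts (J₂₁ a ε ω) z.fst w) (h₂₂ : Acts (A₂₂ a ε ω) z.snd x) :
    Acts (opA a ε ω) z (WithLp.toLp 2 (u + v, w + x)) := by
  obtain ⟨k₁₁, rfl⟩ := h₁₁
  obtain ⟨k₁₂, rfl⟩ := h₁₂
  obtain ⟨k₂₁, rfl⟩ := h₂₁
  obtain ⟨k₂₂, rfl⟩ := h₂₂
  exact ⟨⟨⟨k₁₁, k₂₁⟩, ⟨k₁₂, k₂₂⟩⟩, rfl⟩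

/-- For the first component `∂` is a summand of `A₁₁`; for the second it is the first factor to act
in `[p, S] S⁻¹ ∂`, inside `J₁₂`. -/
theorem mem_dOp_of_mem_opA {a ε : ℝ} {ω : ℝ → ℝ} {z : WithLp 2 (L2w a × L2w a)}
    (h : z ∈ (opA a ε ω).domain) : z.fst ∈ (dOp a).domain ∧ z.snd ∈ (dOp a).domain := by
  obtain ⟨⟨h₁₁, -⟩, ⟨h₁₂, -⟩⟩ := h
  exact ⟨h₁₁.1.1.1, mem_dOp_of_mem_pCommOp h₁₂.1.2.2⟩

/-! ### Energy identities -/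

theorem norm_sq_eq_integral (u : Lp ℂ 2 (volume : Measure ℝ)) :
    ‖u‖ ^ 2 = ∫ κ, ‖u κ‖ ^ 2 := by
  have h := inner_self_eq_norm_sq (𝕜 := ℂ) u
  rw [← h, L2.inner_def, ← integral_re (L2.integrable_inner u u)]
  refine integral_congr_ae (Filter.Eventually.of_forall fun κ => ?_)
  exact inner_self_eq_norm_sq (𝕜 := ℂ) (u κ)

theorem integrable_norm_sq (u : Lp ℂ 2 (volume : Measure ℝ)) : Integrable fun κ => ‖u κ‖ ^ 2 :=
  (Lp.memLp u).norm.integrable_sq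

theorem re_inner_FM {a : ℝ} {m : ℂ → ℂ} {f g : L2w a} (h : FM a m f g) :
    Integrable (fun κ => (m (freq a (2 * Real.pi * κ))).re * ‖fourierW a f κ‖ ^ 2) ∧
    (inner ℂ f g).re = ∫ κ, (m (freq a (2 * Real.pi * κ))).re * ‖fourierW a f κ‖ ^ 2 := by
  have hi := (L2.integrable_inner (𝕜 := ℂ) (fourierW a f) (fourierW a g)).re
  have hae : (fun κ => RCLike.re (inner ℂ (fourierW a f κ) (fourierW a g κ))) =ᵐ[volume]
      fun κ => (m (freq a (2 * Real.pi * κ))).re * ‖fourierW a f κ‖ ^ 2 := by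
    filter_upwards [h] with κ hκ
    rw [hκ, RCLike.inner_apply, mul_assoc, RCLike.mul_conj, RCLike.re_to_complex,
      ← Complex.re_mul_ofReal]
    norm_cast
  refine ⟨hi.congr hae, ?_⟩
  rw [← (fourierW a).inner_map_map, L2.inner_def, ← RCLike.re_to_complex,
    ← integral_re (L2.integrable_inner _ _)]
  exact integral_congr_ae hae

theorem re_inner_dSymbol {a : ℝ} {f df : L2w a} (h : FM a dSymbol f df) :
    (inner ℂ f df).re = -a * ‖f‖ ^ 2 := by
  rw [(re_inner_FM h).2, ← (fourierW a).norm_map f, norm_sq_eq_integral, ← integral_const_mul]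
  congr 1
  ext κ
  simp

/-- Multiplication by the indicator function of a set of frequencies. -/
def cutoff (s : Set ℝ) (hs : MeasurableSet s) :
    Lp ℂ 2 (volume : Measure ℝ) →L[ℂ] Lp ℂ 2 (volume : Measure ℝ) :=
  mulCLM volume (s.indicator fun _ => (1 : ℂ)) 1
    (measurable_const.indicator hs).aestronglyMeasurable fun x => by
      by_cases h : x ∈ s <;> simp [h]

theorem cutoff_ae (s : Set ℝ) (hs : MeasurableSet s) (u : Lp ℂ 2 (volume : Measure ℝ)) :
    cutoff s hs u =ᵐ[volume] s.indicator u := by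
  filter_upwards [mulCLM_ae (g := s.indicator fun _ => (1 : ℂ)) (C := 1)
    (measurable_const.indicator hs).aestronglyMeasurable (fun x => by
      by_cases h : x ∈ s <;> simp [h]) u] with κ hκ
  refine hκ.trans ?_
  by_cases h : κ ∈ s <;> simp [h]

theorem norm_cutoff_le (s : Set ℝ) (hs : MeasurableSet s) (u : Lp ℂ 2 (volume : Measure ℝ)) :
    ‖cutoff s hs u‖ ≤ ‖u‖ := by
  refine Lp.norm_le_norm_of_ae_le ?_
  filter_upwards [cutoff_ae s hs u] with κ hκ
  rw [hκ]
  exact norm_indicator_le_norm_self _ _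

theorem norm_sq_eq_cutoff_add (s : Set ℝ) (hs : MeasurableSet s)
    (u : Lp ℂ 2 (volume : Measure ℝ)) :
    ‖u‖ ^ 2 = ‖cutoff sᶜ hs.compl u‖ ^ 2 + ‖cutoff s hs u‖ ^ 2 := by
  rw [norm_sq_eq_integral, norm_sq_eq_integral, norm_sq_eq_integral,
    ← integral_add (integrable_norm_sq _) (integrable_norm_sq _)]
  refine integral_congr_ae ?_
  filter_upwards [cutoff_ae s hs u, cutoff_ae sᶜ hs.compl u] with κ h1 h2
  rw [h1, h2]
  by_cases h : κ ∈ s <;> simp [h]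

/-- The frequencies `|k| ≥ δ`. -/
def highFreq (δ : ℝ) : Set ℝ := {κ | δ ≤ |2 * Real.pi * κ|}

theorem measurableSet_highFreq (δ : ℝ) : MeasurableSet (highFreq δ) :=
  measurableSet_le measurable_const (by fun_prop)

section symbols

variable {a ε : ℝ} (ha : 0 < a) (ha' : a ≤ 1 / 2) (hε2 : ε ^ 2 ≤ 1 / 2)
include ha ha' hε2

theorem re_inner_sSymbol_nonneg {f sf : L2w a} (h : FM a (sSymbol ε) f sf) :
    0 ≤ (inner ℂ f sf).re := by
  rw [(re_inner_FM h).2]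
  exact integral_nonneg fun κ => mul_nonneg (sSymbol_freq_re_pos ha ha' hε2 _).le (sq_nonneg _)

theorem re_inner_sSymbol_le {f sf : L2w a} (h : FM a (sSymbol ε) f sf) {δ : ℝ} (hδ : 0 < δ)
    (hδ1 : δ ≤ 1) (haδ : a ^ 2 ≤ δ ^ 2 / 16) :
    (inner ℂ f sf).re ≤ (a + a ^ 3) * ‖f‖ ^ 2 -
      a * δ ^ 2 / 16 * ‖cutoff (highFreq δ) (measurableSet_highFreq δ) (fourierW a f)‖ ^ 2 := by
  obtain ⟨hi, e⟩ := re_inner_FM h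
  rw [e, ← (fourierW a).norm_map f, norm_sq_eq_integral, norm_sq_eq_integral,
    ← integral_const_mul, ← integral_const_mul, ← integral_sub
    ((integrable_norm_sq _).const_mul _) ((integrable_norm_sq _).const_mul _)]
  refine integral_mono_ae hi (((integrable_norm_sq _).const_mul _).sub
    ((integrable_norm_sq _).const_mul _)) ?_
  filter_upwards [cutoff_ae _ (measurableSet_highFreq δ) (fourierW a f)] with κ hκ
  rw [hκ]
  by_cases hk : κ ∈ highFreq δ
  · rw [Set.indicator_of_mem hk, ← sub_mul]
    refine mul_le_mul_of_nonneg_right ?_ (sq_nonneg _)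
    have := sSymbol_freq_re_le_high ha ha' hε2 (2 * Real.pi * κ) hδ hδ1 haδ hk
    have h3 : 0 < a ^ 3 := by positivity
    linarith
  · rw [Set.indicator_of_notMem hk, norm_zero]
    have := mul_le_mul_of_nonneg_right (sSymbol_freq_re_le_low ha ha' hε2 (2 * Real.pi * κ))
      (sq_nonneg ‖fourierW a f κ‖)
    linarith

/-- Low frequencies: there `|lam - iξ - S| ≥ θ / 2`. -/
theorem norm_cutoff_low_le {δ θ : ℝ} (hθ : 0 < θ) (hδθ : 3 * (δ + a) ≤ θ / 2)
    (hδ : 0 < δ) {lam : ℂ} (hlam : θ ≤ ‖lam‖) {f df sf F₁ g₁ F₂ g₂ : L2w a} (hd : FM a dSymbol f df)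
    (hs : FM a (sSymbol ε) f sf) (h₁ : FM a dSymbol F₁ g₁) (h₂ : FM a (sSymbol ε) F₂ g₂) :
    θ / 2 * ‖cutoff (highFreq δ)ᶜ (measurableSet_highFreq δ).compl (fourierW a f)‖ ≤
      ‖lam • f - (df + sf + (g₁ + g₂))‖ + 2 * (δ + a) * (‖F₁‖ + ‖F₂‖) := by
  set L := cutoff (highFreq δ)ᶜ (measurableSet_highFreq δ).compl with hL
  have hLa := cutoff_ae (highFreq δ)ᶜ (measurableSet_highFreq δ).compl
  have hξ : ∀ κ ∈ (highFreq δ)ᶜ, ‖freq a (2 * Real.pi * κ)‖ ≤ δ + a := fun κ hκ => by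
    have h1 := norm_freq_le ha.le (2 * Real.pi * κ)
    have h2 : |2 * Real.pi * κ| < δ := not_le.1 hκ
    linarith
  have hS : ∀ κ ∈ (highFreq δ)ᶜ, ‖sSymbol ε (freq a (2 * Real.pi * κ))‖ ≤ 2 * (δ + a) :=
    fun κ hκ => (norm_sSymbol_freq_le_two ha ha' hε2 _).trans (by linarith [hξ κ hκ])
  -- As `∂` and `S` act last in `g₁` and `g₂`, the cutoff bounds them by `δ + a` and `2(δ + a)`,
  -- with no derivative falling on `F₁` or `F₂`.
  have b₁ : ‖L (fourierW a g₁)‖ ≤ (δ + a) * ‖fourierW a F₁‖ := by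
    refine Lp.norm_le_mul_norm_of_ae_le_mul ?_
    filter_upwards [hLa (fourierW a g₁), h₁] with κ h3 h4
    rw [h3]
    by_cases hκ : κ ∈ (highFreq δ)ᶜ
    · rw [Set.indicator_of_mem hκ, h4, norm_mul, norm_mul, Complex.norm_I, one_mul]
      exact mul_le_mul_of_nonneg_right (hξ κ hκ) (norm_nonneg _)
    · rw [Set.indicator_of_notMem hκ, norm_zero]
      positivity
  have b₂ : ‖L (fourierW a g₂)‖ ≤ (2 * (δ + a)) * ‖fourierW a F₂‖ := by
    refine Lp.norm_le_mul_norm_of_ae_le_mul ?_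
    filter_upwards [hLa (fourierW a g₂), h₂] with κ h3 h4
    rw [h3]
    by_cases hκ : κ ∈ (highFreq δ)ᶜ
    · rw [Set.indicator_of_mem hκ, h4, norm_mul]
      exact mul_le_mul_of_nonneg_right (hS κ hκ) (norm_nonneg _)
    · rw [Set.indicator_of_notMem hκ, norm_zero]
      positivity
  -- On low frequencies `|iξ + S| ≤ 3(δ + a) ≤ θ/2`, while `|lam| ≥ θ`.
  have b₀ : ‖L (fourierW a f)‖ ≤ 2 / θ * ‖L (fourierW a (lam • f - (df + sf)))‖ := by
    refine Lp.norm_le_mul_norm_of_ae_le_mul ?_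
    have e : fourierW a (lam • f - (df + sf)) =
        lam • fourierW a f - (fourierW a df + fourierW a sf) := by
      rw [map_sub, map_add, LinearIsometryEquiv.map_smul]
    rw [e]
    filter_upwards [hLa (fourierW a f),
      hLa (lam • fourierW a f - (fourierW a df + fourierW a sf)), hd, hs,
      Lp.coeFn_sub (lam • fourierW a f) (fourierW a df + fourierW a sf),
      Lp.coeFn_smul lam (fourierW a f), Lp.coeFn_add (fourierW a df) (fourierW a sf)]
      with κ h3 h4 h5 h6 h7 h8 h9
    rw [h3, h4]
    by_cases hκ : κ ∈ (highFreq δ)ᶜ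
    · rw [Set.indicator_of_mem hκ, Set.indicator_of_mem hκ, h7, Pi.sub_apply, h8, h9,
        Pi.smul_apply, Pi.add_apply, h5, h6, smul_eq_mul, ← add_mul, ← sub_mul, norm_mul,
        ← mul_assoc]
      refine le_mul_of_one_le_left (norm_nonneg _) ?_
      rw [div_mul_eq_mul_div, le_div_iff₀ hθ, one_mul]
      have h10 := norm_sub_norm_le lam (dSymbol (freq a (2 * Real.pi * κ)) +
        sSymbol ε (freq a (2 * Real.pi * κ)))
      have h11 := norm_add_le (dSymbol (freq a (2 * Real.pi * κ)))
        (sSymbol ε (freq a (2 * Real.pi * κ)))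
      rw [norm_mul, Complex.norm_I, one_mul] at h11
      linarith [hξ κ hκ, hS κ hκ]
    · rw [Set.indicator_of_notMem hκ, Set.indicator_of_notMem hκ, norm_zero, mul_zero]
  have e : fourierW a (lam • f - (df + sf)) =
      fourierW a (lam • f - (df + sf + (g₁ + g₂))) + (fourierW a g₁ + fourierW a g₂) := by
    rw [← map_add, ← map_add]
    congr 1
    abel
  have b₃ : ‖L (fourierW a (lam • f - (df + sf)))‖ ≤
      ‖lam • f - (df + sf + (g₁ + g₂))‖ + 2 * (δ + a) * (‖F₁‖ + ‖F₂‖) := by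
    rw [e, map_add, map_add]
    refine (norm_add_le _ _).trans ?_
    have h3 := norm_add_le (L (fourierW a g₁)) (L (fourierW a g₂))
    have h4 := norm_cutoff_le (highFreq δ)ᶜ (measurableSet_highFreq δ).compl
      (fourierW a (lam • f - (df + sf + (g₁ + g₂))))
    rw [LinearIsometryEquiv.norm_map] at h4 b₁ b₂
    rw [← hL] at h4
    have h5 : 0 ≤ (δ + a) * ‖F₁‖ := by positivity
    nlinarith
  calc _ ≤ θ / 2 * (2 / θ * ‖L (fourierW a (lam • f - (df + sf)))‖) := by gcongr
    _ = ‖L (fourierW a (lam • f - (df + sf)))‖ := by field_simp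
    _ ≤ _ := b₃

end symbols

/-! ### The a priori estimate -/

theorem abs_norm_mulB_sub_le {a ε N : ℝ} (hε : 0 < ε) {g : BoundedContinuousFunction ℝ ℝ}
    (hg : Wiener (fun η => 1 + |η| / ε) (fun x => g x - 1) N) (f : L2w a) :
    ‖mulB a g f - f‖ ≤ N * ‖f‖ := by
  rw [← mulB_congr_sub_one (h := g - 1) (fun x => rfl)]
  exact norm_mulB_le (fun x => hg.abs_le (isWeight_one_add_abs hε) x) f

theorem norm_fst_snd_le {a : ℝ} (v : WithLp 2 (L2w a × L2w a)) :
    ‖v.fst‖ ≤ ‖v‖ ∧ ‖v.snd‖ ≤ ‖v‖ ∧ ‖v‖ ≤ ‖v.fst‖ + ‖v.snd‖ := by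
  have h := WithLp.prod_norm_sq_eq_of_L2 v
  refine ⟨le_of_sq_le_sq (by linarith [sq_nonneg ‖v.snd‖]) (norm_nonneg _),
    le_of_sq_le_sq (by linarith [sq_nonneg ‖v.fst‖]) (norm_nonneg _),
    le_of_sq_le_sq ?_ (by positivity)⟩
  linarith [mul_nonneg (norm_nonneg v.fst) (norm_nonneg v.snd)]

set_option maxHeartbeats 400000 in
/-- The algebra of the a priori estimate: `x, y` are the norms of the two components, `l` and `h`
the low and high frequency parts of the first one. -/
theorem apriori_arith {x y l h hi Y a δ θ m η₀ : ℝ} (hx : 0 ≤ x)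
    (hl : 0 ≤ l) (hhi : 0 ≤ hi) (hY : 0 ≤ Y) (ha : 0 < a)
    (hδ : 0 < δ) (hθ : 0 < θ) (hθ1 : θ ≤ 1) (hδθ : 3 * (δ + a) ≤ θ / 2) (hm0 : 0 ≤ m)
    (hm : m ≤ 1 / 24) (hη₀ : 0 ≤ η₀) (hη : η₀ ≤ a * δ ^ 2 / 1024)
    (e₁ : a / 4 * y ≤ Y + η₀ * x)
    (e₂ : a * δ ^ 2 / 16 * h ^ 2 ≤ x * Y + a * δ ^ 2 / 512 * x ^ 2 + η₀ * x * y)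
    (e₃ : θ / 2 * l ≤ Y + η₀ * (x + y) + 4 * (δ + a) * m * x)
    (e₄ : x ^ 2 = l ^ 2 + hi ^ 2) (e₅ : hi ≤ h + m * x) :
    a * δ ^ 2 * (x + y) ≤ 300 * Y := by
  have hδθ' : δ ≤ θ / 6 := by linarith
  have hδ1 : δ ≤ 1 / 6 := by linarith
  have hδ2 : δ ^ 2 ≤ θ ^ 2 := pow_le_pow_left₀ hδ.le (by linarith) 2
  have hθ2 : θ ^ 2 ≤ θ := by rw [sq]; exact mul_le_of_le_one_left hθ.le hθ1
  have hδ21 : δ ^ 2 ≤ 1 := pow_le_one₀ hδ.le (by linarith)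
  -- `X` is the size of the gap; every error is compared with it.
  obtain ⟨X, hX⟩ : ∃ X, X = a * δ ^ 2 := ⟨_, rfl⟩
  rw [← hX] at hη e₂ ⊢
  have hX0 : 0 < X := by rw [hX]; positivity
  have hXa : X ≤ a := by rw [hX]; exact mul_le_of_le_one_right ha.le hδ21
  have hXθ : X ≤ θ ^ 2 := by
    rw [hX]
    calc a * δ ^ 2 ≤ 1 * θ ^ 2 := mul_le_mul (by linarith) hδ2 (sq_nonneg _) zero_le_one
      _ = _ := one_mul _
  -- bound for `η₀ y`
  have h1 : η₀ * y ≤ θ / 256 * Y + X / 1024 * x := by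
    have h2 : η₀ ≤ a / 4 * (θ / 256) := by
      calc η₀ ≤ a * δ ^ 2 / 1024 := by rwa [hX] at hη
        _ ≤ a * θ / 1024 := by gcongr; linarith
        _ = _ := by ring
    rcases le_total 0 y with hy | hy
    · calc η₀ * y ≤ (a / 4 * (θ / 256)) * y := by gcongr
        _ = θ / 256 * (a / 4 * y) := by ring
        _ ≤ θ / 256 * (Y + η₀ * x) := by gcongr
        _ ≤ θ / 256 * Y + 1 * (η₀ * x) := by
          rw [mul_add]
          gcongr
          linarith
        _ ≤ θ / 256 * Y + X / 1024 * x := by rw [one_mul]; gcongr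
    · have h3 : η₀ * y ≤ 0 := mul_nonpos_of_nonneg_of_nonpos hη₀ hy
      exact h3.trans (by positivity)
  -- low frequencies
  have h2 : l ≤ 3 / θ * Y + x / 4 := by
    have h3 : η₀ ≤ θ / 1024 := by linarith
    have h4 : X / 1024 ≤ θ / 1024 := by linarith
    have h5 : 4 * (δ + a) * m ≤ θ / 36 := by
      calc 4 * (δ + a) * m ≤ 4 * (θ / 6) * (1 / 24) := by gcongr; linarith
        _ = _ := by ring
    have h6 : θ / 2 * l ≤ θ / 2 * (3 / θ * Y + x / 4) := by
      have e : θ / 2 * (3 / θ * Y + x / 4) = 3 / 2 * Y + θ / 8 * x := by field_simp; ring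
      rw [e]
      have k1 : η₀ * x ≤ θ / 1024 * x := by gcongr
      have k2 : X / 1024 * x ≤ θ / 1024 * x := by gcongr
      have k3 : 4 * (δ + a) * m * x ≤ θ / 36 * x := by gcongr
      have k4 : θ / 256 * Y ≤ 1 / 256 * Y := by gcongr
      have k5 : 0 ≤ θ * x := by positivity
      linarith
    exact le_of_mul_le_mul_left h6 (by positivity)
  have h3 : X * h ^ 2 ≤ 32 * (x * Y) + X / 16 * x ^ 2 := by
    have k1 : η₀ * x * y ≤ 1 / 256 * (x * Y) + X / 1024 * x ^ 2 := by
      calc η₀ * x * y = x * (η₀ * y) := by ring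
        _ ≤ x * (θ / 256 * Y + X / 1024 * x) := by gcongr
        _ = θ / 256 * (x * Y) + X / 1024 * x ^ 2 := by ring
        _ ≤ _ := by gcongr
    have k2 : 0 ≤ x * Y := by positivity
    have k3 : 0 ≤ X * x ^ 2 := by positivity
    linarith
  obtain ⟨t, ht⟩ : ∃ t, t = 3 / θ * Y := ⟨_, rfl⟩
  rw [← ht] at h2
  have ht0 : 0 ≤ t := by rw [ht]; positivity
  -- Both frequency bounds contain small multiples of `x`, which are absorbed into `x² = l² + hi²`.
  have h4 : x ^ 2 ≤ 3 * t ^ 2 + 3 * h ^ 2 := by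
    have k1 : l ^ 2 ≤ 2 * t ^ 2 + x ^ 2 / 8 := by
      have : l ^ 2 ≤ (t + x / 4) ^ 2 := pow_le_pow_left₀ hl h2 2
      linarith [sq_nonneg (t - x / 4)]
    have k2 : hi ^ 2 ≤ 2 * h ^ 2 + x ^ 2 / 32 := by
      have k3 : hi ≤ h + x / 8 := by linarith [mul_le_mul_of_nonneg_right hm hx]
      have : hi ^ 2 ≤ (h + x / 8) ^ 2 := pow_le_pow_left₀ hhi k3 2
      linarith [sq_nonneg (h - x / 8), sq_nonneg h]
    linarith [sq_nonneg t, sq_nonneg h]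
  have h5 : X * t ^ 2 ≤ 9 * Y ^ 2 := by
    have e : X * t ^ 2 = X / θ ^ 2 * (9 * Y ^ 2) := by rw [ht]; field_simp; ring
    rw [e]
    have : X / θ ^ 2 ≤ 1 := (div_le_one (by positivity)).2 hXθ
    exact mul_le_of_le_one_left (by positivity) this
  have h6 : X * x ^ 2 ≤ 36 * Y ^ 2 + 128 * (x * Y) := by
    have k2 : 0 ≤ x * Y := by positivity
    linarith [mul_le_mul_of_nonneg_left h4 hX0.le, sq_nonneg Y]
  -- A quadratic inequality in `x` is solved by contradiction. Since `X ≤ 1/2`, the assumption `X x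
  -- > 140 Y` makes the term `Y²` negligible against `x Y`.
  have h7 : X * x ≤ 140 * Y := by
    by_contra hcon
    push Not at hcon
    have k1 : X ≤ 1 / 2 := by linarith
    have hx0 : 0 < x := by
      rcases hx.eq_or_lt with h0 | h0
      · rw [← h0] at hcon; linarith
      · exact h0
    have k2 : 140 * Y * x < X * x * x := mul_lt_mul_of_pos_right hcon hx0
    have k3 : 140 * Y ≤ x / 2 := by linarith [mul_le_mul_of_nonneg_right k1 hx]
    linarith [mul_le_mul_of_nonneg_right k3 hY, mul_nonneg hx hY]
  have h8 : X * y ≤ 150 * Y := by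
    rcases le_total 0 y with hy | hy
    · have k1 : X * y ≤ a * y := by gcongr
      have k2 := mul_le_mul_of_nonneg_right hη hx
      linarith
    · have : X * y ≤ 0 := mul_nonpos_of_nonneg_of_nonpos hX0.le hy
      linarith
  linarith

/-- Smallness conditions on the parameters `a`, `δ`, `θ`. -/
structure SmallParams (M ε a δ θ : ℝ) : Prop where
  M_nonneg : 0 ≤ M
  ε_pos : 0 < ε
  ε_sq_le : ε ^ 2 ≤ 1 / 2
  a_pos : 0 < a
  a_le : a ≤ 1 / 2
  δ_pos : 0 < δ
  θ_pos : 0 < θ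
  θ_le : θ ≤ 1
  a_sq_le : a ^ 2 ≤ δ ^ 2 / 16
  δ_add_le : 3 * (δ + a) ≤ θ / 2
  M_le : M * ε ^ 2 ≤ 1 / 200
  -- The left side collects all cubic errors: replacing `√p f` and `ρ f` by `f`, the excess `a³` of
  -- `Re S` over `a`, and the commutators. They must fit below the gap.
  cubic_le : 4 * a * (M * ε ^ 2) + 2 * a ^ 3 + 3200 * M * ε ^ 3 ≤ a * δ ^ 2 / 1024

-- Three inequalities are combined: the energy of the second component, dissipated at rate of order
-- `a`; the energy of the first, dissipated at high frequency only; and direct inversion at low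
-- frequency, which alone uses `|lam| ≥ θ`.
set_option maxHeartbeats 1000000 in
theorem apriori {M ε a δ θ : ℝ} {ω : ℝ → ℝ} (c : Coeffs M ε ω) (H : SmallParams M ε a δ θ)
    {lam : ℂ} (hlam : θ ≤ ‖lam‖) (hre : -(a * δ ^ 2 / 1024) ≤ lam.re)
    (z : (opA a ε ω).domain) :
    a * δ ^ 2 / 300 * ‖(z : WithLp 2 (L2w a × L2w a))‖ ≤
      ‖lam • (z : WithLp 2 (L2w a × L2w a)) - opA a ε ω z‖ := by
  obtain ⟨z, hz⟩ := z
  obtain ⟨hf, hg⟩ := mem_dOp_of_mem_opA hz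
  obtain ⟨df, hdf⟩ := exists_FM_of_mem hf
  obtain ⟨dg, hdg⟩ := exists_FM_of_mem hg
  have hε := H.ε_pos
  have ha := H.a_pos
  have hM4 : M * ε ^ 2 ≤ 1 / 4 := H.M_le.trans (by norm_num)
  obtain ⟨sf, d₁, s₁, g₁, g₂, j₁₁, _, j₂₁, e₁₁, _, B⟩ :=
    exists_blockFormula c H.M_nonneg ha H.a_le hε H.ε_sq_le hM4 hdf
  obtain ⟨sg, d₁', s₁', _, _, _, j₁₂, _, _, e₂₂, B'⟩ :=
    exists_blockFormula c H.M_nonneg ha H.a_le hε H.ε_sq_le hM4 hdg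
  set f := z.fst with hfdef
  set g := z.snd with hgdef
  have hA := (acts_opA B.acts₁₁ B'.acts₁₂ B.acts₂₁ B'.acts₂₂).apply_eq hz
  have hA' := (acts_opA B.acts₁₁' B'.acts₁₂ B.acts₂₁ B'.acts₂₂).apply_eq hz
  set w := lam • z - opA a ε ω ⟨z, hz⟩ with hw
  have hw₁ : w.fst = lam • f - (mulB a c.sP d₁ + mulB a c.sQ s₁ + e₁₁ + j₁₂) := by
    rw [hw, hA]; rfl
  have hw₁' : w.fst = lam • f - (df + sf + (g₁ + g₂) + j₁₁ + j₁₂) := by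
    rw [hw, hA']; rfl
  have hw₂ : w.snd = lam • g - (j₂₁ + (mulB a c.sP d₁' - mulB a c.sQ s₁' + e₂₂)) := by
    rw [hw, hA]; rfl
  set Y := ‖w‖ with hY
  have hY₁ : ‖w.fst‖ ≤ Y := (norm_fst_snd_le w).1
  have hY₂ : ‖w.snd‖ ≤ Y := (norm_fst_snd_le w).2.1
  set m := M * ε ^ 2 with hmdef
  have hM0 := H.M_nonneg
  have hm0 : 0 ≤ m := by positivity
  set η₀ := 3200 * M * ε ^ 3 with hη₀def
  have hη₀ : 0 ≤ η₀ := by positivity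
  have hκ : 8 * (400 * M * ε ^ 3) = η₀ := by rw [hη₀def]; ring
  have n₁ := B.norm_e₁₁
  have n₂ := B.norm_j₁₁
  have n₃ := B.norm_j₂₁
  have n₄ := B'.norm_j₁₂
  have n₅ := B'.norm_e₂₂
  rw [hκ] at n₁ n₂ n₃ n₄ n₅
  have hcub := H.cubic_le
  have hm200 := H.M_le
  have hηle : η₀ ≤ a * δ ^ 2 / 1024 := by
    have : 0 ≤ 4 * a * m + 2 * a ^ 3 := by positivity
    linarith
  have hδ1 : δ ≤ 1 := by linarith [H.δ_add_le, H.θ_le]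
  have hδ21 : δ ^ 2 ≤ 1 := pow_le_one₀ H.δ_pos.le hδ1
  have hδaa : a * δ ^ 2 ≤ a := mul_le_of_le_one_right ha.le hδ21
  -- sizes of `√p f` and `ρ f`
  have hsP : ∀ u : L2w a, (1 - m) * ‖u‖ ≤ ‖mulB a c.sP u‖ := fun u => by
    have h1 := abs_norm_mulB_sub_le hε c.wiener_sP u
    have h2 := norm_sub_norm_le u (u - mulB a c.sP u)
    rw [sub_sub_cancel, norm_sub_rev] at h2
    linarith
  have hsQ : ‖mulB a c.sQ f‖ ≤ (1 + m) * ‖f‖ := by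
    have h1 := abs_norm_mulB_sub_le hε c.wiener_sQ f
    have h2 := norm_add_le (mulB a c.sQ f - f) f
    rw [sub_add_cancel] at h2
    linarith
  have hinner : ∀ u v : L2w a, -(‖u‖ * ‖v‖) ≤ (inner ℂ u v).re ∧
      (inner ℂ u v).re ≤ ‖u‖ * ‖v‖ := fun u v => by
    have h1 := (Complex.abs_re_le_norm (inner ℂ u v)).trans (norm_inner_le_norm u v)
    exact _root_.abs_le.1 h1
  have hself : ∀ u : L2w a, (inner ℂ u u).re = ‖u‖ ^ 2 := fun u =>
    inner_self_eq_norm_sq (𝕜 := ℂ) u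
  have hlamin : ∀ u : L2w a, (inner ℂ u (lam • u)).re = lam.re * ‖u‖ ^ 2 := fun u => by
    have h0 : (inner ℂ u u).im = 0 := inner_self_im (𝕜 := ℂ) u
    rw [inner_smul_right, Complex.mul_re, hself, h0, mul_zero, sub_zero]
  -- the second component
  have E₁ : a / 4 * ‖g‖ ≤ Y + η₀ * ‖f‖ := by
    have k1 : (inner ℂ g w.snd).re = lam.re * ‖g‖ ^ 2 - ((inner ℂ g j₂₁).re +
        ((inner ℂ (mulB a c.sP g) d₁').re - (inner ℂ (mulB a c.sQ g) s₁').re +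
          (inner ℂ g e₂₂).re)) := by
      rw [hw₂, inner_sub_right, inner_add_right, inner_add_right, inner_sub_right, inner_mulB,
        inner_mulB, Complex.sub_re, Complex.add_re, Complex.add_re, Complex.sub_re, hlamin]
    rw [re_inner_dSymbol B'.d_sP] at k1
    -- In `A₂₂` the operator `S` enters with a minus sign, so only the sign of its real part
    -- matters.
    have k2 := re_inner_sSymbol_nonneg ha H.a_le H.ε_sq_le B'.s_sQ
    have k3 := (hinner g w.snd).2
    have k4 := (hinner g j₂₁).2
    have k5 := (hinner g e₂₂).2
    have k6 : a / 2 * ‖g‖ ^ 2 ≤ a * ‖mulB a c.sP g‖ ^ 2 := by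
      have k7 : ((1 - m) * ‖g‖) ^ 2 ≤ ‖mulB a c.sP g‖ ^ 2 :=
        pow_le_pow_left₀ (mul_nonneg (by linarith) (norm_nonneg _)) (hsP g) 2
      have k8 : 1 / 2 ≤ (1 - m) ^ 2 := by linarith [sq_nonneg m]
      have k9 : 1 / 2 * ‖g‖ ^ 2 ≤ ((1 - m) * ‖g‖) ^ 2 := by
        rw [mul_pow]; exact mul_le_mul_of_nonneg_right k8 (sq_nonneg _)
      linarith [mul_le_mul_of_nonneg_left (k9.trans k7) ha.le]
    have k10 : ‖g‖ * (a / 4 * ‖g‖) ≤ ‖g‖ * (Y + η₀ * ‖f‖) := by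
      have q1 : ‖g‖ * ‖w.snd‖ ≤ ‖g‖ * Y := by gcongr
      have q2 : ‖g‖ * ‖j₂₁‖ ≤ ‖g‖ * (η₀ * ‖f‖) := by gcongr
      have q3 : ‖g‖ * ‖e₂₂‖ ≤ ‖g‖ * (η₀ * ‖g‖) := by gcongr
      have q4 : -(a / 1024) * ‖g‖ ^ 2 ≤ lam.re * ‖g‖ ^ 2 :=
        mul_le_mul_of_nonneg_right (by linarith) (sq_nonneg _)
      have q5 : η₀ * ‖g‖ ^ 2 ≤ a / 1024 * ‖g‖ ^ 2 :=
        mul_le_mul_of_nonneg_right (by linarith) (sq_nonneg _)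
      linarith [mul_nonneg ha.le (sq_nonneg ‖g‖)]
    rcases (norm_nonneg g).eq_or_lt with h0 | h0
    · rw [← h0, mul_zero]; positivity
    · exact le_of_mul_le_mul_left k10 h0
  -- energy of the first component
  set h := ‖cutoff (highFreq δ) (measurableSet_highFreq δ) (fourierW a (mulB a c.sQ f))‖ with hh
  -- The loss `-a ‖√p f‖²` from `∂` and the gain `(a + a³) ‖ρ f‖²` from `S` cancel up to `(4am +
  -- 2a³) ‖f‖²`; what survives is the gap on the high frequencies of `ρ f`.
  have E₂ : a * δ ^ 2 / 16 * h ^ 2 ≤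
      ‖f‖ * Y + a * δ ^ 2 / 512 * ‖f‖ ^ 2 + η₀ * ‖f‖ * ‖g‖ := by
    have k1 : (inner ℂ f w.fst).re = lam.re * ‖f‖ ^ 2 -
        ((inner ℂ (mulB a c.sP f) d₁).re + (inner ℂ (mulB a c.sQ f) s₁).re +
          (inner ℂ f e₁₁).re + (inner ℂ f j₁₂).re) := by
      rw [hw₁, inner_sub_right, inner_add_right, inner_add_right, inner_add_right, inner_mulB,
        inner_mulB, Complex.sub_re, Complex.add_re, Complex.add_re, Complex.add_re, hlamin]
    rw [re_inner_dSymbol B.d_sP] at k1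
    have k2 := re_inner_sSymbol_le ha H.a_le H.ε_sq_le B.s_sQ H.δ_pos hδ1 H.a_sq_le
    rw [← hh] at k2
    have k3 := (hinner f w.fst).2
    have k4 := (hinner f e₁₁).2
    have k5 := (hinner f j₁₂).2
    have k6 : ((1 - m) * ‖f‖) ^ 2 ≤ ‖mulB a c.sP f‖ ^ 2 :=
      pow_le_pow_left₀ (mul_nonneg (by linarith) (norm_nonneg _)) (hsP f) 2
    have k7 : ‖mulB a c.sQ f‖ ^ 2 ≤ ((1 + m) * ‖f‖) ^ 2 :=
      pow_le_pow_left₀ (norm_nonneg _) hsQ 2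
    have k8 : (a + a ^ 3) * ‖mulB a c.sQ f‖ ^ 2 - a * ‖mulB a c.sP f‖ ^ 2 ≤
        (4 * a * m + 2 * a ^ 3) * ‖f‖ ^ 2 := by
      have q1 : (a + a ^ 3) * ‖mulB a c.sQ f‖ ^ 2 ≤ (a + a ^ 3) * ((1 + m) * ‖f‖) ^ 2 := by gcongr
      have q2 : a * ((1 - m) * ‖f‖) ^ 2 ≤ a * ‖mulB a c.sP f‖ ^ 2 := by gcongr
      have q3 : (1 + m) ^ 2 ≤ 2 := by
        have := mul_le_of_le_one_left hm0 (by linarith : m ≤ 1)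
        linarith
      have q4 : a ^ 3 * (1 + m) ^ 2 * ‖f‖ ^ 2 ≤ a ^ 3 * 2 * ‖f‖ ^ 2 := by gcongr
      linarith
    have q1 : ‖f‖ * ‖w.fst‖ ≤ ‖f‖ * Y := by gcongr
    have q2 : ‖f‖ * ‖e₁₁‖ ≤ ‖f‖ * (η₀ * ‖f‖) := by gcongr
    have q3 : ‖f‖ * ‖j₁₂‖ ≤ ‖f‖ * (η₀ * ‖g‖) := by gcongr
    have q4 : -(a * δ ^ 2 / 1024) * ‖f‖ ^ 2 ≤ lam.re * ‖f‖ ^ 2 :=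
      mul_le_mul_of_nonneg_right hre (sq_nonneg _)
    have q5 : (4 * a * m + 2 * a ^ 3 + η₀) * ‖f‖ ^ 2 ≤ a * δ ^ 2 / 1024 * ‖f‖ ^ 2 :=
      mul_le_mul_of_nonneg_right hcub (sq_nonneg _)
    linarith
  -- low frequencies of the first component
  set l := ‖cutoff (highFreq δ)ᶜ (measurableSet_highFreq δ).compl (fourierW a f)‖ with hl
  have E₃ : θ / 2 * l ≤ Y + η₀ * (‖f‖ + ‖g‖) + 4 * (δ + a) * m * ‖f‖ := by
    refine (norm_cutoff_low_le ha H.a_le H.ε_sq_le H.θ_pos H.δ_add_le H.δ_pos hlam hdf B.s_f B.d_P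
      B.s_Q).trans ?_
    have k1 : lam • f - (df + sf + (g₁ + g₂)) = w.fst + (j₁₁ + j₁₂) := by
      rw [hw₁']; abel
    have k2 := abs_norm_mulB_sub_le hε c.wiener_P f
    have k3 := abs_norm_mulB_sub_le hε c.wiener_Q f
    have k4 : ‖lam • f - (df + sf + (g₁ + g₂))‖ ≤ Y + (η₀ * ‖f‖ + η₀ * ‖g‖) := by
      rw [k1]
      exact (norm_add_le _ _).trans (add_le_add hY₁ ((norm_add_le _ _).trans (add_le_add n₂ n₄)))
    have k5 : 2 * (δ + a) * (‖mulB a c.P f - f‖ + ‖mulB a c.Q f - f‖) ≤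
        2 * (δ + a) * (m * ‖f‖ + m * ‖f‖) := by
      have := H.δ_pos
      gcongr
    linarith
  have E₄ := norm_sq_eq_cutoff_add (highFreq δ) (measurableSet_highFreq δ) (fourierW a f)
  rw [LinearIsometryEquiv.norm_map, ← hl] at E₄
  -- The gap controls the high frequencies of `ρ f`, not of `f`; the exchange costs `m ‖f‖`.
  have E₅ : ‖cutoff (highFreq δ) (measurableSet_highFreq δ) (fourierW a f)‖ ≤ h + m * ‖f‖ := by
    have k1 : fourierW a f = fourierW a (mulB a c.sQ f) - fourierW a (mulB a c.sQ f - f) := by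
      rw [← map_sub, sub_sub_cancel]
    rw [k1, map_sub]
    refine (norm_sub_le _ _).trans (add_le_add le_rfl ?_)
    refine (norm_cutoff_le _ _ _).trans ?_
    rw [LinearIsometryEquiv.norm_map]
    exact abs_norm_mulB_sub_le hε c.wiener_sQ f
  have key := apriori_arith (norm_nonneg f) (norm_nonneg _) (norm_nonneg _)
    (norm_nonneg w) ha H.δ_pos H.θ_pos H.θ_le H.δ_add_le hm0 (by linarith) hη₀ hηle E₁ E₂ E₃
    E₄ E₅
  have hz3 := (norm_fst_snd_le z).2.2
  have : a * δ ^ 2 * ‖z‖ ≤ a * δ ^ 2 * (‖f‖ + ‖g‖) := by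
    have := H.δ_pos
    gcongr
  linarith

/-! ### Existence of the resolvent -/

section resolvent

variable {E : Type*} [NormedAddCommGroup E] [NormedSpace ℂ E] [CompleteSpace E]

/-- An a priori bound and an approximate right inverse give the resolvent. -/
theorem exists_isResolventAt {A : E →ₗ.[ℂ] E} {lam : ℂ} {c : ℝ} (hc : 0 < c)
    (hA : ∀ x : A.domain, c * ‖(x : E)‖ ≤ ‖lam • (x : E) - A x‖) (R₀ : E →L[ℂ] E)
    (hR₀ : ∀ y, R₀ y ∈ A.domain)
    (hR₀' : ∀ y, ‖y - (lam • R₀ y - A ⟨R₀ y, hR₀ y⟩)‖ ≤ 1 / 2 * ‖y‖) :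
    ∃ R, IsResolventAt A lam R ∧ ‖R‖ ≤ 1 / c := by
  let T : E →ₗ[ℂ] E :=
    { toFun := fun y => y - (lam • R₀ y - A ⟨R₀ y, hR₀ y⟩)
      map_add' := fun y z => by
        have h : A ⟨R₀ (y + z), hR₀ (y + z)⟩ = A ⟨R₀ y, hR₀ y⟩ + A ⟨R₀ z, hR₀ z⟩ := by
          rw [← LinearPMap.map_add]
          congr 1
          ext1
          exact map_add R₀ y z
        rw [h, map_add, smul_add]
        abel
      map_smul' := fun r y => by
        have h : A ⟨R₀ (r • y), hR₀ (r • y)⟩ = r • A ⟨R₀ y, hR₀ y⟩ := by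
          rw [← LinearPMap.map_smul]
          congr 1
          ext1
          exact map_smul R₀ r y
        rw [h, map_smul, RingHom.id_apply, smul_sub, smul_sub, smul_comm] }
  -- Since `(lam - A) R₀ = 1 - T` with `‖T‖ ≤ 1/2`, a Neumann series makes `R₀ (1 - T)⁻¹` a right
  -- inverse. The a priori bound makes it a left inverse through injectivity, and also gives the
  -- norm `1/c`, independently of `R₀`.
  let T' : E →L[ℂ] E := T.mkContinuous (1 / 2) hR₀'
  have hT' : ‖T'‖ < 1 := (T.mkContinuous_norm_le (by norm_num) _).trans_lt (by norm_num)
  let V := Units.oneSub T' hT'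
  let W : E →L[ℂ] E := (V⁻¹ : (E →L[ℂ] E)ˣ)
  have hVW : ∀ y, W y - T' (W y) = y := fun y => by
    have h : (V : E →L[ℂ] E) * W = 1 := V.mul_inv
    exact congrArg (fun L : E →L[ℂ] E => L y) h
  have hright : ∀ y, lam • R₀ (W y) - A ⟨R₀ (W y), hR₀ (W y)⟩ = y := fun y => by
    have h := hVW y
    have e : T' (W y) = W y - (lam • R₀ (W y) - A ⟨R₀ (W y), hR₀ (W y)⟩) := rfl
    rwa [e, sub_sub_cancel] at h
  refine ⟨R₀ ∘L W, ⟨fun y => hR₀ (W y), hright, fun x => ?_⟩, ?_⟩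
  · set y := lam • (x : E) - A x with hy
    have h := hright y
    have h1 := hA (⟨R₀ (W y), hR₀ (W y)⟩ - x)
    have e : lam • ((⟨R₀ (W y), hR₀ (W y)⟩ - x : A.domain) : E) -
        A (⟨R₀ (W y), hR₀ (W y)⟩ - x) = 0 := by
      rw [LinearPMap.map_sub, Submodule.coe_sub, smul_sub]
      calc _ = (lam • R₀ (W y) - A ⟨R₀ (W y), hR₀ (W y)⟩) - (lam • (x : E) - A x) := by
            simp only; abel
        _ = 0 := by rw [h, hy, sub_self]
    rw [e, norm_zero] at h1
    have h2 : ‖((⟨R₀ (W y), hR₀ (W y)⟩ - x : A.domain) : E)‖ = 0 :=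
      le_antisymm (nonpos_of_mul_nonpos_right h1 hc) (norm_nonneg _)
    rw [Submodule.coe_sub, norm_eq_zero, sub_eq_zero] at h2
    exact h2
  · refine ContinuousLinearMap.opNorm_le_bound _ (by positivity) fun y => ?_
    have h1 := hA ⟨R₀ (W y), hR₀ (W y)⟩
    rw [hright y] at h1
    rw [one_div, inv_mul_eq_div, le_div_iff₀ hc, mul_comm]
    exact h1

/-- The known resolvent is the approximate inverse, with defect `(lam' - lam) R` of norm at most
`(c/2)(1/c)`. The same bound `1/c` is reproduced, so steps of fixed length can be iterated. -/
theorem IsResolventAt.exists_of_near {A : E →ₗ.[ℂ] E} {lam lam' : ℂ} {c : ℝ} (hc : 0 < c)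
    {R : E →L[ℂ] E} (hR : IsResolventAt A lam R) (hRn : ‖R‖ ≤ 1 / c)
    (hA : ∀ x : A.domain, c * ‖(x : E)‖ ≤ ‖lam' • (x : E) - A x‖) (h : ‖lam' - lam‖ ≤ c / 2) :
    ∃ R', IsResolventAt A lam' R' ∧ ‖R'‖ ≤ 1 / c := by
  refine exists_isResolventAt hc hA R hR.mem_domain fun y => ?_
  have e : y - (lam' • R y - A ⟨R y, hR.mem_domain y⟩) = -((lam' - lam) • R y) := by
    nth_rewrite 1 [← hR.right_inv y]
    rw [sub_smul]
    abel
  rw [e, norm_neg, norm_smul]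
  calc _ ≤ c / 2 * (1 / c * ‖y‖) := by
        gcongr
        exact (R.le_opNorm y).trans (by gcongr)
    _ = _ := by field_simp

/-- Continuation of the resolvent along a segment on which the a priori bound holds. -/
theorem IsResolventAt.exists_of_segment {A : E →ₗ.[ℂ] E} {lam lam' : ℂ} {c : ℝ} (hc : 0 < c)
    (hA : ∀ t : ℝ, 0 ≤ t → t ≤ 1 → ∀ x : A.domain,
      c * ‖(x : E)‖ ≤ ‖(lam + t * (lam' - lam)) • (x : E) - A x‖)
    (h : ∃ R, IsResolventAt A lam R ∧ ‖R‖ ≤ 1 / c) :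
    ∃ R, IsResolventAt A lam' R ∧ ‖R‖ ≤ 1 / c := by
  obtain ⟨n, hn⟩ := exists_nat_gt (2 * ‖lam' - lam‖ / c)
  have hn0 : (0 : ℝ) < n := lt_of_le_of_lt (by positivity) hn
  have key : ∀ k : ℕ, k ≤ n →
      ∃ R, IsResolventAt A (lam + (k / n : ℝ) * (lam' - lam)) R ∧ ‖R‖ ≤ 1 / c := by
    intro k
    induction k with
    | zero => intro _; simpa using h
    | succ k ih =>
      intro hk
      obtain ⟨R, hR, hRn⟩ := ih (by omega)
      have hk' : ((k + 1 : ℕ) : ℝ) ≤ n := by exact_mod_cast hk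
      refine hR.exists_of_near hc hRn (hA _ (by positivity) ((div_le_one hn0).2 hk')) ?_
      have e : lam + (((k + 1 : ℕ) : ℝ) / n : ℝ) * (lam' - lam) -
          (lam + (k / n : ℝ) * (lam' - lam)) = ((1 / n : ℝ) : ℂ) * (lam' - lam) := by
        push_cast
        ring
      rw [e, norm_mul, Complex.norm_real, Real.norm_of_nonneg (by positivity)]
      rw [div_lt_iff₀ hc] at hn
      rw [div_mul_eq_mul_div, one_mul, div_le_iff₀ hn0]
      linarith
  have h1 := key n le_rfl
  rwa [div_self hn0.ne', Complex.ofReal_one, one_mul, add_sub_cancel] at h1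

/-- The region `|lam| ≥ r`, `Re lam ≥ -x₀` is connected by segments to the point `4`. -/
theorem exists_isResolventAt_of_region {A : E →ₗ.[ℂ] E} {c r x₀ : ℝ} (hc : 0 < c)
    (hr1 : r ≤ 1) (hx₀ : 0 ≤ x₀)
    (hA : ∀ lam : ℂ, r ≤ ‖lam‖ → -x₀ ≤ lam.re → ∀ x : A.domain,
      c * ‖(x : E)‖ ≤ ‖lam • (x : E) - A x‖)
    (h₀ : ∃ R, IsResolventAt A 4 R ∧ ‖R‖ ≤ 1 / c) {lam : ℂ} (hlam : r ≤ ‖lam‖)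
    (hre : -x₀ ≤ lam.re) : ∃ R, IsResolventAt A lam R ∧ ‖R‖ ≤ 1 / c := by
  obtain ⟨x, y⟩ := lam
  simp only at hre
  -- the ordinate of the horizontal segment
  obtain ⟨y', hy'r, hy'⟩ : ∃ y' : ℝ, r ≤ |y'| ∧ ∀ t : ℝ, 0 ≤ t → t ≤ 1 →
      |y| ≤ |y' + t * (y - y')| := by
    rcases le_total r |y| with h | h
    · exact ⟨y, h, fun t _ _ => by simp⟩
    · rcases le_total 0 y with h0 | h0
      · rw [abs_of_nonneg h0] at h ⊢
        refine ⟨r, le_abs_self r, fun t ht ht1 => le_trans ?_ (le_abs_self _)⟩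
        nlinarith
      · rw [abs_of_nonpos h0] at h ⊢
        refine ⟨-r, by rw [abs_neg]; exact le_abs_self r,
          fun t ht ht1 => le_trans ?_ (neg_le_abs _)⟩
        nlinarith
  -- The path is `4 → 4 + iy' → x + iy' → x + iy`. The first leg has real part `4 ≥ r`; on the
  -- second the ordinate has modulus at least `r`; on the third the ordinate never drops below `|y|`
  -- in modulus, so the norm stays at least that of the endpoint.
  have h₁ : ∃ R, IsResolventAt A ⟨4, y'⟩ R ∧ ‖R‖ ≤ 1 / c := by
    refine IsResolventAt.exists_of_segment hc (fun t ht ht1 => hA _ ?_ ?_) h₀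
    · refine le_trans ?_ (Complex.abs_re_le_norm _)
      simp
      linarith
    · simp
      linarith
  have h₂ : ∃ R, IsResolventAt A ⟨x, y'⟩ R ∧ ‖R‖ ≤ 1 / c := by
    refine IsResolventAt.exists_of_segment hc (fun t ht ht1 => hA _ ?_ ?_) h₁
    · refine le_trans ?_ (Complex.abs_im_le_norm _)
      simpa using hy'r
    · simp
      nlinarith
  refine IsResolventAt.exists_of_segment hc (fun t ht ht1 => hA _ ?_ ?_) h₂
  · refine hlam.trans (le_of_sq_le_sq ?_ (norm_nonneg _))
    rw [Complex.sq_norm, Complex.sq_norm, Complex.normSq_apply, Complex.normSq_apply]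
    have := sq_le_sq.2 (hy' t ht ht1)
    simp
    nlinarith
  · simpa using hre

end resolvent

/-! ### The resolvent at a base point -/

theorem FM.unique {a : ℝ} {m : ℂ → ℂ} {f g g' : L2w a} (h : FM a m f g) (h' : FM a m f g') :
    g = g' :=
  (fourierW a).injective (Lp.ext (h.trans h'.symm))

/-- The inverse of `4 - ∂ - s S`, `s = ±1`, as a bounded operator. -/
theorem exists_base_inverse {a ε s : ℝ} (ha : 0 < a) (ha' : a ≤ 1 / 2) (hε2 : ε ^ 2 ≤ 1 / 2)
    (hs : s = 1 ∨ s = -1) : ∃ R : L2w a →L[ℂ] L2w a, ∀ y, ‖R y‖ ≤ 4 * ‖y‖ ∧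
      ∃ df sf, FM a dSymbol (R y) df ∧ FM a (sSymbol ε) (R y) sf ∧
        (4 : ℂ) • R y - (df + (s : ℂ) • sf) = y ∧ ‖df‖ ≤ 4 * ‖y‖ ∧ ‖sf‖ ≤ 8 * ‖y‖ := by
  set σ : ℂ → ℂ := fun ξ => (4 : ℂ) - (Complex.I * ξ + s * sSymbol ε ξ) with hσ
  have hσm : Measurable fun κ : ℝ => σ (freq a (2 * Real.pi * κ)) :=
    measurable_const.sub (((measurable_freq a).const_mul _).add
      (((measurable_sSymbol ε).comp (measurable_freq a)).const_mul _))
  have hlow : ∀ k : ℝ, (1 + |k|) / 4 ≤ ‖σ (freq a k)‖ := fun k =>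
    le_norm_sub_symbol ha ha' hε2 k hs
  have hσ0 : ∀ k : ℝ, 0 < ‖σ (freq a k)‖ := fun k =>
    lt_of_lt_of_le (by positivity) (hlow k)
  have hb : ∀ κ : ℝ, ‖(σ (freq a (2 * Real.pi * κ)))⁻¹‖ ≤ 4 := fun κ => by
    rw [norm_inv, inv_le_comm₀ (hσ0 _) (by norm_num)]
    refine le_trans ?_ (hlow _)
    linarith [abs_nonneg (2 * Real.pi * κ)]
  set Mσ := mulCLM volume (fun κ => (σ (freq a (2 * Real.pi * κ)))⁻¹) 4
    hσm.inv.aestronglyMeasurable hb with hMσ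
  set U : L2w a →L[ℂ] Lp ℂ 2 (volume : Measure ℝ) :=
    (fourierW a).toLinearIsometry.toContinuousLinearMap
  set V : Lp ℂ 2 (volume : Measure ℝ) →L[ℂ] L2w a :=
    (fourierW a).symm.toLinearIsometry.toContinuousLinearMap
  refine ⟨V ∘L Mσ ∘L U, fun y => ?_⟩
  set f := (V ∘L Mσ ∘L U) y with hf
  have hUf : fourierW a f =ᵐ[volume] fun κ => (σ (freq a (2 * Real.pi * κ)))⁻¹ *
      fourierW a y κ := by
    have e : fourierW a f = Mσ (fourierW a y) := (fourierW a).apply_symm_apply _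
    rw [e]
    exact mulCLM_ae _ _ _
  have hfn : ‖f‖ ≤ 4 * ‖y‖ := by
    rw [← (fourierW a).norm_map f, ← (fourierW a).norm_map y]
    refine Lp.norm_le_mul_norm_of_ae_le_mul ?_
    filter_upwards [hUf] with κ hκ
    rw [hκ, norm_mul]
    exact mul_le_mul_of_nonneg_right (hb κ) (norm_nonneg _)
  have hpt : ∀ᵐ κ, ‖dSymbol (freq a (2 * Real.pi * κ)) * fourierW a f κ‖ ≤
      4 * ‖fourierW a y κ‖ := by
    filter_upwards [hUf] with κ hκ
    rw [hκ, norm_mul, norm_mul, norm_mul, Complex.norm_I, one_mul, norm_inv, ← mul_assoc]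
    refine mul_le_mul_of_nonneg_right ?_ (norm_nonneg _)
    rw [← div_eq_mul_inv, div_le_iff₀ (hσ0 _)]
    have h1 := norm_freq_le ha.le (2 * Real.pi * κ)
    have h2 := hlow (2 * Real.pi * κ)
    linarith
  obtain ⟨df, hdf⟩ := exists_FM_of_memLp (a := a) (m := dSymbol) (f := f)
    (MemLp.of_le_mul (Lp.memLp (fourierW a y))
      ((((measurable_freq a).const_mul _).aestronglyMeasurable).mul (Lp.memLp _).1) hpt)
  have hdfn : ‖df‖ ≤ 4 * ‖y‖ := by
    rw [← (fourierW a).norm_map df, ← (fourierW a).norm_map y]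
    refine Lp.norm_le_mul_norm_of_ae_le_mul ?_
    filter_upwards [hpt, hdf] with κ h1 h2
    rwa [h2]
  obtain ⟨sf, hsf, hsfn⟩ := exists_FM_sSymbol ha ha' hε2 hdf
  refine ⟨hfn, df, sf, hdf, hsf, ?_, hdfn, by linarith⟩
  refine (fourierW a).injective (Lp.ext ?_)
  have e : fourierW a ((4 : ℂ) • f - (df + (s : ℂ) • sf)) =
      (4 : ℂ) • fourierW a f - (fourierW a df + (s : ℂ) • fourierW a sf) := by
    rw [map_sub, map_add, LinearIsometryEquiv.map_smul, LinearIsometryEquiv.map_smul]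
  rw [e]
  filter_upwards [hUf, hdf, hsf,
    Lp.coeFn_sub ((4 : ℂ) • fourierW a f) (fourierW a df + (s : ℂ) • fourierW a sf),
    Lp.coeFn_smul (4 : ℂ) (fourierW a f), Lp.coeFn_smul (s : ℂ) (fourierW a sf),
    Lp.coeFn_add (fourierW a df) ((s : ℂ) • fourierW a sf)] with κ h1 h2 h3 h4 h5 h6 h7
  rw [h4, Pi.sub_apply, h5, h7, Pi.add_apply, h6, Pi.smul_apply, Pi.smul_apply, h2, h3,
    smul_eq_mul, smul_eq_mul]
  have h8 : (4 : ℂ) * fourierW a f κ - (dSymbol (freq a (2 * Real.pi * κ)) * fourierW a f κ +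
      s * (sSymbol ε (freq a (2 * Real.pi * κ)) * fourierW a f κ)) =
      σ (freq a (2 * Real.pi * κ)) * fourierW a f κ := by
    rw [hσ]; ring
  rw [h8, h1, mul_inv_cancel_left₀ (norm_pos_iff.1 (hσ0 _))]

/-- The approximate inverse is diagonal, with entries `(4 - ∂ - S)⁻¹` and `(4 - ∂ + S)⁻¹`. As `∂`
and `S` remain bounded after these inverses, the variable coefficients leave a defect made of
multiples of `Mε²` and `Mε³`, hence small. -/
theorem exists_isResolventAt_four {M ε a δ θ : ℝ} {ω : ℝ → ℝ} (c : Coeffs M ε ω)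
    (H : SmallParams M ε a δ θ) :
    ∃ R, IsResolventAt (opA a ε ω) 4 R ∧ ‖R‖ ≤ 1 / (a * δ ^ 2 / 300) := by
  have hε := H.ε_pos
  have ha := H.a_pos
  have hδ := H.δ_pos
  have hδ1 : δ ≤ 1 := by linarith [H.δ_add_le, H.θ_le]
  have hδ21 : δ ^ 2 ≤ 1 := pow_le_one₀ hδ.le hδ1
  have hM4 : M * ε ^ 2 ≤ 1 / 4 := H.M_le.trans (by norm_num)
  have hM0 := H.M_nonneg
  obtain ⟨Rp, hRp⟩ := exists_base_inverse ha H.a_le H.ε_sq_le (Or.inl rfl)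
  obtain ⟨Rm, hRm⟩ := exists_base_inverse ha H.a_le H.ε_sq_le (Or.inr rfl)
  set R₀ : WithLp 2 (L2w a × L2w a) →L[ℂ] WithLp 2 (L2w a × L2w a) :=
    ((WithLp.prodContinuousLinearEquiv 2 ℂ (L2w a) (L2w a)).symm :
      L2w a × L2w a →L[ℂ] WithLp 2 (L2w a × L2w a)) ∘L (Rp.prodMap Rm) ∘L
    (WithLp.prodContinuousLinearEquiv 2 ℂ (L2w a) (L2w a) :
      WithLp 2 (L2w a × L2w a) →L[ℂ] L2w a × L2w a) with hR₀
  have key : ∀ y, ∃ v, Acts (opA a ε ω) (R₀ y) v ∧ ‖y - ((4 : ℂ) • R₀ y - v)‖ ≤ 1 / 2 * ‖y‖ := by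
    intro y
    obtain ⟨nf, df, sf, hdf, hsf, hf4, ndf, nsf⟩ := hRp y.fst
    obtain ⟨ng, dg, sg, hdg, hsg, hg4, ndg, nsg⟩ := hRm y.snd
    have e₁ : (R₀ y).fst = Rp y.fst := rfl
    have e₂ : (R₀ y).snd = Rm y.snd := rfl
    rw [← e₁] at hdf hsf hf4 nf
    rw [← e₂] at hdg hsg hg4 ng
    obtain ⟨sf', d₁, s₁, g₁, g₂, j₁₁, _, j₂₁, _, _, B⟩ :=
      exists_blockFormula c hM0 ha H.a_le hε H.ε_sq_le hM4 hdf
    obtain ⟨sg', d₁', s₁', _, _, _, j₁₂, _, _, e₂₂, B'⟩ :=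
      exists_blockFormula c hM0 ha H.a_le hε H.ε_sq_le hM4 hdg
    obtain rfl := B.s_f.unique hsf
    obtain rfl := B'.s_f.unique hsg
    refine ⟨_, acts_opA B.acts₁₁' B'.acts₁₂ B.acts₂₁ B'.acts₂₂, ?_⟩
    set v := y - ((4 : ℂ) • R₀ y - WithLp.toLp 2 (df + sf' + (g₁ + g₂) + j₁₁ + j₁₂,
      j₂₁ + (mulB a c.sP d₁' - mulB a c.sQ s₁' + e₂₂))) with hv
    have hv₁ : v.fst = (g₁ - (mulB a c.sP d₁ - df)) + (mulB a c.sP d₁ - df) +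
        ((g₂ - (mulB a c.sQ s₁ - sf')) + (mulB a c.sQ s₁ - sf')) + j₁₁ + j₁₂ := by
      have : v.fst = y.fst - ((4 : ℂ) • (R₀ y).fst - (df + sf' + (g₁ + g₂) + j₁₁ + j₁₂)) := rfl
      rw [this]
      nth_rewrite 1 [← hf4]
      rw [Complex.ofReal_one, one_smul]
      abel
    have hv₂ : v.snd = (mulB a c.sP d₁' - dg) - (mulB a c.sQ s₁' - sg') + e₂₂ + j₂₁ := by
      have : v.snd = y.snd - ((4 : ℂ) • (R₀ y).snd -
        (j₂₁ + (mulB a c.sP d₁' - mulB a c.sQ s₁' + e₂₂))) := rfl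
      rw [this]
      nth_rewrite 1 [← hg4]
      rw [Complex.ofReal_neg, Complex.ofReal_one, neg_smul, one_smul]
      abel
    obtain ⟨η₀, hη₀⟩ : ∃ η₀, η₀ = 400 * M * ε ^ 3 := ⟨_, rfl⟩
    have hη0 : 0 ≤ η₀ := by rw [hη₀]; positivity
    have hη1 : η₀ ≤ 1 / 10000 := by
      have h1 := H.cubic_le
      have h2 : 0 ≤ 4 * a * (M * ε ^ 2) + 2 * a ^ 3 := by positivity
      have h3 : a * δ ^ 2 ≤ 1 / 2 * 1 := mul_le_mul H.a_le hδ21 (sq_nonneg _) (by norm_num)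
      linarith
    obtain ⟨m, hm⟩ : ∃ m, m = M * ε ^ 2 := ⟨_, rfl⟩
    have hm0 : 0 ≤ m := by rw [hm]; positivity
    have hm1 : m ≤ 1 / 200 := by rw [hm]; exact H.M_le
    have b₁ := B.norm_g₁
    have b₂ := B.norm_g₂
    have b₃ := B.norm_d₁
    have b₄ := B.norm_s₁
    have b₅ := B.norm_j₁₁
    have b₆ := B'.norm_j₁₂
    have b₇ := B'.norm_d₁
    have b₈ := B'.norm_s₁
    have b₉ := B'.norm_e₂₂
    have b₁₀ := B.norm_j₂₁
    rw [← hη₀] at b₁ b₂ b₃ b₄ b₅ b₆ b₇ b₈ b₉ b₁₀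
    rw [← hm] at b₃ b₄ b₇ b₈
    obtain ⟨hy₁, hy₂, -⟩ := norm_fst_snd_le y
    have t : ∀ {A x Y : ℝ}, 0 ≤ A → x ≤ 4 * Y → Y ≤ ‖y‖ → A * x ≤ 4 * A * ‖y‖ := by
      intro A x Y hA hx hY
      calc A * x ≤ A * (4 * ‖y‖) := by gcongr; linarith
        _ = _ := by ring
    have t₁ := t hη0 nf hy₁
    have t₂ := t hη0 ng hy₂
    have t₃ := t hm0 ndf hy₁
    have t₄ := t hm0 ndg hy₂
    have t₅ : m * ‖sf'‖ ≤ 8 * m * ‖y‖ := by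
      calc m * ‖sf'‖ ≤ m * (8 * ‖y‖) := by gcongr; linarith
        _ = _ := by ring
    have t₆ : m * ‖sg'‖ ≤ 8 * m * ‖y‖ := by
      calc m * ‖sg'‖ ≤ m * (8 * ‖y‖) := by gcongr; linarith
        _ = _ := by ring
    have n₁ : ‖v.fst‖ ≤ 1 / 4 * ‖y‖ := by
      rw [hv₁]
      have k₁ := norm_add₄_le (a := (g₁ - (mulB a c.sP d₁ - df)) + (mulB a c.sP d₁ - df))
        (b := (g₂ - (mulB a c.sQ s₁ - sf')) + (mulB a c.sQ s₁ - sf')) (c := j₁₁) (d := j₁₂)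
      have k₂ := norm_add_le (g₁ - (mulB a c.sP d₁ - df)) (mulB a c.sP d₁ - df)
      have k₃ := norm_add_le (g₂ - (mulB a c.sQ s₁ - sf')) (mulB a c.sQ s₁ - sf')
      have k₄ : m * ‖y‖ ≤ 1 / 200 * ‖y‖ := by gcongr
      have k₅ : η₀ * ‖y‖ ≤ 1 / 10000 * ‖y‖ := by gcongr
      linarith [norm_nonneg y]
    have n₂ : ‖v.snd‖ ≤ 1 / 4 * ‖y‖ := by
      rw [hv₂]
      have k₁ := norm_add₃_le (a := (mulB a c.sP d₁' - dg) - (mulB a c.sQ s₁' - sg')) (b := e₂₂)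
        (c := j₂₁)
      have k₂ := norm_sub_le (mulB a c.sP d₁' - dg) (mulB a c.sQ s₁' - sg')
      have k₄ : m * ‖y‖ ≤ 1 / 200 * ‖y‖ := by gcongr
      have k₅ : η₀ * ‖y‖ ≤ 1 / 10000 * ‖y‖ := by gcongr
      linarith [norm_nonneg y]
    linarith [(norm_fst_snd_le v).2.2]
  refine exists_isResolventAt (by positivity) (fun x => ?_) R₀ (fun y => (key y).choose_spec.1.mem)
    fun y => ?_
  · refine apriori c H ?_ ?_ x
    · have : ‖(4 : ℂ)‖ = 4 := by norm_num
      rw [this]; linarith [H.θ_le]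
    · have : 0 ≤ a * δ ^ 2 := by positivity
      have h4 : ((4 : ℂ)).re = 4 := by norm_num
      rw [h4]; linarith
  · obtain ⟨h1, h2⟩ := (key y).choose_spec
    rwa [h1.apply_eq]

/-! ### Choice of the parameters -/

theorem exists_rpow_lt {r η : ℝ} (hr : 0 < r) (hη : 0 < η) :
    ∃ ε₀ > 0, ∀ ε : ℝ, 0 < ε → ε < ε₀ → ε ^ r < η := by
  refine ⟨η ^ r⁻¹, Real.rpow_pos_of_pos hη _, fun ε hε h => ?_⟩
  have := Real.rpow_lt_rpow hε.le h hr
  rwa [← Real.rpow_mul hη.le, inv_mul_cancel₀ hr.ne', Real.rpow_one] at this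

/-- `δ = ε^ν'` with `ν'` halfway between `ν` and `ν̂`. Writing `u = ε^(1-ν')` and `v =
ε^((ν̂-ν)/2)`, one has `ε = δ u`, `δ = θ v` and `ε^(1+2ν̂) = ε δ² v²`; all conditions then follow
from `u` and `v` being small. -/
theorem exists_smallParams {α ν νh M : ℝ} (hα₀ : 0 < α) (hα₁ : α ≤ 1 / 2) (hν : 0 < ν)
    (hννh : ν < νh) (hνh : νh < 1) (hM : 0 ≤ M) :
    ∃ ε₀ > 0, ∀ ε : ℝ, 0 < ε → ε < ε₀ → ∃ δ, SmallParams M ε (α * ε) δ (ε ^ ν) ∧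
      1 / 12 * α * ε ^ (1 + 2 * νh) ≤ α * ε * δ ^ 2 / 1024 := by
  obtain ⟨s, hs⟩ : ∃ s, s = (νh - ν) / 2 := ⟨_, rfl⟩
  obtain ⟨ν', hν'⟩ : ∃ ν', ν' = (ν + νh) / 2 := ⟨_, rfl⟩
  have hs0 : 0 < s := by rw [hs]; linarith
  have hν'1 : 0 < 1 - ν' := by rw [hν']; linarith
  obtain ⟨D, hD⟩ : ∃ D, D = 4 * α * M + 2 * α ^ 3 + 3200 * M := ⟨_, rfl⟩
  have hD0 : 0 ≤ D := by rw [hD]; positivity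
  obtain ⟨ε₁, hε₁, h₁⟩ := exists_rpow_lt hs0 (by norm_num : (0 : ℝ) < 1 / 100)
  obtain ⟨ε₂, hε₂, h₂⟩ := exists_rpow_lt hν'1
    (by positivity : (0 : ℝ) < min (1 / 2) (α / (1024 * (D + 1))))
  refine ⟨min (min ε₁ ε₂) (min (1 / 2) (1 / (200 * (M + 1)))), by positivity, fun ε hε hlt => ?_⟩
  have hv := h₁ ε hε (hlt.trans_le ((min_le_left _ _).trans (min_le_left _ _)))
  have hu := h₂ ε hε (hlt.trans_le ((min_le_left _ _).trans (min_le_right _ _)))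
  have hε2 : ε < 1 / 2 := hlt.trans_le ((min_le_right _ _).trans (min_le_left _ _))
  have hεM : ε < 1 / (200 * (M + 1)) := hlt.trans_le ((min_le_right _ _).trans (min_le_right _ _))
  rw [lt_div_iff₀ (by positivity)] at hεM
  obtain ⟨δ, hδ⟩ : ∃ δ, δ = ε ^ ν' := ⟨_, rfl⟩
  obtain ⟨θ, hθ⟩ : ∃ θ, θ = ε ^ ν := ⟨_, rfl⟩
  obtain ⟨u, hu'⟩ : ∃ u, u = ε ^ (1 - ν') := ⟨_, rfl⟩
  obtain ⟨v, hv'⟩ : ∃ v, v = ε ^ s := ⟨_, rfl⟩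
  rw [← hu'] at hu
  rw [← hv'] at hv
  have hδ0 : 0 < δ := by rw [hδ]; exact Real.rpow_pos_of_pos hε _
  have hθ0 : 0 < θ := by rw [hθ]; exact Real.rpow_pos_of_pos hε _
  have hu0 : 0 < u := by rw [hu']; exact Real.rpow_pos_of_pos hε _
  have hv0 : 0 < v := by rw [hv']; exact Real.rpow_pos_of_pos hε _
  have eδ : δ = θ * v := by
    rw [hδ, hθ, hv', ← Real.rpow_add hε]; congr 1; rw [hν', hs]; ring
  have eε : ε = δ * u := by
    rw [hδ, hu', ← Real.rpow_add hε, add_sub_cancel, Real.rpow_one]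
  have eν : ε ^ (1 + 2 * νh) = ε * δ ^ 2 * v ^ 2 := by
    have e1 : δ ^ 2 * v ^ 2 = ε ^ (2 * νh) := by
      rw [← mul_pow, hδ, hv', ← Real.rpow_add hε, ← Real.rpow_natCast, ← Real.rpow_mul hε.le]
      congr 1
      rw [hν', hs]
      push_cast
      ring
    rw [Real.rpow_add hε, Real.rpow_one, ← e1]
    ring
  have hθ1 : θ ≤ 1 := by rw [hθ]; exact Real.rpow_le_one hε.le (by linarith) hν.le
  have hu1 : u ≤ 1 / 2 := hu.le.trans (min_le_left _ _)
  have huD : D * u ≤ α / 1024 := by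
    have h3 := hu.le.trans (min_le_right _ _)
    rw [le_div_iff₀ (by positivity)] at h3
    linarith
  have hεδ : ε ≤ δ / 2 := by
    rw [eε]; linarith [mul_le_mul_of_nonneg_left hu1 hδ0.le]
  have hδθ : δ ≤ θ / 100 := by
    rw [eδ]; linarith [mul_le_mul_of_nonneg_left hv.le hθ0.le]
  have haε : α * ε ≤ 1 / 2 * ε := mul_le_mul_of_nonneg_right hα₁ hε.le
  have hεsq : ε ^ 2 ≤ ε := by rw [sq]; exact mul_le_of_le_one_left hε.le (by linarith)
  refine ⟨δ, ⟨hM, hε, by linarith, by positivity, by linarith, hδ0, by rwa [← hθ],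
    by rwa [← hθ], ?_, ?_, ?_, ?_⟩, ?_⟩
  · have h3 : α * ε ≤ δ / 4 := by linarith
    calc (α * ε) ^ 2 ≤ (δ / 4) ^ 2 := pow_le_pow_left₀ (by positivity) h3 2
      _ = _ := by ring
  · rw [← hθ]; linarith
  · have h3 := mul_le_mul_of_nonneg_left hεsq hM
    linarith
  · have e1 : 4 * (α * ε) * (M * ε ^ 2) + 2 * (α * ε) ^ 3 + 3200 * M * ε ^ 3 = D * ε ^ 3 := by
      rw [hD]; ring
    have e2 : D * ε ^ 3 = D * u * (u * (δ ^ 2 * ε)) := by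
      nth_rewrite 1 [show ε ^ 3 = ε * ε * ε by ring]
      nth_rewrite 1 2 [eε]
      ring
    rw [e1, e2]
    calc D * u * (u * (δ ^ 2 * ε)) ≤ α / 1024 * (1 * (δ ^ 2 * ε)) := by
          gcongr; linarith
      _ = _ := by ring
  · rw [eν]
    have h3 : v ^ 2 ≤ 1 / 10000 := by
      calc v ^ 2 ≤ (1 / 100) ^ 2 := pow_le_pow_left₀ hv0.le hv.le 2
        _ = _ := by norm_num
    have h4 : 0 ≤ α * (ε * δ ^ 2) := by positivity
    calc 1 / 12 * α * (ε * δ ^ 2 * v ^ 2) = 1 / 12 * (α * (ε * δ ^ 2)) * v ^ 2 := by ring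
      _ ≤ 1 / 12 * (α * (ε * δ ^ 2)) * (1 / 10000) := by gcongr
      _ ≤ _ := by linarith

end SolitaryWave

end

/-! ### Conclusion: domain and resolvent bound. -/

theorem proposition9p1 (α : ℝ) (hα₀ : 0 < α) (hα₁ : α ≤ 1 / 2)
    (ν νh : ℝ) (hν : 0 < ν) (hννh : ν < νh) (hνh : νh < 1)
    (m : ℕ) (hm : 2 ≤ m) (μ : ℝ) (hμ₀ : 0 < μ) (hμ₁ : μ < 1) :
    ∃ ε₀ > 0, ∃ K > 0, ∀ ε : ℝ, 0 < ε → ε < ε₀ →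
      ∀ ω : ℝ → ℝ, SolitaryWave.IsSolitaryWave α m μ ε ω →
        (∀ z : WithLp 2 (SolitaryWave.L2w (α * ε) × SolitaryWave.L2w (α * ε)),
          z ∈ (SolitaryWave.opA (α * ε) ε ω).domain ↔
            SolitaryWave.sobolevNorm (α * ε) 1 z.fst < ⊤ ∧
            SolitaryWave.sobolevNorm (α * ε) 1 z.snd < ⊤) ∧
        ∀ lam : ℂ, ε ^ ν ≤ ‖lam‖ → -(1 / 12) * α * ε ^ (1 + 2 * νh) ≤ lam.re →
          ∃ R, SolitaryWave.IsResolventAt (SolitaryWave.opA (α * ε) ε ω) lam R ∧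
            ‖R‖ ≤ K / ε ^ (1 + 2 * νh) := by
  obtain ⟨M, hM, ε₁, hε₁, hc⟩ := SolitaryWave.exists_coeffBounds hα₀ hm hμ₀
  obtain ⟨ε₂, hε₂, hs⟩ :=
    SolitaryWave.exists_smallParams hα₀ hα₁ hν hννh hνh (zero_le_one.trans hM)
  -- The a priori bound gives norm at most `300 / (α ε δ²)`, and `ε^(1+2ν̂) ≤ ε δ²`.
  refine ⟨min ε₁ ε₂, lt_min hε₁ hε₂, 300 / α, by positivity, fun ε hε hlt ω hω => ?_⟩
  obtain ⟨δ, H, hδ⟩ := hs ε hε (hlt.trans_le (min_le_right _ _))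
  have hM4 : M * ε ^ 2 ≤ 1 / 4 := H.M_le.trans (by norm_num)
  obtain ⟨c⟩ := (hc ε hε (hlt.trans_le (min_le_left _ _)) ω hω).nonempty_coeffs hε hM4
  have hδ0 := H.δ_pos
  have hpow : 0 < ε ^ (1 + 2 * νh) := Real.rpow_pos_of_pos hε _
  refine ⟨fun z => ?_, fun lam hlam hre => ?_⟩
  · rw [← SolitaryWave.mem_dOp_iff H.a_pos H.a_le, ← SolitaryWave.mem_dOp_iff H.a_pos H.a_le]
    refine ⟨SolitaryWave.mem_dOp_of_mem_opA, fun ⟨hf, hg⟩ => ?_⟩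
    obtain ⟨_, hdf⟩ := SolitaryWave.exists_FM_of_mem hf
    obtain ⟨_, hdg⟩ := SolitaryWave.exists_FM_of_mem hg
    obtain ⟨_, _, _, _, _, _, _, _, _, _, B⟩ :=
      SolitaryWave.exists_blockFormula c H.M_nonneg H.a_pos H.a_le hε H.ε_sq_le hM4 hdf
    obtain ⟨_, _, _, _, _, _, _, _, _, _, B'⟩ :=
      SolitaryWave.exists_blockFormula c H.M_nonneg H.a_pos H.a_le hε H.ε_sq_le hM4 hdg
    exact (SolitaryWave.acts_opA B.acts₁₁ B'.acts₁₂ B.acts₂₁ B'.acts₂₂).mem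
  · obtain ⟨R, hR, hRn⟩ := SolitaryWave.exists_isResolventAt_of_region
      (c := α * ε * δ ^ 2 / 300) (r := ε ^ ν) (x₀ := α * ε * δ ^ 2 / 1024) (by positivity) H.θ_le
      (by positivity) (fun _ h₁ h₂ x => SolitaryWave.apriori c H h₁ h₂ x)
      (SolitaryWave.exists_isResolventAt_four c H) hlam (by linarith)
    refine ⟨R, hR, hRn.trans ?_⟩
    have hle : α * ε ^ (1 + 2 * νh) ≤ α * ε * δ ^ 2 := by
      have : 0 < α * ε * δ ^ 2 := by positivity
      linarith
    rw [one_div_div, div_div]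
    exact div_le_div_of_nonneg_left (by norm_num) (by positivity) hle
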